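/- Identify $S^2\subset\mathbb R^3$ with $\widehat{\mathbb C}=\mathbb C\cup\{\infty\}$ by stereographic projection. For $\alpha\subset S^2$ let $\mathcal A_\alpha$ be the group of linear fractional transformations $f$ with $f(\alpha)=\alpha$. For a regular tetrahedron ($T$), cube ($O$) or regular dodecahedron ($I$) inscribed in $S^2$ (so its center is the origin), its tetrahedral, octahedral or icosahedral group is the group of rotations carrying it to itself. Let $V$ be the set of its vertices, and $F$, $E$ the sets of projections to $S^2$, from the origin, of the central points of its faces and of the middle points of its edges. For $X\in S^2$, let $B(X)$ be the orbit of $X$ under its group, and let $\mathcal O=\{V,F,E\}\cup\{B(X): X\in S^2\setminus(V\cup F\cup E)\}$. Subscripts $T,O,I$ indicate the polyhedron. **Theorem.** Let $G$ be the tetrahedral group of a regular tetrahedron inscribed in $S^2$. Then $G\cong A_4$, and for every finite $\alpha\subset S^2$, $\mathcal A_\alpha=G$ if and only if all of the following hold: 1. $\alpha$ is a union of certain elements of $\mathcal O_T$; 2. for every regular dodecahedron inscribed in $S^2$ whose icosahedral group contains $G$, $\alpha$ is not a union of certain elements of $\mathcal O_I$; 3. for every cube inscribed in $S^2$ whose octahedral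 group contains $G$, $\alpha$ is not a union of certain elements of $\mathcal O_O$. (The empty union is allowed.) Such dodecahedra and cubes exist, and their orbits are the following. *Icosahedral case.* For every dodecahedron as in 2, there are consecutive vertices $A,B,C,D,E$ of a face such that $A\in V_T$ and the middle point of $BC$ projects into $E_T$. For every such labelling, let $N,Q,R\in S^2$ be the projections of the center of the face $ABCDE$ and of the middle points of $AB$ and $DE$, and let $g$ be the rotation that maps this face to itself and $A$ to $B$. Then $B,N,Q,R\notin V_T\cup F_T\cup E_T$, $$V_I=V_T\cup F_T\cup B_T(B),\quad F_I=B_T(N),\quad E_I=E_T\cup B_T(Q)\cup B_T(R),$$ and for every $X\in S^2\setminus(V_I\cup F_I\cup E_I)$ all $g^i(X)$, $i\ge 0$, lie outside $V_T\cup F_T\cup E_T$ and $$B_I(X)=B_T(X)\cup B_T(g(X))\cup B_T(g^2(X))\cup B_T(g^3(X))\cup B_T(g^4(X)).$$ *Octahedral case.* For every cube as in 3, there are consecutive vertices $A,B,C,D$ of a face with $A\in V_T$. For every such labelling, let $P\in S^2$ be the projection of the middle point of $AB$, and let $g$ be the rotation that maps this face to itself and $A$ to $B$. Then $P\notin V_T\cup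 F_T\cup E_T$, $$V_O=V_T\cup F_T,\quad F_O=E_T,\quad E_O=B_T(P),$$ and for every $X\in S^2\setminus(V_O\cup F_O\cup E_O)$ all $g^i(X)$, $i\ge 0$, lie outside $V_T\cup F_T\cup E_T$ and $$B_O(X)=B_T(X)\cup B_T(g(X)).$$ -/

import Mathlib

noncomputable section

/-- Euclidean three-space. -/
abbrev E3 : Type := EuclideanSpace ℝ (Fin 3)

/-- The unit sphere `S²` in Euclidean three-space. -/
abbrev S2 : Type := Metric.sphere (0 : E3) 1

/-- Stereographic projection from the north pole, `S² → ℂ ∪ {∞}`. -/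
def stereo (x : S2) : OnePoint ℂ :=
  open Classical in
  if x.1 2 = 1 then OnePoint.infty
  else (((x.1 0 : ℂ) + (x.1 1 : ℂ) * Complex.I) / (1 - (x.1 2 : ℂ)) : ℂ)

/-- The linear fractional transformations, as transformations of `S²`: under stereographic
projection they become `z ↦ (a z + b) / (c z + d)` for some invertible complex matrix. -/
def linearFractional : Subgroup (Equiv.Perm S2) where
  carrier := {f | ∃ M : GL (Fin 2) ℂ, ∀ x, stereo (f x) = M • stereo x}
  one_mem' := ⟨1, fun x => by simp⟩
  mul_mem' := by
    rintro f g ⟨M, hM⟩ ⟨N, hN⟩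
    exact ⟨M * N, fun x => by rw [Equiv.Perm.mul_apply, hM, hN, mul_smul]⟩
  inv_mem' := by
    rintro f ⟨M, hM⟩
    refine ⟨M⁻¹, fun x => ?_⟩
    have h := hM (f⁻¹ x)
    rw [show f (f⁻¹ x) = x from f.apply_symm_apply x] at h
    rw [h, inv_smul_smul]

/-- The permutations of `S²` that map the set `V` onto itself. -/
def setStabilizer (V : Set S2) : Subgroup (Equiv.Perm S2) where
  carrier := {f | f '' V = V}
  one_mem' := by simp
  mul_mem' := by
    intro f g hf hg
    simp only [Set.mem_ofPred_eq] at hf hg ⊢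
    rw [Equiv.Perm.coe_mul, Set.image_comp, hg, hf]
  inv_mem' := by
    intro f hf
    simp only [Set.mem_ofPred_eq] at hf ⊢
    conv_lhs => rw [← hf]
    rw [← Set.image_comp, ← Equiv.Perm.coe_mul]
    simp

/-- `𝒜_α`: the group of linear fractional transformations that fix the set `α`. -/
def fixingGroup (α : Set S2) : Subgroup (Equiv.Perm S2) :=
  linearFractional ⊓ setStabilizer α

/-- The rotations of `S²`: restrictions of linear isometries of determinant `1`. -/
def rotations : Subgroup (Equiv.Perm S2) where
  carrier := {f | ∃ R : E3 ≃ₗᵢ[ℝ] E3, LinearMap.det (R.toLinearEquiv : E3 →ₗ[ℝ] E3) = 1 ∧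
    ∀ x : S2, (f x : E3) = R x}
  one_mem' := ⟨LinearIsometryEquiv.refl ℝ E3, by simp, fun x => by simp⟩
  mul_mem' := by
    rintro f g ⟨R, hR, hf⟩ ⟨S, hS, hg⟩
    refine ⟨S.trans R, ?_, fun x => by simp [hf, hg]⟩
    have : ((S.trans R).toLinearEquiv : E3 →ₗ[ℝ] E3)
        = (R.toLinearEquiv : E3 →ₗ[ℝ] E3) ∘ₗ (S.toLinearEquiv : E3 →ₗ[ℝ] E3) := rfl
    rw [this, LinearMap.det_comp, hR, hS, one_mul]
  inv_mem' := by
    rintro f ⟨R, hR, hf⟩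
    refine ⟨R.symm, ?_, fun x => ?_⟩
    · have h : (R.symm.toLinearEquiv : E3 →ₗ[ℝ] E3) ∘ₗ (R.toLinearEquiv : E3 →ₗ[ℝ] E3)
          = LinearMap.id := by
        ext1 x
        simp
      have h2 := congrArg LinearMap.det h
      rw [LinearMap.det_comp, hR, mul_one, LinearMap.det_id] at h2
      exact h2
    · have h := hf (f⁻¹ x)
      rw [show f (f⁻¹ x) = x from f.apply_symm_apply x] at h
      rw [h, LinearIsometryEquiv.symm_apply_apply]

/-- The group of rotations that carry the polyhedron with vertex set `V` into itself. -/
def rotationGroup (V : Set S2) : Subgroup (Equiv.Perm S2) :=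
  rotations ⊓ setStabilizer V

/-! ### Regular polyhedra inscribed in the unit sphere (so that their centre is the origin),
given by their vertex sets -/

/-- Regular tetrahedron: four points at equal distances from one another. -/
def IsRegularTetrahedron (V : Set S2) : Prop :=
  V.ncard = 4 ∧ ∃ d : ℝ, V.Pairwise fun x y => dist x y = d

/-- Cube: in suitable orthonormal coordinates, the vertices are `(±1, ±1, ±1) / √3`. -/
def IsCube (V : Set S2) : Prop :=
  ∃ b : OrthonormalBasis (Fin 3) ℝ E3, V = {x | ∀ i, |b.repr x i| = 1 / √3}

/-- Regular dodecahedron: in suitable orthonormal coordinates, and with `φ` the golden ratio, the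
vertices are the points `(±1, ±1, ±1) / √3` and the cyclic permutations of
`(0, ±φ⁻¹, ±φ) / √3`. -/
def IsRegularDodecahedron (V : Set S2) : Prop :=
  ∃ b : OrthonormalBasis (Fin 3) ℝ E3, V = {x |
    (∀ i, |b.repr x i| = 1 / √3) ∨
    ∃ i : Fin 3, b.repr x i = 0 ∧ |b.repr x (i + 1)| = Real.goldenRatio⁻¹ / √3 ∧
      |b.repr x (i + 2)| = Real.goldenRatio / √3}

/-- `F` is the set of vertices on some supporting plane of the convex polyhedron with vertex
set `V`. -/
def IsSupportSection (V F : Set S2) : Prop :=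
  ∃ (n : E3) (c : ℝ), n ≠ 0 ∧ (∀ v ∈ V, inner ℝ n (v : E3) ≤ c) ∧
    F = {v ∈ V | inner ℝ n (v : E3) = c}

/-- `F` is the vertex set of a (two-dimensional) face: as no three points of a sphere are
collinear, this means that the supporting plane contains at least three vertices. -/
def IsFace (V F : Set S2) : Prop :=
  IsSupportSection V F ∧ 3 ≤ F.ncard

/-- `A` and `B` are the end points of an edge. -/
def IsEdge (V : Set S2) (A B : S2) : Prop :=
  A ≠ B ∧ IsSupportSection V {A, B}

/-- `x` is the projection of `p` to the sphere, with the origin as centre of projection. -/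
def IsRadialProj (p : E3) (x : S2) : Prop :=
  ∃ r : ℝ, 0 < r ∧ p = r • (x : E3)

/-- The central point of the face with vertex set `F`. -/
def faceCentre (F : Set S2) : E3 :=
  (F.ncard : ℝ)⁻¹ • ∑ᶠ v ∈ F, (v : E3)

/-- The projections to `S²` of the central points of the faces. -/
def faceCentres (V : Set S2) : Set S2 :=
  {x | ∃ F, IsFace V F ∧ IsRadialProj (faceCentre F) x}

/-- The projections to `S²` of the middle points of the edges. -/
def edgeMidpoints (V : Set S2) : Set S2 :=
  {x | ∃ A B, IsEdge V A B ∧ IsRadialProj (midpoint ℝ (A : E3) (B : E3)) x}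

/-- The union of the vertices, the projected face centres and the projected edge midpoints. -/
def specialPoints (V : Set S2) : Set S2 :=
  V ∪ faceCentres V ∪ edgeMidpoints V

/-- The orbit of `X` under the rotation group of the polyhedron `V`. -/
def rotOrbit (V : Set S2) (X : S2) : Set S2 :=
  MulAction.orbit (rotationGroup V) X

/-- The family `{V, F, E} ∪ {B(X) | X ∈ S² \ (V ∪ F ∪ E)}`. -/
def orbitFamily (V : Set S2) : Set (Set S2) :=
  {V, faceCentres V, edgeMidpoints V} ∪ {B | ∃ X, X ∉ specialPoints V ∧ B = rotOrbit V X}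

/-- `α` is a union of certain elements of the family `𝓕`. -/
def IsUnionOfElements (𝓕 : Set (Set S2)) (α : Set S2) : Prop :=
  ∃ 𝓢, 𝓢 ⊆ 𝓕 ∧ α = ⋃₀ 𝓢

/-- `A, B, C, D, E` are the consecutive vertices of a face of the dodecahedron `VI`, `A` is a
vertex of the tetrahedron `VT`, and the middle point of `BC` projects to that of an edge of `VT`. -/
structure IsPentagonLabelling (VT VI : Set S2) (A B C D E : S2) : Prop where
  face : IsFace VI {A, B, C, D, E}
  edge_AB : IsEdge VI A B
  edge_BC : IsEdge VI B C
  edge_CD : IsEdge VI C D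
  edge_DE : IsEdge VI D E
  edge_EA : IsEdge VI E A
  mem_A : A ∈ VT
  mid_BC : ∃ x ∈ edgeMidpoints VT, IsRadialProj (midpoint ℝ (B : E3) (C : E3)) x

/-- `A, B, C, D` are the consecutive vertices of a face of the cube `VO`, and `A` is a vertex of
the tetrahedron `VT`. -/
structure IsSquareLabelling (VT VO : Set S2) (A B C D : S2) : Prop where
  face : IsFace VO {A, B, C, D}
  edge_AB : IsEdge VO A B
  edge_BC : IsEdge VO B C
  edge_CD : IsEdge VO C D
  edge_DA : IsEdge VO D A
  mem_A : A ∈ VT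

end

-- Choose an orthonormal frame in which the tetrahedron has the vertices (1,1,1), (1,-1,-1),
-- (-1,1,-1), (-1,-1,1), divided by √3, and describe rotations by unit quaternions that act on pure
-- quaternions by conjugation. Every question becomes one about finitely many explicit points and
-- quaternions.
--
-- Unions of orbits. If the rotations of a polyhedron are transitive on its vertices and cyclic on
-- the neighbours of one vertex, then V, F and E are single orbits, so a union of elements of the
-- family is the same as an invariant set (`RegularVertex.isUnionOfElements_iff`). Necessity of the
-- three conditions is then a comparison of the orders 12, 24 and 60.
--
-- Sufficiency. Let H be the group of the finite set α. It contains G by condition 1. The set α is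
-- not empty, since the empty union is excluded for the cube; being G-invariant it has three points,
-- so H is finite, a linear fractional transformation being determined by three values
-- (`finite_fixingGroup`). Averaging the Hermitian matrices M M* over H gives an invariant one; it
-- commutes with the unitary matrices of the rotations in H, and as these have no common fixed point
-- it is scalar. So H consists of rotations (`finite_le_rotations`). If H is larger than G, a count
-- of poles (`element_orders`) shows that all elements of H have order at most 4, or all have order
-- 1, 2, 3 or 5. For a quaternion q over an element of H outside G this restricts (2 re q)² to 0, 1,
-- 2, 4 or to 0, 1, φ + 1, 2 - φ, 4. Multiplication by G moves every component of q to the real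
-- place, so all four components obey the same restriction, and the four values add up to 4.
-- Irrationality of φ splits this sum into two integer equations, and a finite search leaves a
-- quarter turn about a coordinate axis, or a fifth of a turn in one of two mirror positions.
-- Together with G it generates an octahedral or icosahedral group (`octahedral_or_icosahedral_le`),
-- which conditions 2 and 3 forbid.
--
-- Orbits. The same lemma shows that the cube is unique and that each dodecahedron is standard in
-- some frame adapted to the tetrahedron; a polyhedron is recovered from its group because its
-- vertices lie on the axes of order three. A change of frame puts a labelled face in standard
-- position. The powers of g represent the cosets of G (`exists_mul_pow`), so a large orbit is the
-- union of the G-orbits of the points gⁱ(X). The formulas for V, F and E are this decomposition at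
-- a vertex, a face centre and an edge midpoint.

local notation "φ" => Real.goldenRatio

section

open scoped Quaternion

/-! ### Rotations in coordinates, by unit quaternions -/

/-- The pure quaternion formed by the coordinates of a vector in an orthonormal basis. -/
noncomputable def pureQuat (b : OrthonormalBasis (Fin 3) ℝ E3) (x : E3) : ℍ[ℝ] :=
  ⟨0, b.repr x 0, b.repr x 1, b.repr x 2⟩

/-- The unit quaternion `q` describes the action of `f` on coordinates. -/
def QuatRep (b : OrthonormalBasis (Fin 3) ℝ E3) (q : ℍ[ℝ]) (f : Equiv.Perm S2) : Prop :=
  Quaternion.normSq q = 1 ∧ ∀ x : S2, pureQuat b (f x) = q * pureQuat b x * star q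

section coordinates

@[simp]
theorem pureQuat_re (b : OrthonormalBasis (Fin 3) ℝ E3) (x : E3) : (pureQuat b x).re = 0 := rfl

@[simp]
theorem pureQuat_imI (b : OrthonormalBasis (Fin 3) ℝ E3) (x : E3) :
    (pureQuat b x).imI = b.repr x 0 := rfl

@[simp]
theorem pureQuat_imJ (b : OrthonormalBasis (Fin 3) ℝ E3) (x : E3) :
    (pureQuat b x).imJ = b.repr x 1 := rfl

@[simp]
theorem pureQuat_imK (b : OrthonormalBasis (Fin 3) ℝ E3) (x : E3) :
    (pureQuat b x).imK = b.repr x 2 := rfl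

variable (b : OrthonormalBasis (Fin 3) ℝ E3)

theorem coord_norm_sq (x : E3) :
    ‖x‖ ^ 2 = b.repr x 0 ^ 2 + b.repr x 1 ^ 2 + b.repr x 2 ^ 2 := by
  rw [← b.repr.norm_map x, EuclideanSpace.norm_sq_eq]
  simp [Fin.sum_univ_three]

theorem coord_inner (x y : E3) :
    inner ℝ x y = b.repr x 0 * b.repr y 0 + b.repr x 1 * b.repr y 1 + b.repr x 2 * b.repr y 2 := by
  rw [← b.repr.inner_map_map x y, PiLp.inner_apply]
  simp [Fin.sum_univ_three, mul_comm]

theorem coord_sq_sum (x : S2) :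
    b.repr x 0 ^ 2 + b.repr x 1 ^ 2 + b.repr x 2 ^ 2 = 1 := by
  rw [← coord_norm_sq, norm_eq_of_mem_sphere]; norm_num

theorem vec_ext {x y : E3} (h0 : b.repr x 0 = b.repr y 0) (h1 : b.repr x 1 = b.repr y 1)
    (h2 : b.repr x 2 = b.repr y 2) : x = y := by
  apply b.repr.injective
  ext i
  fin_cases i <;> assumption

theorem pt_ext {x y : S2} (h0 : b.repr x 0 = b.repr y 0) (h1 : b.repr x 1 = b.repr y 1)
    (h2 : b.repr x 2 = b.repr y 2) : x = y :=
  Subtype.ext (vec_ext b h0 h1 h2)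

theorem exists_vec (u v w : ℝ) : ∃ x : E3, b.repr x 0 = u ∧ b.repr x 1 = v ∧ b.repr x 2 = w :=
  ⟨b.repr.symm !₂[u, v, w], by simp⟩

theorem exists_pt {u v w : ℝ} (h : u ^ 2 + v ^ 2 + w ^ 2 = 1) :
    ∃ x : S2, b.repr x 0 = u ∧ b.repr x 1 = v ∧ b.repr x 2 = w := by
  obtain ⟨x, h0, h1, h2⟩ := exists_vec b u v w
  refine ⟨⟨x, ?_⟩, h0, h1, h2⟩
  have := coord_norm_sq b x
  rw [h0, h1, h2, h] at this
  rw [mem_sphere_zero_iff_norm]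
  nlinarith [norm_nonneg x]

theorem pureQuat_inj {x y : E3} (h : pureQuat b x = pureQuat b y) : x = y := by
  have h := Quaternion.ext_iff.1 h
  exact vec_ext b h.2.1 h.2.2.1 h.2.2.2

theorem exists_pureQuat (q : ℍ[ℝ]) (h : q.re = 0) : ∃ x : E3, pureQuat b x = q := by
  obtain ⟨x, h0, h1, h2⟩ := exists_vec b q.imI q.imJ q.imK
  exact ⟨x, by ext <;> simp [*]⟩

theorem normSq_pureQuat (x : E3) : Quaternion.normSq (pureQuat b x) = ‖x‖ ^ 2 := by
  rw [Quaternion.normSq_def', coord_norm_sq b]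
  simp

theorem star_pureQuat (x : E3) : star (pureQuat b x) = -pureQuat b x := by
  rw [Quaternion.star_eq_neg]; rfl

theorem pureQuat_add (x y : E3) : pureQuat b (x + y) = pureQuat b x + pureQuat b y := by
  ext <;> simp

theorem pureQuat_smul (r : ℝ) (x : E3) : pureQuat b (r • x) = r • pureQuat b x := by
  ext <;> simp

theorem star_mul_self_of_unit {q : ℍ[ℝ]} (h : Quaternion.normSq q = 1) : star q * q = 1 := by
  rw [Quaternion.star_mul_self, h]; simp

theorem self_mul_star_of_unit {q : ℍ[ℝ]} (h : Quaternion.normSq q = 1) : q * star q = 1 := by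
  rw [Quaternion.self_mul_star, h]; simp

theorem pureQuat_reflection {v : E3} (hv : ‖v‖ = 1) (x : E3) :
    pureQuat b ((ℝ ∙ v)ᗮ.reflection x)
      = -(pureQuat b v * pureQuat b x * star (pureQuat b v)) := by
  have h1 : (ℝ ∙ v)ᗮ.reflection x = x - (2 * inner ℝ v x) • v := by
    rw [Submodule.reflection_orthogonal_apply, Submodule.reflection_singleton_apply, hv]
    simp [mul_smul, two_smul]
  have h2 := coord_norm_sq b v
  rw [hv] at h2
  rw [h1, star_pureQuat, coord_inner b]
  ext <;> simp
  · ring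
  · linear_combination (b.repr x).ofLp 0 * h2
  · linear_combination (b.repr x).ofLp 1 * h2
  · linear_combination (b.repr x).ofLp 2 * h2

/-- A reflection is minus the conjugation by its unit normal, so each factor contributes a pure
quaternion and a sign; the accumulated sign is also the determinant. A zero vector in the list gives
the identity and contributes nothing. -/
theorem exists_quat_of_reflections (l : List E3) :
    ∃ q : ℍ[ℝ], Quaternion.normSq q = 1 ∧ ∃ ε : ℝ, (ε = 1 ∨ ε = -1) ∧
      LinearMap.det
        (((l.map fun v => (ℝ ∙ v)ᗮ.reflection).prod).toLinearEquiv : E3 →ₗ[ℝ] E3) = ε ∧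
      ∀ x, pureQuat b ((l.map fun v => (ℝ ∙ v)ᗮ.reflection).prod x)
        = ε • (q * pureQuat b x * star q) := by
  induction l with
  | nil => exact ⟨1, by simp, 1, by simp, by simp [LinearIsometryEquiv.one_def], by simp⟩
  | cons v l ih =>
    obtain ⟨q, hq, ε, hε, hdet, h⟩ := ih
    set R := (l.map fun v => (ℝ ∙ v)ᗮ.reflection).prod with hR
    rw [List.map_cons, List.prod_cons, ← hR]
    by_cases hv : v = 0
    · have h1 : (ℝ ∙ v)ᗮ.reflection = 1 := by
        ext1 x
        rw [Submodule.reflection_orthogonal_apply, Submodule.reflection_singleton_apply]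
        simp [hv]
      rw [h1, one_mul]
      exact ⟨q, hq, ε, hε, hdet, h⟩
    · set w := ‖v‖⁻¹ • v with hw
      have hw1 : ‖w‖ = 1 := by simp [hw, norm_smul, hv]
      have hvw : (ℝ ∙ v) = (ℝ ∙ w) := by
        rw [hw, Submodule.span_singleton_smul_eq]
        simpa using hv
      refine ⟨pureQuat b w * q, ?_, -ε, ?_, ?_, ?_⟩
      · rw [map_mul, hq, normSq_pureQuat, hw1]; norm_num
      · rcases hε with rfl | rfl <;> simp
      · have h2 : LinearMap.det ((ℝ ∙ v)ᗮ.reflection.toLinearEquiv : E3 →ₗ[ℝ] E3) = -1 := by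
          have := Submodule.det_reflection (ℝ ∙ v)ᗮ
          rw [Submodule.orthogonal_orthogonal, finrank_span_singleton hv] at this
          simpa using this
        have h3 : (((ℝ ∙ v)ᗮ.reflection * R).toLinearEquiv : E3 →ₗ[ℝ] E3)
          = ((ℝ ∙ v)ᗮ.reflection.toLinearEquiv : E3 →ₗ[ℝ] E3)
            ∘ₗ (R.toLinearEquiv : E3 →ₗ[ℝ] E3) := rfl
        rw [h3, LinearMap.det_comp, h2, hdet]; ring
      · intro x
        rw [LinearIsometryEquiv.coe_mul, Function.comp_apply]
        simp only [hvw]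
        rw [pureQuat_reflection b hw1, h, star_mul]
        simp [mul_assoc]

theorem exists_quat_of_isometry (R : E3 ≃ₗᵢ[ℝ] E3)
    (hR : LinearMap.det (R.toLinearEquiv : E3 →ₗ[ℝ] E3) = 1) :
    ∃ q : ℍ[ℝ], Quaternion.normSq q = 1 ∧ ∀ x, pureQuat b (R x) = q * pureQuat b x * star q := by
  obtain ⟨l, -, rfl⟩ := R.reflections_generate_dim
  obtain ⟨q, hq, ε, -, hdet, h⟩ := exists_quat_of_reflections b l
  rw [hR] at hdet
  subst hdet
  exact ⟨q, hq, by simpa using h⟩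

theorem exists_quatRep {f : Equiv.Perm S2} (hf : f ∈ rotations) : ∃ q, QuatRep b q f := by
  obtain ⟨R, hR, h⟩ := hf
  obtain ⟨q, hq, h2⟩ := exists_quat_of_isometry b R hR
  exact ⟨q, hq, fun x => by rw [h, h2]⟩

theorem exists_isometry_of_quat {q : ℍ[ℝ]} (hq : Quaternion.normSq q = 1) :
    ∃ R : E3 ≃ₗᵢ[ℝ] E3, ∀ x, pureQuat b (R x) = q * pureQuat b x * star q := by
  have h0 : ∀ x : E3, ∃ y : E3, pureQuat b y = q * pureQuat b x * star q := fun x => by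
    apply exists_pureQuat
    simp
    ring
  choose F hF using h0
  let L : E3 →ₗ[ℝ] E3 :=
    { toFun := F
      map_add' := fun x y => pureQuat_inj b (by simp [hF, pureQuat_add, mul_add, add_mul])
      map_smul' := fun r x => pureQuat_inj b (by simp [hF, pureQuat_smul]) }
  let L' : E3 →ₗᵢ[ℝ] E3 := ⟨L, fun x => by
    have h1 : ‖F x‖ ^ 2 = ‖x‖ ^ 2 := by
      rw [← normSq_pureQuat b, ← normSq_pureQuat b, hF]; simp [hq]
    exact (sq_eq_sq₀ (norm_nonneg _) (norm_nonneg _)).1 h1⟩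
  exact ⟨L'.toLinearIsometryEquiv rfl, fun x => hF x⟩

/-- The root is 1 + q divided by its norm. It serves to write a conjugation as the square of an
isometry. -/
theorem exists_sqrt_of_unit {q : ℍ[ℝ]} (hq : Quaternion.normSq q = 1) (hne : q ≠ -1) :
    ∃ p : ℍ[ℝ], Quaternion.normSq p = 1 ∧ p * p = q := by
  rw [Quaternion.normSq_def'] at hq
  have h1 : 0 < 1 + q.re := by
    by_contra h
    have h2 : q.re = -1 := by nlinarith [sq_nonneg q.imI, sq_nonneg q.imJ, sq_nonneg q.imK]
    apply hne
    rw [h2] at hq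
    ext <;> simp
    · exact h2
    all_goals nlinarith [sq_nonneg q.imI, sq_nonneg q.imJ, sq_nonneg q.imK]
  have h2 : √(2 * (1 + q.re)) ^ 2 = 2 * (1 + q.re) := Real.sq_sqrt (by linarith)
  have h3 : 0 < √(2 * (1 + q.re)) := Real.sqrt_pos.2 (by linarith)
  set s := √(2 * (1 + q.re)) with hs
  refine ⟨s⁻¹ • (1 + q), ?_, ?_⟩
  · rw [Quaternion.normSq_smul, Quaternion.normSq_def']
    simp
    field_simp
    linear_combination hq - h2
  · rw [smul_mul_smul_comm]
    have h4 : s⁻¹ * s⁻¹ = (2 * (1 + q.re))⁻¹ := by rw [← h2]; field_simp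
    rw [h4]
    ext <;> simp <;> field_simp
    · linear_combination -hq
    all_goals ring

/-- Conjugation by q is the square of conjugation by a root of q, and an isometry has determinant
±1, so the determinant is 1 without computing it. -/
theorem exists_rotation {q : ℍ[ℝ]} (hq : Quaternion.normSq q = 1) :
    ∃ f ∈ rotations, QuatRep b q f := by
  obtain ⟨R, hdet, hR⟩ : ∃ R : E3 ≃ₗᵢ[ℝ] E3,
      LinearMap.det (R.toLinearEquiv : E3 →ₗ[ℝ] E3) = 1 ∧
      ∀ x, pureQuat b (R x) = q * pureQuat b x * star q := by
    by_cases hne : q = -1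
    · exact ⟨LinearIsometryEquiv.refl ℝ E3, by simp, fun x => by simp [hne]⟩
    obtain ⟨p, hp, rfl⟩ := exists_sqrt_of_unit hq hne
    obtain ⟨R, hR⟩ := exists_isometry_of_quat b hp
    refine ⟨R * R, ?_, fun x => by
      rw [LinearIsometryEquiv.coe_mul, Function.comp_apply, hR, hR, star_mul]; simp only [mul_assoc]⟩
    have h3 : ((R * R).toLinearEquiv : E3 →ₗ[ℝ] E3)
          = (R.toLinearEquiv : E3 →ₗ[ℝ] E3) ∘ₗ (R.toLinearEquiv : E3 →ₗ[ℝ] E3) := rfl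
    rw [h3, LinearMap.det_comp]
    -- The decomposition into reflections is used only to see that the determinant of `R` is ±1.
    obtain ⟨l, -, rfl⟩ := R.reflections_generate_dim
    obtain ⟨-, -, ε, hε, hdet, -⟩ := exists_quat_of_reflections b l
    rw [hdet]
    rcases hε with rfl | rfl <;> norm_num
  let f : Equiv.Perm S2 :=
    { toFun := fun x => ⟨R x, by simp⟩
      invFun := fun x => ⟨R.symm x, by simp⟩
      left_inv := fun x => by simp
      right_inv := fun x => by simp }
  exact ⟨f, ⟨R, hdet, fun x => rfl⟩, hq, fun x => hR x⟩

end coordinates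

variable {b : OrthonormalBasis (Fin 3) ℝ E3}

theorem QuatRep.mul {p q : ℍ[ℝ]} {f g : Equiv.Perm S2} (hf : QuatRep b p f)
    (hg : QuatRep b q g) : QuatRep b (p * q) (f * g) :=
  ⟨by rw [map_mul, hf.1, hg.1, one_mul], fun x => by
    rw [Equiv.Perm.mul_apply, hf.2, hg.2, star_mul]; simp only [mul_assoc]⟩

theorem QuatRep.one : QuatRep b 1 1 := ⟨by simp, fun x => by simp⟩

theorem QuatRep.neg {p : ℍ[ℝ]} {f : Equiv.Perm S2} (hf : QuatRep b p f) : QuatRep b (-p) f :=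
  ⟨by simpa using hf.1, fun x => by simpa using hf.2 x⟩

theorem QuatRep.pow {p : ℍ[ℝ]} {f : Equiv.Perm S2} (hf : QuatRep b p f) (n : ℕ) :
    QuatRep b (p ^ n) (f ^ n) := by
  induction n with
  | zero => simpa using QuatRep.one
  | succ n ih => rw [pow_succ, pow_succ]; exact ih.mul hf

theorem QuatRep.inv {p : ℍ[ℝ]} {f : Equiv.Perm S2} (hf : QuatRep b p f) :
    QuatRep b (star p) f⁻¹ := by
  refine ⟨by simpa using hf.1, fun x => ?_⟩
  have h := hf.2 (f⁻¹ x)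
  rw [show f (f⁻¹ x) = x from f.apply_symm_apply x] at h
  rw [h]
  simp only [star_star, mul_assoc]
  rw [star_mul_self_of_unit hf.1, mul_one, ← mul_assoc, star_mul_self_of_unit hf.1, one_mul]

theorem QuatRep.unique {p : ℍ[ℝ]} {f g : Equiv.Perm S2} (hf : QuatRep b p f)
    (hg : QuatRep b p g) : f = g :=
  Equiv.ext fun x => Subtype.ext (pureQuat_inj b (by rw [hf.2, hg.2]))

theorem QuatRep.mem_rotations {p : ℍ[ℝ]} {f : Equiv.Perm S2} (hf : QuatRep b p f) :
    f ∈ rotations := by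
  obtain ⟨g, hg, h⟩ := exists_rotation b hf.1
  rwa [hf.unique h]

/-- The coordinates of the image of a point. -/
theorem QuatRep.coords {p : ℍ[ℝ]} {f : Equiv.Perm S2} (hf : QuatRep b p f) (x : S2) :
    b.repr (f x) 0 = (p.re ^ 2 + p.imI ^ 2 - p.imJ ^ 2 - p.imK ^ 2) * b.repr x 0
        + 2 * (p.imI * p.imJ - p.re * p.imK) * b.repr x 1
        + 2 * (p.imI * p.imK + p.re * p.imJ) * b.repr x 2 ∧
    b.repr (f x) 1 = 2 * (p.imI * p.imJ + p.re * p.imK) * b.repr x 0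
        + (p.re ^ 2 - p.imI ^ 2 + p.imJ ^ 2 - p.imK ^ 2) * b.repr x 1
        + 2 * (p.imJ * p.imK - p.re * p.imI) * b.repr x 2 ∧
    b.repr (f x) 2 = 2 * (p.imI * p.imK - p.re * p.imJ) * b.repr x 0
        + 2 * (p.imJ * p.imK + p.re * p.imI) * b.repr x 1
        + (p.re ^ 2 - p.imI ^ 2 - p.imJ ^ 2 + p.imK ^ 2) * b.repr x 2 := by
  have h := Quaternion.ext_iff.1 (hf.2 x)
  simp at h
  obtain ⟨-, h0, h1, h2⟩ := h
  refine ⟨?_, ?_, ?_⟩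
  · rw [h0]; ring
  · rw [h1]; ring
  · rw [h2]; ring

/-- A point is fixed by a rotation iff it lies on its axis. -/
theorem QuatRep.fixed_iff {p : ℍ[ℝ]} {f : Equiv.Perm S2} (hf : QuatRep b p f) (x : S2) :
    f x = x ↔ p.imI * b.repr x 1 = p.imJ * b.repr x 0 ∧ p.imI * b.repr x 2 = p.imK * b.repr x 0 ∧
      p.imJ * b.repr x 2 = p.imK * b.repr x 1 := by
  -- Being fixed means commuting with p, that is, being parallel to its imaginary part.
  have key : f x = x ↔ p * pureQuat b x = pureQuat b x * p := by
    constructor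
    · intro h
      have h1 := hf.2 x
      rw [h] at h1
      conv_rhs => rw [h1, mul_assoc, star_mul_self_of_unit hf.1, mul_one]
    · intro h
      refine Subtype.ext (pureQuat_inj b ?_)
      rw [hf.2, h, mul_assoc, self_mul_star_of_unit hf.1, mul_one]
  rw [key, Quaternion.ext_iff]
  simp
  constructor
  · rintro ⟨-, h0, h1, h2⟩
    refine ⟨?_, ?_, ?_⟩ <;> linarith
  · rintro ⟨h0, h1, h2⟩
    refine ⟨?_, ?_, ?_, ?_⟩ <;> linarith

theorem QuatRep.eq_one_of_im {p : ℍ[ℝ]} {f : Equiv.Perm S2} (hf : QuatRep b p f)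
    (h0 : p.imI = 0) (h1 : p.imJ = 0) (h2 : p.imK = 0) : f = 1 :=
  Equiv.ext fun x => (hf.fixed_iff x).2 (by simp [*])

theorem QuatRep.eq_one_iff {p : ℍ[ℝ]} {f : Equiv.Perm S2} (hf : QuatRep b p f) :
    f = 1 ↔ p.imI = 0 ∧ p.imJ = 0 ∧ p.imK = 0 := by
  refine ⟨?_, fun h => hf.eq_one_of_im h.1 h.2.1 h.2.2⟩
  rintro rfl
  obtain ⟨x, hx⟩ := exists_pt b (u := 1) (v := 0) (w := 0) (by norm_num)
  obtain ⟨y, hy⟩ := exists_pt b (u := 0) (v := 1) (w := 0) (by norm_num)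
  have h1 := (hf.fixed_iff x).1 rfl
  have h2 := (hf.fixed_iff y).1 rfl
  simp [hx, hy] at h1 h2
  exact ⟨h2.1, h1.1.symm, h1.2.symm⟩

theorem rotation_neg {f : Equiv.Perm S2} (hf : f ∈ rotations) (x : S2) : f (-x) = -f x := by
  obtain ⟨R, -, h⟩ := hf
  apply Subtype.ext
  rw [h]
  simp [h]

theorem rotation_inner {f : Equiv.Perm S2} (hf : f ∈ rotations) (x y : S2) :
    inner ℝ (f x : E3) (f y : E3) = inner ℝ (x : E3) (y : E3) := by
  obtain ⟨R, -, h⟩ := hf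
  rw [h, h, R.inner_map_map]

/-- A rotation different from the identity fixes exactly two antipodal points. -/
theorem rotation_fixed_points {f : Equiv.Perm S2} (hf : f ∈ rotations) (h1 : f ≠ 1) :
    ∃ x : S2, ∀ y, f y = y ↔ y = x ∨ y = -x := by
  let b := EuclideanSpace.basisFun (Fin 3) ℝ
  obtain ⟨q, hq⟩ := exists_quatRep b hf
  have h2 : 0 < q.imI ^ 2 + q.imJ ^ 2 + q.imK ^ 2 := by
    by_contra h
    apply h1
    apply hq.eq_one_of_im <;> nlinarith [sq_nonneg q.imI, sq_nonneg q.imJ, sq_nonneg q.imK]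
  have h4 := Real.sq_sqrt h2.le
  have h3 := Real.sqrt_pos.2 h2
  set s := √(q.imI ^ 2 + q.imJ ^ 2 + q.imK ^ 2) with hs
  obtain ⟨x, hx0, hx1, hx2⟩ := exists_pt b (u := q.imI / s) (v := q.imJ / s) (w := q.imK / s)
    (by field_simp; linarith)
  refine ⟨x, fun y => ⟨fun h => ?_, ?_⟩⟩
  · obtain ⟨e0, e1, e2⟩ := (hq.fixed_iff y).1 h
    have hy := coord_sq_sum b y
    set t := (q.imI * b.repr y 0 + q.imJ * b.repr y 1 + q.imK * b.repr y 2) / s with ht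
    have g0 : b.repr y 0 = t * b.repr x 0 := by
      rw [hx0, ht]; field_simp
      linear_combination b.repr y 0 * h4 - q.imJ * e0 - q.imK * e1
    have g1 : b.repr y 1 = t * b.repr x 1 := by
      rw [hx1, ht]; field_simp
      linear_combination b.repr y 1 * h4 + q.imI * e0 - q.imK * e2
    have g2 : b.repr y 2 = t * b.repr x 2 := by
      rw [hx2, ht]; field_simp
      linear_combination b.repr y 2 * h4 + q.imI * e1 + q.imJ * e2
    have ht1 : (t - 1) * (t + 1) = 0 := by
      rw [g0, g1, g2] at hy
      linear_combination hy - t ^ 2 * coord_sq_sum b x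
    rcases mul_eq_zero.1 ht1 with h | h
    · have : t = 1 := by linarith
      left; apply pt_ext b <;> simp only [this, one_mul] at g0 g1 g2 <;> assumption
    · have : t = -1 := by linarith
      right; apply pt_ext b <;> simp [g0, g1, g2, this]
  · have hx : f x = x := by
      rw [hq.fixed_iff, hx0, hx1, hx2]
      refine ⟨?_, ?_, ?_⟩ <;> ring
    rintro (rfl | rfl)
    · exact hx
    · rw [rotation_neg hf, hx]

theorem rotation_eq_one {f : Equiv.Perm S2} (hf : f ∈ rotations) {x y : S2} (hx : f x = x)
    (hy : f y = y) (h1 : x ≠ y) (h2 : x ≠ -y) : f = 1 := by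
  by_contra h
  obtain ⟨z, hz⟩ := rotation_fixed_points hf h
  rcases (hz x).1 hx with rfl | rfl <;> rcases (hz y).1 hy with rfl | rfl <;> simp at h1 h2

end

section

/-! ### Counting poles -/

open MulAction in
/-- The poles of a group of transformations of the sphere. -/
def poles (H : Subgroup (Equiv.Perm S2)) : SubMulAction H S2 where
  carrier := {x | ∃ f : H, f ≠ 1 ∧ f • x = x}
  smul_mem' := by
    rintro g x ⟨f, hf, hx⟩
    refine ⟨g * f * g⁻¹, ?_, by rw [mul_smul, inv_smul_smul, mul_smul, hx]⟩
    simpa [mul_inv_eq_one] using hf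

/-- This is the pole equation for three orbits. The bound 4 n ≤ N at one index excludes the dihedral
solutions (2, 2, m), where N = 2m; divisibility by 3 makes that entry 3. -/
theorem platonic_arith {N : ℕ} {n : Fin 3 → ℕ} (hn : ∀ i, 2 ≤ n i)
    (h : (n 0 : ℚ)⁻¹ + (n 1 : ℚ)⁻¹ + (n 2 : ℚ)⁻¹ = 1 + 2 / N) {i : Fin 3} (h3 : 3 ∣ n i)
    (h4 : 4 * n i ≤ N) :
    (∀ j, n j = 2 ∨ n j = 3 ∨ n j = 4) ∨ (∀ j, n j = 2 ∨ n j = 3 ∨ n j = 5) := by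
  -- Here a is the distinguished entry and the other two are ordered. The sum of inverses exceeds 1,
  -- which bounds all entries; c = 2 would give 1/a = 2/N, against 4a ≤ N.
  have key : ∀ a b c : ℕ, 2 ≤ a → 2 ≤ b → 2 ≤ c → 3 ∣ a → 4 * a ≤ N → b ≤ c →
      (a : ℚ)⁻¹ + (b : ℚ)⁻¹ + (c : ℚ)⁻¹ = 1 + 2 / N →
      a = 3 ∧ b = 2 ∧ (c = 3 ∨ c = 4 ∨ c = 5) := by
    intro a b c ha hb hc h3 h4 hbc h
    have ha3 : 3 ≤ a := Nat.le_of_dvd (by omega) h3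
    have hN : (0 : ℚ) < N := by norm_cast; omega
    have ha0 : (3 : ℚ) ≤ a := by exact_mod_cast ha3
    have hb0 : (2 : ℚ) ≤ b := by exact_mod_cast hb
    have hc0 : (2 : ℚ) ≤ c := by exact_mod_cast hc
    have hbc0 : (b : ℚ) ≤ c := by exact_mod_cast hbc
    have h40 : 4 * (a : ℚ) ≤ N := by exact_mod_cast h4
    have e1 : 2 / (N : ℚ) ≤ (a : ℚ)⁻¹ / 2 := by
      rw [div_le_iff₀ hN]
      field_simp
      linarith
    have e0 : 0 < 2 / (N : ℚ) := by positivity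
    have ea : (a : ℚ)⁻¹ ≤ 3⁻¹ := inv_anti₀ (by norm_num) ha0
    have eb : (b : ℚ)⁻¹ ≤ 2⁻¹ := inv_anti₀ (by norm_num) hb0
    have ec : (c : ℚ)⁻¹ ≤ (b : ℚ)⁻¹ := inv_anti₀ (by linarith) hbc0
    have hb2 : b = 2 := by
      by_contra hne
      have : (3 : ℚ) ≤ b := by exact_mod_cast (by omega : 3 ≤ b)
      have := inv_anti₀ (by norm_num) this
      linarith
    subst hb2
    have hc6 : c < 6 := by
      by_contra hne
      have : (6 : ℚ) ≤ c := by exact_mod_cast (by omega : 6 ≤ c)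
      have := inv_anti₀ (by norm_num) this
      simp only [Nat.cast_ofNat] at *
      linarith
    have hc2 : c ≠ 2 := by
      rintro rfl
      have : 0 < (a : ℚ)⁻¹ := by positivity
      simp only [Nat.cast_ofNat] at *
      linarith
    have ha6 : a < 6 := by
      by_contra hne
      have : (6 : ℚ) ≤ a := by exact_mod_cast (by omega : 6 ≤ a)
      have := inv_anti₀ (by norm_num) this
      have h3c : (3 : ℚ) ≤ c := by exact_mod_cast (by omega : 3 ≤ c)
      have := inv_anti₀ (by norm_num) h3c
      simp only [Nat.cast_ofNat] at *
      linarith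
    refine ⟨by omega, rfl, by omega⟩
  have key2 : ∀ a b c : ℕ, 2 ≤ a → 2 ≤ b → 2 ≤ c → 3 ∣ a → 4 * a ≤ N →
      (a : ℚ)⁻¹ + (b : ℚ)⁻¹ + (c : ℚ)⁻¹ = 1 + 2 / N →
      a = 3 ∧ ((b = 2 ∧ (c = 3 ∨ c = 4 ∨ c = 5)) ∨ (c = 2 ∧ (b = 3 ∨ b = 4 ∨ b = 5))) := by
    intro a b c ha hb hc h3 h4 h
    rcases le_total b c with hbc | hbc
    · have := key a b c ha hb hc h3 h4 hbc h
      exact ⟨this.1, Or.inl this.2⟩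
    · have := key a c b ha hc hb h3 h4 hbc (by linarith)
      exact ⟨this.1, Or.inr this.2⟩
  simp only [Fin.forall_fin_succ, Fin.succ_zero_eq_one, IsEmpty.forall_iff, and_true,
    Fin.succ_one_eq_two]
  fin_cases i
  · have := key2 (n 0) (n 1) (n 2) (hn _) (hn _) (hn _) h3 h4 h
    omega
  · have := key2 (n 1) (n 0) (n 2) (hn _) (hn _) (hn _) h3 h4 (by linarith)
    omega
  · have := key2 (n 2) (n 0) (n 1) (hn _) (hn _) (hn _) h3 h4 (by linarith)
    omega

open MulAction in
/-- The element orders in a finite group of rotations with a pole of order divisible by `3` that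
has at least four images. -/
theorem element_orders {H : Subgroup (Equiv.Perm S2)} [Finite H] (hH : H ≤ rotations) {v : S2}
    {f₀ : Equiv.Perm S2} (hf₀ : f₀ ∈ H) (hne : f₀ ≠ 1) (h3 : f₀ ^ 3 = 1) (hv : f₀ v = v)
    (h4 : 4 ≤ (orbit H v).ncard) :
    (∀ f ∈ H, f = 1 ∨ f ^ 2 = 1 ∨ f ^ 3 = 1 ∨ f ^ 4 = 1) ∨
    (∀ f ∈ H, f = 1 ∨ f ^ 2 = 1 ∨ f ^ 3 = 1 ∨ f ^ 5 = 1) := by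
  classical
  have := Fintype.ofFinite H
  have hfix : ∀ f : H, f ≠ 1 → ∃ x : S2, ∀ y, f • y = y ↔ y = x ∨ y = -x := fun f hf =>
    rotation_fixed_points (hH f.2) (by simpa using hf)
  have hneg : ∀ x : S2, x ≠ -x := fun x h => by
    have h1 := congrArg (Subtype.val) h
    have h2 : ‖(x : E3)‖ = 1 := norm_eq_of_mem_sphere x
    have h3 : (x : E3) = 0 := by
      have h4 : (2 : ℝ) • (x : E3) = 0 := by
        rw [two_smul]; nth_rewrite 2 [h1]; simp
      simpa using h4
    rw [h3] at h2; simp at h2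
  have : Finite (poles H) := by
    have : (poles H : Set S2) ⊆ ⋃ f : {f : H // f ≠ 1}, {y : S2 | f.1 • y = y} := by
      rintro x ⟨f, hf, hx⟩
      exact Set.mem_iUnion.2 ⟨⟨f, hf⟩, hx⟩
    refine Set.Finite.subset (Set.finite_iUnion fun f => ?_) this
    obtain ⟨x, hx⟩ := hfix f.1 f.2
    exact (Set.toFinite {x, -x}).subset fun y hy => (hx y).1 hy
  have := Fintype.ofFinite (poles H)
  set Ω := Quotient (orbitRel H (poles H))
  have : Fintype Ω := Fintype.ofFinite _
  set N := Fintype.card H with hN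
  let n : Ω → ℕ := fun ω => Fintype.card (stabilizer H ω.out)
  -- Stabilizers along an orbit are conjugate, so their order is a function of the orbit.
  have hstab : ∀ x : poles H, Fintype.card (stabilizer H x) = n (Quotient.mk'' x) := fun x =>
    Fintype.card_congr
      (stabilizerEquivStabilizerOfOrbitRel
        (Quotient.exact' (Quotient.out_eq' (Quotient.mk'' x : Ω)))).toEquiv.symm
  have hpow : ∀ (x : poles H) (f : H), f • (x : S2) = x → f ^ n (Quotient.mk'' x) = 1 := by
    intro x f hf
    have hf' : f ∈ stabilizer H x := Subtype.ext hf
    have h1 : (⟨f, hf'⟩ : stabilizer H x) ^ Fintype.card (stabilizer H x) = 1 := pow_card_eq_one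
    rw [hstab] at h1
    simpa using congrArg Subtype.val h1
  have hdvd : ∀ (x : poles H) (f : H), f • (x : S2) = x → orderOf f ∣ n (Quotient.mk'' x) :=
    fun x f hf => orderOf_dvd_of_pow_eq_one (hpow x f hf)
  have hn : ∀ ω, 2 ≤ n ω := by
    intro ω
    obtain ⟨f, hf, hx⟩ := ω.out.2
    have hf' : f ∈ stabilizer H ω.out := Subtype.ext hx
    have : 1 < Fintype.card (stabilizer H ω.out) := Fintype.one_lt_card_iff.2
      ⟨⟨f, hf'⟩, 1, fun h => hf (congrArg Subtype.val h)⟩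
    exact this
  have hnN : ∀ ω, n ω ∣ N := fun ω => by
    have := Subgroup.card_subgroup_dvd_card (stabilizer H ω.out)
    rw [Nat.card_eq_fintype_card, Nat.card_eq_fintype_card] at this
    exact this
  have hN0 : 0 < N := Fintype.card_pos
  have hburn := sum_card_fixedBy_eq_card_orbits_mul_card_group (G := H) (X := poles H)
  -- The identity fixes all poles and every other element exactly two. Burnside's lemma compares
  -- this with the number of orbits.
  have hsum : ∑ f : H, Fintype.card (fixedBy (poles H) f)
      = Fintype.card (poles H) + 2 * (N - 1) := by
    rw [← Finset.add_sum_erase _ _ (Finset.mem_univ (1 : H))]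
    congr 1
    · exact Fintype.card_congr (Equiv.subtypeUnivEquiv fun x => by simp)
    · rw [Finset.sum_congr rfl (g := fun _ => 2), Finset.sum_const,
        Finset.card_erase_of_mem (Finset.mem_univ _), Finset.card_univ, smul_eq_mul, mul_comm]
      intro f hf
      obtain ⟨x, hx⟩ := hfix f (Finset.ne_of_mem_erase hf)
      have hx1 : x ∈ poles H := ⟨f, Finset.ne_of_mem_erase hf, (hx x).2 (Or.inl rfl)⟩
      have hx2 : -x ∈ poles H := ⟨f, Finset.ne_of_mem_erase hf, (hx _).2 (Or.inr rfl)⟩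
      rw [← Nat.card_eq_fintype_card]
      have : fixedBy (poles H) f = {⟨x, hx1⟩, ⟨-x, hx2⟩} := by
        ext y
        exact ⟨fun h => ((hx y).1 (congrArg Subtype.val h)).imp (fun h => Subtype.ext h)
          fun h => Subtype.ext h, fun h => Subtype.ext ((hx y).2
            (h.imp (congrArg Subtype.val) (congrArg Subtype.val)))⟩
      rw [this]
      change Set.ncard _ = 2
      exact Set.ncard_pair fun h => hneg x (congrArg Subtype.val h)
  have hP := card_eq_sum_card_group_div_card_stabilizer H (poles H)
  -- An orbit has N / n poles; dividing the Burnside count by N gives the pole equation.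
  have hQ : ∑ ω, (n ω : ℚ)⁻¹ = Fintype.card Ω - 2 + 2 / N := by
    have h1 : (Fintype.card (poles H) : ℚ) = ∑ ω, N * (n ω : ℚ)⁻¹ := by
      rw [hP]; push_cast
      refine Finset.sum_congr rfl fun ω _ => ?_
      rw [Nat.cast_div (hnN ω) (by have := hn ω; positivity)]
      rfl
    rw [hburn] at hsum
    have h2 : ((Fintype.card Ω * N : ℕ) : ℚ)
        = (Fintype.card (poles H) + 2 * (N - 1) : ℕ) := congrArg _ hsum
    push_cast [Nat.cast_sub (show 1 ≤ N from hN0)] at h2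
    rw [h1, ← Finset.mul_sum] at h2
    have hN1 : (N : ℚ) ≠ 0 := by positivity
    apply mul_left_cancel₀ hN1
    rw [mul_add, mul_div_cancel₀ _ hN1]
    linarith
  have hvp : v ∈ poles H := ⟨⟨f₀, hf₀⟩, by simpa using hne, hv⟩
  set ω₀ : Ω := Quotient.mk'' ⟨v, hvp⟩ with hω₀
  have h30 : 3 ∣ n ω₀ := by
    have h1 : orderOf (⟨f₀, hf₀⟩ : H) = 3 := by
      apply orderOf_eq_prime
      · exact Subtype.ext h3
      · simpa using hne
    rw [← h1]
    exact hdvd ⟨v, hvp⟩ ⟨f₀, hf₀⟩ hv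
  have h40 : 4 * n ω₀ ≤ N := by
    have h1 := (stabilizer H v).index_mul_card
    rw [index_stabilizer] at h1
    have h2 : Nat.card (stabilizer H v) = n ω₀ := by
      rw [← hstab, ← Nat.card_eq_fintype_card]
      have : stabilizer H (⟨v, hvp⟩ : poles H) = stabilizer H v := by
        ext f; simp [mem_stabilizer_iff, Subtype.ext_iff]
      rw [this]
    rw [h2, Nat.card_eq_fintype_card] at h1
    rw [hN, ← h1]
    exact Nat.mul_le_mul_right _ h4
  -- Each summand is at most 1/2, which forces fewer than four orbits; the summand of v is at least
  -- 4/N, which forces more than two.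
  have hcard : Fintype.card Ω = 3 := by
    have hN12 : (12 : ℚ) ≤ N := by
      have := Nat.le_of_dvd (by have := hn ω₀; omega) h30
      exact_mod_cast (by omega : 12 ≤ N)
    have e0 : 0 < 2 / (N : ℚ) := by positivity
    have e1 : ∑ ω, (n ω : ℚ)⁻¹ ≤ Fintype.card Ω * 2⁻¹ := by
      rw [← nsmul_eq_mul, ← Finset.card_univ]
      refine Finset.sum_le_card_nsmul _ _ _ fun ω _ => inv_anti₀ (by norm_num) ?_
      exact_mod_cast hn ω
    have e2 : (4 : ℚ) / N ≤ ∑ ω, (n ω : ℚ)⁻¹ := by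
      refine le_trans ?_ (Finset.single_le_sum (f := fun ω => (n ω : ℚ)⁻¹)
        (fun ω _ => by positivity) (Finset.mem_univ ω₀))
      have : (0 : ℚ) < n ω₀ := by have := hn ω₀; positivity
      have h41 : 4 * (n ω₀ : ℚ) ≤ N := by exact_mod_cast h40
      rw [div_le_iff₀ (by positivity)]
      field_simp
      exact h41
    have e3 : (4 : ℚ) / N = 2 * (2 / N) := by ring
    rw [hQ] at e1 e2
    have l1 : (Fintype.card Ω : ℚ) < 4 := by linarith
    have l2 : (2 : ℚ) < Fintype.card Ω := by linarith
    have l1' : Fintype.card Ω < 4 := by exact_mod_cast l1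
    have l2' : 2 < Fintype.card Ω := by exact_mod_cast l2
    omega
  have e := Fintype.equivFinOfCardEq hcard
  have hsum3 : ((n ∘ e.symm) 0 : ℚ)⁻¹ + ((n ∘ e.symm) 1 : ℚ)⁻¹ + ((n ∘ e.symm) 2 : ℚ)⁻¹
      = 1 + 2 / N := by
    rw [hcard, ← Equiv.sum_comp e.symm, Fin.sum_univ_three] at hQ
    simp only [Function.comp_apply]
    rw [hQ]; norm_num
  have hfin := platonic_arith (n := n ∘ e.symm) (N := N) (fun i => hn _) hsum3 (i := e ω₀)
    (by simpa using h30) (by simpa using h40)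
  -- An element different from 1 lies in the stabilizer of a pole, so its order divides the order of
  -- that stabilizer.
  have hall : ∀ f ∈ H, f = 1 ∨ ∃ ω, f ^ n ω = 1 := by
    intro f hf
    by_cases h1 : f = 1
    · exact Or.inl h1
    obtain ⟨x, hx⟩ := hfix ⟨f, hf⟩ (by simpa using h1)
    have hx0 := (hx x).2 (Or.inl rfl)
    refine Or.inr ⟨Quotient.mk'' ⟨x, ⟨f, hf⟩, by simpa using h1, hx0⟩, ?_⟩
    simpa using congrArg Subtype.val (hpow ⟨x, ⟨f, hf⟩, by simpa using h1, hx0⟩ ⟨f, hf⟩ hx0)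
  rcases hfin with h | h
  · left
    intro f hf
    rcases hall f hf with h1 | ⟨ω, h1⟩
    · exact Or.inl h1
    · have h2 := h (e ω)
      simp only [Function.comp_apply, Equiv.symm_apply_apply] at h2
      rcases h2 with h2 | h2 | h2 <;> rw [h2] at h1 <;> simp [h1]
  · right
    intro f hf
    rcases hall f hf with h1 | ⟨ω, h1⟩
    · exact Or.inl h1
    · have h2 := h (e ω)
      simp only [Function.comp_apply, Equiv.symm_apply_apply] at h2
      rcases h2 with h2 | h2 | h2 <;> rw [h2] at h1 <;> simp [h1]

end

section

open scoped Quaternion ComplexConjugate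

/-! ### Linear fractional transformations -/

/-- The point of the Riemann sphere with the given homogeneous coordinates. -/
noncomputable def homog (v₀ v₁ : ℂ) : OnePoint ℂ :=
  open Classical in if v₁ = 0 then OnePoint.infty else ((v₀ / v₁ : ℂ) : OnePoint ℂ)

theorem exists_homog (p : OnePoint ℂ) : ∃ v₀ v₁ : ℂ, (v₀ ≠ 0 ∨ v₁ ≠ 0) ∧ p = homog v₀ v₁ := by
  induction p using OnePoint.rec with
  | infty => exact ⟨1, 0, by simp, by simp [homog]⟩
  | coe z => exact ⟨z, 1, by simp, by simp [homog]⟩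

theorem homog_eq_iff {v₀ v₁ w₀ w₁ : ℂ} (hv : v₀ ≠ 0 ∨ v₁ ≠ 0) (hw : w₀ ≠ 0 ∨ w₁ ≠ 0) :
    homog v₀ v₁ = homog w₀ w₁ ↔ v₀ * w₁ = v₁ * w₀ := by
  unfold homog
  by_cases h1 : v₁ = 0 <;> by_cases h2 : w₁ = 0
  · simp [h1, h2]
  · simp_all
  · simp_all
  · simp only [h1, h2, if_false, OnePoint.coe_eq_coe]
    rw [div_eq_div_iff h1 h2, mul_comm w₀]

theorem mulVec_ne_zero (M : GL (Fin 2) ℂ) {v₀ v₁ : ℂ} (hv : v₀ ≠ 0 ∨ v₁ ≠ 0) :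
    M 0 0 * v₀ + M 0 1 * v₁ ≠ 0 ∨ M 1 0 * v₀ + M 1 1 * v₁ ≠ 0 := by
  by_contra! h
  have hd : M 0 0 * M 1 1 - M 0 1 * M 1 0 ≠ 0 := by
    have := M.det_ne_zero
    rwa [Matrix.det_fin_two] at this
  have h0 : (M 0 0 * M 1 1 - M 0 1 * M 1 0) * v₀ = 0 := by
    linear_combination M 1 1 * h.1 - M 0 1 * h.2
  have h1 : (M 0 0 * M 1 1 - M 0 1 * M 1 0) * v₁ = 0 := by
    linear_combination M 0 0 * h.2 - M 1 0 * h.1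
  simp_all

theorem smul_homog (M : GL (Fin 2) ℂ) {v₀ v₁ : ℂ} (hv : v₀ ≠ 0 ∨ v₁ ≠ 0) :
    M • homog v₀ v₁ = homog (M 0 0 * v₀ + M 0 1 * v₁) (M 1 0 * v₀ + M 1 1 * v₁) := by
  have h3 := mulVec_ne_zero M hv
  by_cases h : v₁ = 0
  · have hv0 : v₀ ≠ 0 := by simpa [h] using hv
    have : homog v₀ v₁ = OnePoint.infty := by simp [homog, h]
    rw [this, OnePoint.smul_infty_eq_ite]
    have h2 : (if M 1 0 = 0 then OnePoint.infty else ((M 0 0 / M 1 0 : ℂ) : OnePoint ℂ))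
      = homog (M 0 0) (M 1 0) := by simp [homog]
    rw [h2, homog_eq_iff _ h3]
    · rw [h]; ring
    · simpa using mulVec_ne_zero M (v₀ := 1) (v₁ := 0) (by simp)
  · have h0 : homog v₀ v₁ = ((v₀ / v₁ : ℂ) : OnePoint ℂ) := by simp [homog, h]
    rw [h0, OnePoint.smul_some_eq_ite]
    have h2 : (if M 1 0 * (v₀ / v₁) + M 1 1 = 0 then OnePoint.infty
        else ((((M 0 0 * (v₀ / v₁) + M 0 1) / (M 1 0 * (v₀ / v₁) + M 1 1)) : ℂ) : OnePoint ℂ))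
      = homog (M 0 0 * (v₀ / v₁) + M 0 1) (M 1 0 * (v₀ / v₁) + M 1 1) := by simp [homog]
    rw [h2, homog_eq_iff _ h3]
    · field_simp
    · simpa using mulVec_ne_zero M (v₀ := v₀ / v₁) (v₁ := 1) (by simp)

/-- A matrix that fixes three points of the projective line is scalar. -/
theorem scalar_of_fixed {M : GL (Fin 2) ℂ} {p₁ p₂ p₃ : OnePoint ℂ} (h₁ : M • p₁ = p₁)
    (h₂ : M • p₂ = p₂) (h₃ : M • p₃ = p₃) (h12 : p₁ ≠ p₂) (h13 : p₁ ≠ p₃) (h23 : p₂ ≠ p₃) :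
    M 0 1 = 0 ∧ M 1 0 = 0 ∧ M 0 0 = M 1 1 := by
  obtain ⟨u₀, u₁, hu, rfl⟩ := exists_homog p₁
  obtain ⟨v₀, v₁, hv, rfl⟩ := exists_homog p₂
  obtain ⟨w₀, w₁, hw, rfl⟩ := exists_homog p₃
  rw [smul_homog M hu, homog_eq_iff (mulVec_ne_zero M hu) hu] at h₁
  rw [smul_homog M hv, homog_eq_iff (mulVec_ne_zero M hv) hv] at h₂
  rw [smul_homog M hw, homog_eq_iff (mulVec_ne_zero M hw) hw] at h₃
  rw [Ne, homog_eq_iff hu hv, ← sub_eq_zero] at h12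
  rw [Ne, homog_eq_iff hu hw, ← sub_eq_zero] at h13
  rw [Ne, homog_eq_iff hv hw, ← sub_eq_zero] at h23
  -- The fixed-point equations are linear in M₀₁, M₁₀ and M₀₀ - M₁₁, with this Vandermonde product
  -- as determinant up to sign; the coefficients below are cofactors.
  have hD : (u₀ * v₁ - u₁ * v₀) * (u₀ * w₁ - u₁ * w₀) * (v₀ * w₁ - v₁ * w₀) ≠ 0 :=
    mul_ne_zero (mul_ne_zero h12 h13) h23
  refine ⟨mul_left_cancel₀ hD ?_, mul_left_cancel₀ hD ?_, mul_left_cancel₀ hD ?_⟩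
  · linear_combination (v₀ * w₀ * (v₀ * w₁ - v₁ * w₀)) * h₁ -
      (u₀ * w₀ * (u₀ * w₁ - u₁ * w₀)) * h₂ + (u₀ * v₀ * (u₀ * v₁ - u₁ * v₀)) * h₃
  · linear_combination -(v₁ * w₁ * (v₀ * w₁ - v₁ * w₀)) * h₁ +
      (u₁ * w₁ * (u₀ * w₁ - u₁ * w₀)) * h₂ - (u₁ * v₁ * (u₀ * v₁ - u₁ * v₀)) * h₃
  · linear_combination -((v₀ * w₁ + v₁ * w₀) * (v₀ * w₁ - v₁ * w₀)) * h₁ +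
      ((u₀ * w₁ + u₁ * w₀) * (u₀ * w₁ - u₁ * w₀)) * h₂
      - ((u₀ * v₁ + u₁ * v₀) * (u₀ * v₁ - u₁ * v₀)) * h₃

theorem smul_eq_self_of_scalar {M : GL (Fin 2) ℂ} (h : M 0 1 = 0 ∧ M 1 0 = 0 ∧ M 0 0 = M 1 1)
    (p : OnePoint ℂ) : M • p = p := by
  obtain ⟨u₀, u₁, hu, rfl⟩ := exists_homog p
  rw [smul_homog M hu, homog_eq_iff (mulVec_ne_zero M hu) hu, h.1, h.2.1, h.2.2]
  ring

/-! ### Spinors, and rotations as special unitary matrices -/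

/-- `(v₀, v₁)` is a spinor over the point `x` of the sphere. -/
def IsSpinor (x : S2) (v₀ v₁ : ℂ) : Prop :=
  (v₀ ≠ 0 ∨ v₁ ≠ 0) ∧
  (Complex.normSq v₀ + Complex.normSq v₁) * x.1 0 = 2 * (v₀.re * v₁.re + v₀.im * v₁.im) ∧
  (Complex.normSq v₀ + Complex.normSq v₁) * x.1 1 = 2 * (v₀.im * v₁.re - v₀.re * v₁.im) ∧
  (Complex.normSq v₀ + Complex.normSq v₁) * x.1 2 = Complex.normSq v₀ - Complex.normSq v₁

theorem sphere_sq_sum (x : S2) : x.1 0 ^ 2 + x.1 1 ^ 2 + x.1 2 ^ 2 = 1 := by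
  simpa using coord_sq_sum (EuclideanSpace.basisFun (Fin 3) ℝ) x

theorem normSq_add_pos {v₀ v₁ : ℂ} (hv : v₀ ≠ 0 ∨ v₁ ≠ 0) :
    0 < Complex.normSq v₀ + Complex.normSq v₁ := by
  rcases hv with h | h
  · exact add_pos_of_pos_of_nonneg (Complex.normSq_pos.2 h) (Complex.normSq_nonneg _)
  · exact add_pos_of_nonneg_of_pos (Complex.normSq_nonneg _) (Complex.normSq_pos.2 h)

theorem IsSpinor.stereo_eq {x : S2} {v₀ v₁ : ℂ} (h : IsSpinor x v₀ v₁) :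
    stereo x = homog v₀ v₁ := by
  obtain ⟨hv, h0, h1, h2⟩ := h
  have hN := normSq_add_pos hv
  set N := Complex.normSq v₀ + Complex.normSq v₁ with hNd
  have h3 : N * (1 - x.1 2) = 2 * Complex.normSq v₁ := by rw [mul_sub, h2, hNd]; ring
  unfold stereo homog
  by_cases hv1 : v₁ = 0
  · rw [if_pos, if_pos hv1]
    rw [hv1] at h3
    simp at h3
    rcases h3 with h3 | h3
    · exact absurd h3 hN.ne'
    · linarith
  · have h4 : 0 < Complex.normSq v₁ := Complex.normSq_pos.2 hv1
    have hx : x.1 2 ≠ 1 := by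
      intro h5
      rw [h5] at h3
      simp at h3
      exact hv1 h3
    rw [if_neg hx, if_neg hv1]
    congr 1
    have hx' : (1 - (x.1 2 : ℂ)) ≠ 0 := by
      intro h
      apply hx
      have h5 : (1 : ℂ) = (x.1 2 : ℂ) := by linear_combination h
      exact_mod_cast h5.symm
    rw [div_eq_div_iff hx' hv1]
    have hNc : (N : ℂ) ≠ 0 := by exact_mod_cast hN.ne'
    apply mul_left_cancel₀ hNc
    apply Complex.ext
    · simp
      left
      apply mul_left_cancel₀ hN.ne'
      simp only [Complex.normSq_apply] at h0 h1 h3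
      linear_combination v₁.re * h0 - v₁.im * h1 - v₀.re * h3
    · simp
      left
      apply mul_left_cancel₀ hN.ne'
      simp only [Complex.normSq_apply] at h0 h1 h3
      linear_combination v₁.im * h0 + v₁.re * h1 - v₀.im * h3

theorem exists_spinor (x : S2) : ∃ v₀ v₁, IsSpinor x v₀ v₁ := by
  have h := sphere_sq_sum x
  by_cases h2 : x.1 2 = 1
  · have h0 : x.1 0 = 0 := by rw [h2] at h; nlinarith [sq_nonneg (x.1 0), sq_nonneg (x.1 1)]
    have h1 : x.1 1 = 0 := by rw [h2] at h; nlinarith [sq_nonneg (x.1 0), sq_nonneg (x.1 1)]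
    exact ⟨1, 0, by simp, by simp [h0], by simp [h1], by simp [h2]⟩
  -- Numerator and denominator of the stereographic projection; both vanish only at the north pole,
  -- treated above.
  · refine ⟨⟨x.1 0, x.1 1⟩, ((1 - x.1 2 : ℝ) : ℂ), Or.inr ?_, ?_, ?_, ?_⟩
    · rw [Complex.ofReal_ne_zero]
      exact sub_ne_zero.2 (Ne.symm h2)
    all_goals simp only [Complex.normSq_apply, Complex.ofReal_re, Complex.ofReal_im]
    · linear_combination x.1 0 * h
    · linear_combination x.1 1 * h
    · linear_combination (x.1 2 - 1) * h

theorem IsSpinor.congr {x : S2} {v₀ v₁ w₀ w₁ : ℂ} (h : IsSpinor x v₀ v₁) (hw : w₀ ≠ 0 ∨ w₁ ≠ 0)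
    (hvw : v₀ * w₁ = v₁ * w₀) : IsSpinor x w₀ w₁ := by
  obtain ⟨hv, h0, h1, h2⟩ := h
  obtain ⟨c, rfl, rfl⟩ : ∃ c, w₀ = c * v₀ ∧ w₁ = c * v₁ := by
    rcases hv with hv | hv
    · exact ⟨w₀ / v₀, by field_simp, by field_simp; linear_combination hvw⟩
    · exact ⟨w₁ / v₁, by field_simp; linear_combination -hvw, by field_simp⟩
  refine ⟨hw, ?_, ?_, ?_⟩ <;> simp only [Complex.normSq_apply, Complex.mul_re, Complex.mul_im] at *
  · linear_combination (c.re ^ 2 + c.im ^ 2) * h0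
  · linear_combination (c.re ^ 2 + c.im ^ 2) * h1
  · linear_combination (c.re ^ 2 + c.im ^ 2) * h2

theorem stereo_eq_homog_iff {x : S2} {v₀ v₁ : ℂ} (hv : v₀ ≠ 0 ∨ v₁ ≠ 0) :
    stereo x = homog v₀ v₁ ↔ IsSpinor x v₀ v₁ := by
  refine ⟨fun h => ?_, IsSpinor.stereo_eq⟩
  obtain ⟨w₀, w₁, hw⟩ := exists_spinor x
  rw [hw.stereo_eq, homog_eq_iff hw.1 hv] at h
  exact hw.congr hv h

theorem stereo_injective : Function.Injective stereo := by
  intro x y h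
  obtain ⟨v₀, v₁, hv⟩ := exists_spinor x
  rw [hv.stereo_eq, eq_comm, stereo_eq_homog_iff hv.1] at h
  obtain ⟨hn, h0, h1, h2⟩ := hv
  obtain ⟨-, g0, g1, g2⟩ := h
  have hN := (normSq_add_pos hn).ne'
  apply Subtype.ext
  ext i
  fin_cases i
  · exact mul_left_cancel₀ hN (h0.trans g0.symm)
  · exact mul_left_cancel₀ hN (h1.trans g1.symm)
  · exact mul_left_cancel₀ hN (h2.trans g2.symm)

/-- The special unitary matrix of a unit quaternion. -/
noncomputable def quatMatrix (q : ℍ[ℝ]) : Matrix (Fin 2) (Fin 2) ℂ :=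
  !![⟨q.re, q.imK⟩, ⟨-q.imJ, q.imI⟩; ⟨q.imJ, q.imI⟩, ⟨q.re, -q.imK⟩]

theorem det_quatMatrix {q : ℍ[ℝ]} (hq : Quaternion.normSq q = 1) : (quatMatrix q).det = 1 := by
  rw [Quaternion.normSq_def'] at hq
  rw [quatMatrix, Matrix.det_fin_two_of]
  apply Complex.ext <;> simp
  · linear_combination hq
  · ring

/-- The invertible matrix of a unit quaternion. -/
noncomputable def quatGL {q : ℍ[ℝ]} (hq : Quaternion.normSq q = 1) : GL (Fin 2) ℂ :=
  Matrix.GeneralLinearGroup.mkOfDetNeZero (quatMatrix q) (by rw [det_quatMatrix hq]; simp)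

theorem quatGL_coe {q : ℍ[ℝ]} (hq : Quaternion.normSq q = 1) :
    (quatGL hq : Matrix (Fin 2) (Fin 2) ℂ) = quatMatrix q := rfl

/-- This is the covering SU(2) → SO(3): applying the matrix of q to a spinor over x gives a spinor
over the rotated point. The required identities are linear combinations of those for x and of |q| =
1. -/
theorem QuatRep.stereo_smul {q : ℍ[ℝ]} {f : Equiv.Perm S2}
    (hf : QuatRep (EuclideanSpace.basisFun (Fin 3) ℝ) q f) (x : S2) :
    stereo (f x) = quatGL hf.1 • stereo x := by
  obtain ⟨v₀, v₁, hv⟩ := exists_spinor x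
  rw [hv.stereo_eq, smul_homog _ hv.1, stereo_eq_homog_iff (mulVec_ne_zero _ hv.1)]
  refine ⟨mulVec_ne_zero _ hv.1, ?_⟩
  obtain ⟨hn, h0, h1, h2⟩ := hv
  obtain ⟨c0, c1, c2⟩ := hf.coords x
  have hq := hf.1
  rw [Quaternion.normSq_def'] at hq
  simp only [EuclideanSpace.basisFun_repr] at c0 c1 c2
  rw [c0, c1, c2]
  simp only [quatGL_coe, quatMatrix, Matrix.cons_val', Matrix.cons_val_zero, Matrix.cons_val_one,
    Matrix.of_apply, Matrix.cons_val_fin_one, Complex.normSq_apply, Complex.add_re, Complex.add_im,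
    Complex.mul_re, Complex.mul_im] at *
  set N := v₀.re * v₀.re + v₀.im * v₀.im + (v₁.re * v₁.re + v₁.im * v₁.im) with hN
  refine ⟨?_, ?_, ?_⟩
  · linear_combination (N * ((q.re ^ 2 + q.imI ^ 2 - q.imJ ^ 2 - q.imK ^ 2) * x.1 0
        + 2 * (q.imI * q.imJ - q.re * q.imK) * x.1 1
        + 2 * (q.imI * q.imK + q.re * q.imJ) * x.1 2)) * hq
        + (q.re ^ 2 + q.imI ^ 2 - q.imJ ^ 2 - q.imK ^ 2) * h0
        + 2 * (q.imI * q.imJ - q.re * q.imK) * h1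
        + 2 * (q.imI * q.imK + q.re * q.imJ) * h2
  · linear_combination (N * (2 * (q.imI * q.imJ + q.re * q.imK) * x.1 0
        + (q.re ^ 2 - q.imI ^ 2 + q.imJ ^ 2 - q.imK ^ 2) * x.1 1
        + 2 * (q.imJ * q.imK - q.re * q.imI) * x.1 2)) * hq
        + 2 * (q.imI * q.imJ + q.re * q.imK) * h0
        + (q.re ^ 2 - q.imI ^ 2 + q.imJ ^ 2 - q.imK ^ 2) * h1
        + 2 * (q.imJ * q.imK - q.re * q.imI) * h2
  · linear_combination (N * (2 * (q.imI * q.imK - q.re * q.imJ) * x.1 0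
        + 2 * (q.imJ * q.imK + q.re * q.imI) * x.1 1
        + (q.re ^ 2 - q.imI ^ 2 - q.imJ ^ 2 + q.imK ^ 2) * x.1 2)) * hq
        + 2 * (q.imI * q.imK - q.re * q.imJ) * h0
        + 2 * (q.imJ * q.imK + q.re * q.imI) * h1
        + (q.re ^ 2 - q.imI ^ 2 - q.imJ ^ 2 + q.imK ^ 2) * h2

theorem rotations_le_linearFractional : rotations ≤ linearFractional := by
  intro f hf
  obtain ⟨q, hq⟩ := exists_quatRep (EuclideanSpace.basisFun (Fin 3) ℝ) hf
  exact ⟨quatGL hq.1, hq.stereo_smul⟩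

/-- A linear fractional transformation with three fixed points is the identity. -/
theorem linearFractional_eq_one {f : Equiv.Perm S2} (hf : f ∈ linearFractional) {x y z : S2}
    (hx : f x = x) (hy : f y = y) (hz : f z = z) (hxy : x ≠ y) (hxz : x ≠ z) (hyz : y ≠ z) :
    f = 1 := by
  obtain ⟨M, hM⟩ := hf
  have h := scalar_of_fixed (M := M) (p₁ := stereo x) (p₂ := stereo y) (p₃ := stereo z)
    (by rw [← hM, hx]) (by rw [← hM, hy]) (by rw [← hM, hz])
    (stereo_injective.ne hxy) (stereo_injective.ne hxz) (stereo_injective.ne hyz)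
  exact Equiv.ext fun t => stereo_injective (by rw [hM, smul_eq_self_of_scalar h]; rfl)

/-- The quotient of the matrices fixes three points of the sphere, so it is scalar. This makes a
quantity that is insensitive to scaling a function of the transformation alone. -/
theorem exists_smul_eq_of_action_eq {M N : GL (Fin 2) ℂ} {f : Equiv.Perm S2}
    (hM : ∀ x, stereo (f x) = M • stereo x) (hN : ∀ x, stereo (f x) = N • stereo x) :
    ∃ c : ℂ, (M : Matrix (Fin 2) (Fin 2) ℂ) = c • (N : Matrix (Fin 2) (Fin 2) ℂ) := by
  have h0 : ∀ x, (N⁻¹ * M) • stereo x = stereo x := fun x => by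
    rw [mul_smul, ← hM, hN, inv_smul_smul]
  let b := EuclideanSpace.basisFun (Fin 3) ℝ
  obtain ⟨x, hx0, hx1, hx2⟩ := exists_pt b (u := 1) (v := 0) (w := 0) (by norm_num)
  obtain ⟨y, hy0, hy1, hy2⟩ := exists_pt b (u := 0) (v := 1) (w := 0) (by norm_num)
  obtain ⟨z, hz0, hz1, hz2⟩ := exists_pt b (u := 0) (v := 0) (w := 1) (by norm_num)
  have h := scalar_of_fixed (h0 x) (h0 y) (h0 z)
    (stereo_injective.ne (by rintro rfl; rw [hx0] at hy0; norm_num at hy0))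
    (stereo_injective.ne (by rintro rfl; rw [hx0] at hz0; norm_num at hz0))
    (stereo_injective.ne (by rintro rfl; rw [hy1] at hz1; norm_num at hz1))
  refine ⟨(N⁻¹ * M) 1 1, ?_⟩
  have h1 : M = N * (N⁻¹ * M) := by group
  have h2 : ((N⁻¹ * M : GL (Fin 2) ℂ) : Matrix (Fin 2) (Fin 2) ℂ)
      = (N⁻¹ * M) 1 1 • (1 : Matrix (Fin 2) (Fin 2) ℂ) := by
    ext i j
    fin_cases i <;> fin_cases j
    · simpa using h.2.2
    · simpa using h.1
    · simpa using h.2.1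
    · simp
  conv_lhs => rw [h1, Units.val_mul, h2]
  simp

open Matrix in
/-- A linear fractional transformation given by a multiple of a unitary matrix is a rotation. -/
theorem mem_rotations_of_unitary {M : GL (Fin 2) ℂ} {f : Equiv.Perm S2}
    (hM : ∀ x, stereo (f x) = M • stereo x) {κ : ℝ} (hκ : 0 < κ)
    (h : (M : Matrix (Fin 2) (Fin 2) ℂ) * (M : Matrix (Fin 2) (Fin 2) ℂ)ᴴ
      = (κ : ℂ) • (1 : Matrix (Fin 2) (Fin 2) ℂ)) : f ∈ rotations := by
  -- Division by a square root of the determinant gives the matrix A, B, C, D of determinant 1,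
  -- which is still a multiple of a unitary one.
  obtain ⟨μ, hμ⟩ : ∃ μ : ℂ, μ ^ 2 = M 0 0 * M 1 1 - M 0 1 * M 1 0 :=
    IsAlgClosed.exists_pow_nat_eq _ (by norm_num)
  have hd : M 0 0 * M 1 1 - M 0 1 * M 1 0 ≠ 0 := by
    have := M.det_ne_zero
    rwa [Matrix.det_fin_two] at this
  have hμ0 : μ ≠ 0 := by rintro rfl; apply hd; rw [← hμ]; ring
  have h00 := congrFun (congrFun h 0) 0
  have h01 := congrFun (congrFun h 0) 1
  have h10 := congrFun (congrFun h 1) 0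
  have h11 := congrFun (congrFun h 1) 1
  simp [Matrix.mul_apply, Fin.sum_univ_two] at h00 h01 h10 h11
  obtain ⟨A, hA⟩ : ∃ A, A = M 0 0 / μ := ⟨_, rfl⟩
  obtain ⟨B, hB⟩ : ∃ B, B = M 0 1 / μ := ⟨_, rfl⟩
  obtain ⟨C, hC⟩ : ∃ C, C = M 1 0 / μ := ⟨_, rfl⟩
  obtain ⟨D, hD⟩ : ∃ D, D = M 1 1 / μ := ⟨_, rfl⟩
  rw [eq_div_iff hμ0] at hA hB hC hD
  rw [← hA, ← hB, ← hC, ← hD] at hμ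
  rw [← hA, ← hB] at h00
  rw [← hA, ← hB, ← hC, ← hD] at h01 h10
  rw [← hC, ← hD] at h11
  have hdet : A * D - B * C = 1 := by
    apply mul_left_cancel₀ (pow_ne_zero 2 hμ0)
    linear_combination -hμ
  simp only [map_mul] at h00 h01 h10 h11
  have hm : μ * conj μ ≠ 0 := by simpa using hμ0
  set ν : ℂ := κ / (μ * conj μ) with hν
  have g00 : A * conj A + B * conj B = ν := by rw [hν, eq_div_iff hm]; linear_combination h00
  have g11 : C * conj C + D * conj D = ν := by rw [hν, eq_div_iff hm]; linear_combination h11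
  have g01 : A * conj C + B * conj D = 0 := by
    apply mul_right_cancel₀ hm; linear_combination h01
  have g10 : C * conj A + D * conj B = 0 := by
    apply mul_right_cancel₀ hm; linear_combination h10
  have hdet' : conj A * conj D - conj B * conj C = 1 := by
    have := congrArg conj hdet
    simpa using this
  -- Determinants in U U* = ν: both U and U* have determinant 1. As ν is positive, it is 1 and U is
  -- unitary.
  have hν2 : ν ^ 2 = 1 := by
    linear_combination (-ν) * g00 - (A * conj A + B * conj B) * g11
      + (C * conj A + D * conj B) * g01 + (conj A * conj D - conj B * conj C) * hdet + hdet'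
  have hν1 : ν = 1 := by
    have h1 : ν = ((κ / Complex.normSq μ : ℝ) : ℂ) := by
      rw [hν, Complex.mul_conj]; push_cast; rfl
    have h2 : 0 < κ / Complex.normSq μ := div_pos hκ (Complex.normSq_pos.2 hμ0)
    rw [h1] at hν2 ⊢
    have h3 : (κ / Complex.normSq μ) ^ 2 = 1 := by exact_mod_cast hν2
    have h4 : κ / Complex.normSq μ = 1 := by nlinarith
    rw [h4]; simp
  rw [hν1] at g00
  have eC : B = -conj C := by
    have h1 : C + conj B = 0 := by linear_combination (-C) * g00 + A * g10 - conj B * hdet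
    have h2 := congrArg conj h1
    simp at h2
    linear_combination h2
  have eD : D = conj A := by linear_combination (-D) * g00 + B * g10 + conj A * hdet
  -- A special unitary matrix is determined by its first column; these are the components read off
  -- from `quatMatrix`.
  let q : ℍ[ℝ] := ⟨A.re, C.im, C.re, A.im⟩
  have hq : Quaternion.normSq q = 1 := by
    rw [Quaternion.normSq_def']
    rw [eC, eD] at hdet
    have := congrArg Complex.re hdet
    simp at this
    change A.re ^ 2 + C.im ^ 2 + C.re ^ 2 + A.im ^ 2 = 1
    linear_combination this
  have hU : quatMatrix q = !![A, B; C, D] := by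
    rw [eC, eD]
    ext i j
    fin_cases i <;> fin_cases j <;> apply Complex.ext <;> simp [quatMatrix, q]
  obtain ⟨g, hg, hgq⟩ := exists_rotation (EuclideanSpace.basisFun (Fin 3) ℝ) hq
  suffices f = g by rwa [this]
  refine Equiv.ext fun x => stereo_injective ?_
  rw [hM, hgq.stereo_smul]
  obtain ⟨v₀, v₁, hv⟩ := exists_spinor x
  rw [hv.stereo_eq, smul_homog _ hv.1, smul_homog _ hv.1,
    homog_eq_iff (mulVec_ne_zero _ hv.1) (mulVec_ne_zero _ hv.1)]
  simp only [quatGL_coe, hU, ← hA, ← hB, ← hC, ← hD]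
  simp
  ring

/-! ### Averaging Hermitian forms over a finite group of linear fractional transformations -/

open Matrix in
/-- The Hermitian form of a linear fractional transformation. -/
noncomputable def hermForm (M : Matrix (Fin 2) (Fin 2) ℂ) : Matrix (Fin 2) (Fin 2) ℂ :=
  ((‖M.det‖⁻¹ : ℝ) : ℂ) • (M * Mᴴ)

open Matrix in
-- The factor 1/|det M| is there for this: the form depends only on the transformation and not on
-- the choice of its matrix.
theorem hermForm_smul {c : ℂ} (hc : c ≠ 0) (M : Matrix (Fin 2) (Fin 2) ℂ) :
    hermForm (c • M) = hermForm M := by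
  have h : c * conj c ≠ 0 := by simpa using hc
  have h2 : ((‖c‖ : ℂ)) ^ 2 = c * conj c := by
    rw [Complex.mul_conj, Complex.normSq_eq_norm_sq]; push_cast; rfl
  rw [hermForm, hermForm, Matrix.det_smul, Matrix.conjTranspose_smul, Matrix.smul_mul,
    Matrix.mul_smul, smul_smul, smul_smul]
  congr 1
  simp only [Fintype.card_fin, norm_mul, norm_pow]
  push_cast
  rw [mul_inv, h2]
  have hc' : conj c ≠ 0 := by simpa using hc
  simp only [Complex.star_def]
  field_simp

open Matrix in
-- Left multiplication permutes the forms of a group up to the congruence by M; hence their sum is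
-- invariant.
theorem hermForm_mul (M N : Matrix (Fin 2) (Fin 2) ℂ) :
    hermForm (M * N) = ((‖M.det‖⁻¹ : ℝ) : ℂ) • (M * hermForm N * Mᴴ) := by
  rw [hermForm, hermForm, Matrix.det_mul, Matrix.conjTranspose_mul, Matrix.mul_smul,
    Matrix.smul_mul, smul_smul]
  congr 1
  · simp [mul_comm]
  · simp only [Matrix.mul_assoc]

/-- Of positive definiteness only this is needed: once the averaged form is known to be scalar, it
is not zero. -/
theorem hermForm_trace_pos (M : GL (Fin 2) ℂ) : ∃ r : ℝ, 0 < r ∧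
    hermForm (M : Matrix (Fin 2) (Fin 2) ℂ) 0 0 + hermForm (M : Matrix (Fin 2) (Fin 2) ℂ) 1 1
      = r := by
  have hdet : 0 < ‖(M : Matrix (Fin 2) (Fin 2) ℂ).det‖ := norm_pos_iff.2 M.det_ne_zero
  have h0 : 0 < Complex.normSq (M 0 0) + Complex.normSq (M 1 0) := by
    apply normSq_add_pos
    simpa using mulVec_ne_zero M (v₀ := 1) (v₁ := 0) (by simp)
  have h1 : 0 < Complex.normSq (M 0 1) + Complex.normSq (M 1 1) := by
    apply normSq_add_pos
    simpa using mulVec_ne_zero M (v₀ := 0) (v₁ := 1) (by simp)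
  refine ⟨‖(M : Matrix (Fin 2) (Fin 2) ℂ).det‖⁻¹ * (Complex.normSq (M 0 0)
    + Complex.normSq (M 1 0) + (Complex.normSq (M 0 1) + Complex.normSq (M 1 1))),
    by positivity, ?_⟩
  simp [hermForm, Matrix.mul_apply, Fin.sum_univ_two, Complex.mul_conj]
  ring

open Matrix in
/-- A finite group of linear fractional transformations whose rotations have no common fixed
point consists of rotations. -/
theorem finite_le_rotations {H : Subgroup (Equiv.Perm S2)} [Finite H]
    (hH : H ≤ linearFractional) (hfix : ∀ x : S2, ∃ g ∈ H, g ∈ rotations ∧ g x ≠ x) :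
    H ≤ rotations := by
  classical
  have := Fintype.ofFinite H
  choose! M hM using fun (h : Equiv.Perm S2) (hh : h ∈ H) => hH hh
  set S : Matrix (Fin 2) (Fin 2) ℂ := ∑ h : H, hermForm (M h) with hS
  -- The matrix of the product g h chosen by `M` differs from the product of matrices by a factor,
  -- which the form ignores.
  have hinv : ∀ g ∈ H, ∀ A : GL (Fin 2) ℂ, (∀ x, stereo (g x) = A • stereo x) →
      ((‖(A : Matrix (Fin 2) (Fin 2) ℂ).det‖⁻¹ : ℝ) : ℂ) •
        ((A : Matrix (Fin 2) (Fin 2) ℂ) * S * (A : Matrix (Fin 2) (Fin 2) ℂ)ᴴ) = S := by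
    intro g hg A hA
    rw [hS, Matrix.mul_sum, Matrix.sum_mul, Finset.smul_sum]
    rw [← Equiv.sum_comp (Equiv.mulLeft (⟨g, hg⟩ : H)) (fun h : H => hermForm (M h))]
    refine Finset.sum_congr rfl fun h _ => ?_
    rw [← hermForm_mul]
    have h1 : ∀ x, stereo ((g * h : Equiv.Perm S2) x) = (A * M h) • stereo x := fun x => by
      rw [Equiv.Perm.mul_apply, hA, hM h h.2, mul_smul]
    obtain ⟨c, hc⟩ := exists_smul_eq_of_action_eq h1 (hM (g * h) (H.mul_mem hg h.2))
    have hc0 : c ≠ 0 := by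
      rintro rfl
      have := (A * M h).det_ne_zero
      rw [hc] at this
      simp at this
    rw [Units.val_mul] at hc
    rw [hc, hermForm_smul hc0]
    rfl
  have h00 : ∃ r : ℝ, 0 < r ∧ S 0 0 + S 1 1 = r := by
    choose r hr hrS using fun h : H => hermForm_trace_pos (M h)
    refine ⟨∑ h, r h, Finset.sum_pos (fun h _ => hr h) Finset.univ_nonempty, ?_⟩
    simp only [hS, Matrix.sum_apply, ← Finset.sum_add_distrib, hrS]
    push_cast
    rfl
  have hherm : Sᴴ = S := by
    simp only [hS, Matrix.conjTranspose_sum, hermForm, Matrix.conjTranspose_smul,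
      Matrix.conjTranspose_mul, Matrix.conjTranspose_conjTranspose]
    simp
  obtain ⟨r, hr, hrS⟩ := h00
  have e00 : (S 0 0).im = 0 := by
    have := congrFun (congrFun hherm 0) 0
    exact Complex.conj_eq_iff_im.1 this
  have e11 : (S 1 1).im = 0 := by
    have := congrFun (congrFun hherm 1) 1
    exact Complex.conj_eq_iff_im.1 this
  have e01 : S 1 0 = conj (S 0 1) := (congrFun (congrFun hherm 1) 0).symm
  -- The traceless part of a Hermitian 2 × 2 matrix is a vector of three-space. If it were not zero,
  -- its direction would be fixed by every rotation in H.
  have hzero : (S 0 1).re ^ 2 + (S 0 1).im ^ 2 + (((S 0 0).re - (S 1 1).re) / 2) ^ 2 = 0 := by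
    by_contra hne
    set t := √((S 0 1).re ^ 2 + (S 0 1).im ^ 2 + (((S 0 0).re - (S 1 1).re) / 2) ^ 2) with ht
    have ht2 : t ^ 2 = _ := Real.sq_sqrt (by positivity)
    have ht0 : t ≠ 0 := by
      intro h0
      rw [h0] at ht2
      exact hne (by linarith)
    obtain ⟨x, hx0, hx1, hx2⟩ := exists_pt (EuclideanSpace.basisFun (Fin 3) ℝ)
      (u := (S 0 1).re / t) (v := (S 0 1).im / t) (w := ((S 0 0).re - (S 1 1).re) / 2 / t)
      (by field_simp; linear_combination -4 * ht2)
    obtain ⟨g, hgH, hg, hgx⟩ := hfix x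
    obtain ⟨q, hq⟩ := exists_quatRep (EuclideanSpace.basisFun (Fin 3) ℝ) hg
    apply hgx
    rw [hq.fixed_iff, hx0, hx1, hx2]
    have h1 := hinv g hgH _ hq.stereo_smul
    have hn := hq.1
    rw [Quaternion.normSq_def'] at hn
    have hU : (quatMatrix q)ᴴ * quatMatrix q = 1 := by
      ext i j
      fin_cases i <;> fin_cases j <;> apply Complex.ext <;>
        simp [quatMatrix, Matrix.mul_apply, Fin.sum_univ_two] <;>
        first | linear_combination hn | ring
    rw [quatGL_coe, det_quatMatrix hq.1] at h1
    simp only [norm_one, inv_one, Complex.ofReal_one, one_smul] at h1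
    -- Invariance under a unitary matrix is commutation, and commutation with S says that the axis
    -- of q is parallel to the vector of S.
    have h2 : quatMatrix q * S = S * quatMatrix q := by
      conv_rhs => rw [← h1]
      rw [Matrix.mul_assoc, hU, Matrix.mul_one]
    have h3 := congrFun (congrFun h2 0) 0
    have h4 := congrFun (congrFun h2 0) 1
    simp [Matrix.mul_apply, Fin.sum_univ_two, quatMatrix] at h3 h4
    rw [e01] at h3
    have a1 := congrArg Complex.re h3
    have a2 := congrArg Complex.re h4
    have a3 := congrArg Complex.im h4
    simp [e00, e11] at a1 a2 a3
    field_simp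
    refine ⟨?_, ?_, ?_⟩
    · linear_combination a1 / 2
    · linear_combination -a3
    · linear_combination a2
  obtain ⟨d, hd⟩ : ∃ d, d = ((S 0 0).re - (S 1 1).re) / 2 := ⟨_, rfl⟩
  rw [← hd] at hzero
  have p1 := sq_nonneg (S 0 1).re
  have p2 := sq_nonneg (S 0 1).im
  have p3 := sq_nonneg d
  have z1 : (S 0 1).re = 0 := by nlinarith
  have z2 : (S 0 1).im = 0 := by nlinarith
  have z3 : d = 0 := by nlinarith
  have hr2 : (S 0 0).re + (S 1 1).re = r := by
    have := congrArg Complex.re hrS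
    simpa using this
  have hscal : S = ((r / 2 : ℝ) : ℂ) • (1 : Matrix (Fin 2) (Fin 2) ℂ) := by
    ext i j
    fin_cases i <;> fin_cases j <;> apply Complex.ext <;> simp [z1, z2, e00, e11, e01] <;> linarith
  -- With S scalar, invariance under g says that M M* = |det M|, so g is a rotation.
  intro g hg
  have h1 := hinv g hg _ (hM g hg)
  have hdet : 0 < ‖(M g : Matrix (Fin 2) (Fin 2) ℂ).det‖ := norm_pos_iff.2 (M g).det_ne_zero
  refine mem_rotations_of_unitary (hM g hg) hdet ?_
  rw [hscal] at h1
  have hr0 : ((r / 2 : ℝ) : ℂ) ≠ 0 := by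
    rw [Complex.ofReal_ne_zero]; positivity
  rw [Matrix.mul_smul, Matrix.smul_mul, Matrix.mul_one, smul_comm] at h1
  have h2 := smul_right_injective _ hr0 h1
  rw [← h2, smul_smul, ← Complex.ofReal_mul, mul_inv_cancel₀ hdet.ne']
  simp

end

section

/-! ### Faces and edges at a simple vertex -/

theorem rotationGroup_le_rotations (V : Set S2) : rotationGroup V ≤ rotations := inf_le_left

theorem mem_of_mem_rotationGroup {V : Set S2} {g : Equiv.Perm S2} (hg : g ∈ rotationGroup V)
    {x : S2} (hx : x ∈ V) : g x ∈ V := by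
  have h : g '' V = V := hg.2
  rw [← h]; exact Set.mem_image_of_mem g hx

theorem mem_rotationGroup_of_maps {V : Set S2} (hV : V.Finite) {g : Equiv.Perm S2}
    (hg : g ∈ rotations) (h : ∀ x ∈ V, g x ∈ V) : g ∈ rotationGroup V := by
  refine ⟨hg, ?_⟩
  change g '' V = V
  exact Set.eq_of_subset_of_ncard_le (Set.image_subset_iff.2 h)
    (Set.ncard_image_of_injective V g.injective).ge hV

/-- `A` is a vertex of `V` with three neighbours `B i`, and `⟪n k, v⟫ ≤ c k` are the inequalities
of the three faces at `A`. -/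
structure SimpleVertex (V : Set S2) (A : S2) (B : Fin 3 → S2) (n : Fin 3 → E3) (c : Fin 3 → ℝ) :
    Prop where
  finite : V.Finite
  mem_A : A ∈ V
  mem_B : ∀ i, B i ∈ V
  le : ∀ k, ∀ v ∈ V, inner ℝ (n k) (v : E3) ≤ c k
  eq_A : ∀ k, inner ℝ (n k) (A : E3) = c k
  eq_B : ∀ k i, i ≠ k → inner ℝ (n k) (B i : E3) = c k
  lt_B : ∀ k, inner ℝ (n k) (B k : E3) < c k
  ne_neg : ∀ i, B i ≠ -A

theorem exists_third_index {k l : Fin 3} (h : l ≠ k) :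
    ∃ m : Fin 3, ∀ j, j ≠ m → j = k ∨ j = l := by
  decide +revert

theorem eq_add_one_or_add_two {k m : Fin 3} (h : k ≠ m) : k = m + 1 ∨ k = m + 2 := by
  decide +revert

namespace SimpleVertex

variable {V : Set S2} {A : S2} {B : Fin 3 → S2} {n : Fin 3 → E3} {c : Fin 3 → ℝ}

/-- The normals and the edge vectors at A are dual bases up to positive factors, since face k misses
only the neighbour B k. The local structure at A follows from this duality. -/
theorem inner_sub (h : SimpleVertex V A B n c) (k i : Fin 3) :
    inner ℝ (n k) ((A : E3) - B i) = if i = k then c k - inner ℝ (n k) (B k : E3) else 0 := by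
  rw [_root_.inner_sub_right, h.eq_A]
  split_ifs with hik
  · rw [hik]
  · rw [h.eq_B k i hik, sub_self]

theorem B_ne_A (h : SimpleVertex V A B n c) (i : Fin 3) : B i ≠ A := fun hi => by
  have h1 := h.lt_B i
  rw [hi, h.eq_A] at h1
  exact lt_irrefl _ h1

theorem B_injective (h : SimpleVertex V A B n c) : Function.Injective B := fun i j hij => by
  by_contra hne
  have h1 := h.lt_B i
  rw [hij, h.eq_B i j (Ne.symm hne)] at h1
  exact lt_irrefl _ h1

theorem linearIndependent (h : SimpleVertex V A B n c) : LinearIndependent ℝ n := by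
  rw [Fintype.linearIndependent_iff]
  intro μ hμ i
  have h1 : inner ℝ (∑ k, μ k • n k) ((A : E3) - B i) = 0 := by rw [hμ, inner_zero_left]
  simp only [sum_inner, real_inner_smul_left, h.inner_sub, mul_ite, mul_zero, Finset.sum_ite_eq,
    Finset.mem_univ, if_true] at h1
  have h2 := h.lt_B i
  rcases mul_eq_zero.1 h1 with h3 | h3
  · exact h3
  · linarith

theorem exists_coeff (h : SimpleVertex V A B n c) (m : E3) : ∃ μ : Fin 3 → ℝ, m = ∑ k, μ k • n k := by
  let e := basisOfLinearIndependentOfCardEqFinrank h.linearIndependent (by simp)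
  refine ⟨fun k => e.repr m k, ?_⟩
  conv_lhs => rw [← e.sum_repr m]
  simp [e]

/-- A functional that is maximal at A is a combination of the three normals, with coefficients that
are nonnegative when tested on the neighbours. It is maximal exactly where all normals with positive
coefficient are. -/
theorem exists_of_section (h : SimpleVertex V A B n c) {F : Set S2} (hF : IsSupportSection V F)
    (hA : A ∈ F) : ∃ I : Set (Fin 3), I.Nonempty ∧
      ∀ v, v ∈ F ↔ v ∈ V ∧ ∀ k ∈ I, inner ℝ (n k) (v : E3) = c k := by
  obtain ⟨m, d, hm, hle, rfl⟩ := hF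
  obtain ⟨μ, hμ⟩ := h.exists_coeff m
  have hval : ∀ v : S2, d - inner ℝ m (v : E3) = ∑ k, μ k * (c k - inner ℝ (n k) (v : E3)) := by
    intro v
    rw [← hA.2, hμ]
    simp only [sum_inner, real_inner_smul_left, h.eq_A, mul_sub, Finset.sum_sub_distrib]
  have hμ0 : ∀ i, 0 ≤ μ i := by
    intro i
    have h1 := hval (B i)
    have h2 := hle (B i) (h.mem_B i)
    rw [Finset.sum_eq_single i (fun k _ hk => by rw [h.eq_B k i hk.symm, sub_self, mul_zero])
      (by simp)] at h1
    have h3 := h.lt_B i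
    by_contra! h4
    nlinarith
  refine ⟨{k | μ k ≠ 0}, ?_, fun v => ?_⟩
  · by_contra h1
    rw [Set.not_nonempty_iff_eq_empty, Set.eq_empty_iff_forall_notMem] at h1
    apply hm
    rw [hμ]
    refine Finset.sum_eq_zero fun k _ => ?_
    have : μ k = 0 := by simpa using h1 k
    rw [this, zero_smul]
  · refine and_congr_right fun hv => ?_
    rw [eq_comm, ← sub_eq_zero, hval, Finset.sum_eq_zero_iff_of_nonneg fun k _ =>
      mul_nonneg (hμ0 k) (sub_nonneg.2 (h.le k v hv))]
    simp only [Finset.mem_univ, true_imp_iff, mul_eq_zero, sub_eq_zero, Set.mem_ofPred_eq]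
    refine forall_congr' fun k => ?_
    rw [or_iff_not_imp_left, eq_comm (a := c k)]

/-- The two planes meet in the line through A and B m, and a line meets the sphere in at most two
points. -/
theorem eq_of_two (h : SimpleVertex V A B n c) (m : Fin 3) {v : S2}
    (hv : ∀ k ≠ m, inner ℝ (n k) (v : E3) = c k) : v = A ∨ v = B m := by
  -- The parameter of v on this line, measured by the remaining normal.
  obtain ⟨s, hs⟩ : ∃ s : ℝ, s * (inner ℝ (n m) (A : E3) - inner ℝ (n m) (B m : E3))
      = inner ℝ (n m) (A : E3) - inner ℝ (n m) (v : E3) := by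
    have h1 := h.lt_B m
    rw [← h.eq_A m] at h1
    exact ⟨_, div_mul_cancel₀ _ (sub_ne_zero.2 h1.ne')⟩
  have h1 : (v : E3) = A + s • ((B m : E3) - A) := by
    rw [← sub_eq_zero]
    obtain ⟨μ, hμ⟩ := h.exists_coeff ((v : E3) - (A + s • ((B m : E3) - A)))
    rw [← inner_self_eq_zero (𝕜 := ℝ)]
    conv_lhs => enter [2]; rw [hμ]
    rw [sum_inner]
    refine Finset.sum_eq_zero fun k _ => ?_
    rw [real_inner_smul_left]
    apply mul_eq_zero_of_right
    simp only [_root_.inner_sub_right, inner_add_right, real_inner_smul_right]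
    by_cases hk : k = m
    · subst hk; linarith
    · rw [hv k hk, h.eq_A, h.eq_B k m (Ne.symm hk)]; ring
  have hA := norm_eq_of_mem_sphere A
  have hB := norm_eq_of_mem_sphere (B m)
  have hv' := norm_eq_of_mem_sphere v
  have h2 : ‖(v : E3)‖ ^ 2 = 1 := by rw [hv']; norm_num
  have hA2 : inner ℝ (A : E3) A = (1 : ℝ) := by rw [real_inner_self_eq_norm_sq, hA]; norm_num
  have hB2 : inner ℝ (B m : E3) (B m) = (1 : ℝ) := by
    rw [real_inner_self_eq_norm_sq, hB]; norm_num
  rw [← real_inner_self_eq_norm_sq, h1] at h2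
  simp only [inner_add_left, inner_add_right, _root_.inner_sub_right, _root_.inner_sub_left,
    real_inner_smul_right, real_inner_smul_left, hA2, hB2, real_inner_comm (B m : E3) A] at h2
  set t := inner ℝ (A : E3) (B m : E3) with ht
  have h3 : s * (s - 1) * (1 - t) = 0 := by
    rw [real_inner_comm (A : E3) (B m), ← ht] at h2
    linear_combination h2 / 2
  have h4 : 1 - t ≠ 0 := fun h5 => h.B_ne_A m (Subtype.ext
    ((inner_eq_one_iff_of_norm_eq_one (𝕜 := ℝ) hA hB).1 (by linarith)).symm)
  rcases mul_eq_zero.1 ((mul_eq_zero.1 h3).resolve_right h4) with h5 | h5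
  · left; apply Subtype.ext; rw [h1, h5]; simp
  · right; apply Subtype.ext; rw [h1, sub_eq_zero.1 h5]; simp

/-- If two of the normals occurred in the section it would lie on a line and have only two points.
-/
theorem face_at (h : SimpleVertex V A B n c) {F : Set S2} (hF : IsFace V F) (hA : A ∈ F) :
    ∃ k, F = {v ∈ V | inner ℝ (n k) (v : E3) = c k} := by
  obtain ⟨I, ⟨k, hk⟩, hI⟩ := h.exists_of_section hF.1 hA
  refine ⟨k, ?_⟩
  have hone : ∀ l ∈ I, l = k := by
    intro l hl
    by_contra hlk
    obtain ⟨m, hm⟩ := exists_third_index hlk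
    have hsub : F ⊆ {A, B m} := by
      intro v hv
      have h1 := ((hI v).1 hv).2
      refine h.eq_of_two m fun j hj => ?_
      rcases hm j hj with rfl | rfl
      · exact h1 _ hk
      · exact h1 _ hl
    have h1 := Set.ncard_le_ncard hsub
    have h2 : ({A, B m} : Set S2).ncard ≤ 2 := by
      rw [Set.ncard_pair (h.B_ne_A m).symm]
    have h3 := hF.2
    omega
  ext v
  rw [hI]
  refine and_congr_right fun _ => ⟨fun h1 => h1 k hk, fun h1 l hl => ?_⟩
  rw [hone l hl]; exact h1

theorem edge_at (h : SimpleVertex V A B n c) {X : S2} (hX : IsEdge V A X) : ∃ m, X = B m := by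
  obtain ⟨I, ⟨k, hk⟩, hI⟩ := h.exists_of_section hX.2 (Set.mem_insert _ _)
  have hXk := (hI X).1 (by simp)
  -- With a single normal the section contains the neighbour B (k + 1), which must then be X; this
  -- suffices, although the case cannot occur.
  by_cases hone : ∀ l ∈ I, l = k
  · have h1 : B (k + 1) ∈ ({A, X} : Set S2) := by
      refine (hI _).2 ⟨h.mem_B _, fun l hl => ?_⟩
      rw [hone l hl]
      exact h.eq_B _ _ (by simp)
    rcases h1 with h1 | h1
    · exact absurd h1 (h.B_ne_A _)
    · exact ⟨_, (Set.mem_singleton_iff.1 h1).symm⟩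
  · push Not at hone
    obtain ⟨l, hl, hlk⟩ := hone
    obtain ⟨m, hm⟩ := exists_third_index hlk
    refine ⟨m, (h.eq_of_two m fun j hj => ?_).resolve_left hX.1.symm⟩
    rcases hm j hj with rfl | rfl
    · exact hXk.2 _ hk
    · exact hXk.2 _ hl

theorem isFace (h : SimpleVertex V A B n c) (k : Fin 3) :
    IsFace V {v ∈ V | inner ℝ (n k) (v : E3) = c k} := by
  refine ⟨⟨n k, c k, h.linearIndependent.ne_zero k, h.le k, rfl⟩, ?_⟩
  have hsub : {A, B (k + 1), B (k + 2)} ⊆ {v ∈ V | inner ℝ (n k) (v : E3) = c k} := by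
    rintro v (rfl | rfl | rfl)
    · exact ⟨h.mem_A, h.eq_A k⟩
    · exact ⟨h.mem_B _, h.eq_B _ _ (by simp)⟩
    · exact ⟨h.mem_B _, h.eq_B _ _ (by simp)⟩
  refine le_trans ?_ (Set.ncard_le_ncard hsub (h.finite.subset (Set.sep_subset _ _)))
  rw [Set.ncard_eq_three.2]
  exact ⟨_, _, _, (h.B_ne_A _).symm, (h.B_ne_A _).symm, h.B_injective.ne (by simp), rfl⟩

theorem isEdge (h : SimpleVertex V A B n c) (m : Fin 3) : IsEdge V A (B m) := by
  -- The sum of the normals of the two faces along an edge supports the polyhedron in that edge.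
  refine ⟨(h.B_ne_A m).symm, n (m + 1) + n (m + 2), c (m + 1) + c (m + 2), ?_, ?_, ?_⟩
  · intro h0
    have h1 : inner ℝ (n (m + 1) + n (m + 2)) ((A : E3) - B (m + 1)) = 0 := by
      rw [h0, inner_zero_left]
    rw [inner_add_left, h.inner_sub, h.inner_sub] at h1
    have h2 := h.lt_B (m + 1)
    simp at h1
    linarith
  · intro v hv
    rw [inner_add_left]
    exact add_le_add (h.le _ v hv) (h.le _ v hv)
  · ext v
    constructor
    · rintro (rfl | rfl)
      · exact ⟨h.mem_A, by rw [inner_add_left, h.eq_A, h.eq_A]⟩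
      · exact ⟨h.mem_B _, by
          rw [inner_add_left, h.eq_B _ _ (by simp), h.eq_B _ _ (by simp)]⟩
    · rintro ⟨hv, h1⟩
      rw [inner_add_left] at h1
      have h2 := h.le (m + 1) v hv
      have h3 := h.le (m + 2) v hv
      refine h.eq_of_two m fun k hk => ?_
      rcases eq_add_one_or_add_two hk with rfl | rfl <;> linarith

end SimpleVertex

end

section

/-! ### Transport by symmetries -/

theorem mem_rotOrbit {V : Set S2} {X Y : S2} :
    Y ∈ rotOrbit V X ↔ ∃ g ∈ rotationGroup V, g X = Y :=
  ⟨fun ⟨g, hg⟩ => ⟨g, g.2, hg⟩, fun ⟨g, hg, h⟩ => ⟨⟨g, hg⟩, h⟩⟩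

theorem rotOrbit_eq_of_mem {V : Set S2} {X Y : S2} (h : Y ∈ rotOrbit V X) :
    rotOrbit V Y = rotOrbit V X :=
  MulAction.orbit_eq_iff.2 h

theorem rotOrbit_apply {V : Set S2} {g : Equiv.Perm S2} (hg : g ∈ rotationGroup V) (X : S2) :
    rotOrbit V (g X) = rotOrbit V X :=
  rotOrbit_eq_of_mem (mem_rotOrbit.2 ⟨g, hg, rfl⟩)

theorem mem_rotOrbit_self (V : Set S2) (X : S2) : X ∈ rotOrbit V X := MulAction.mem_orbit_self X

theorem isSupportSection_image {V F : Set S2} {g : Equiv.Perm S2} (hg : g ∈ rotationGroup V)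
    (hF : IsSupportSection V F) : IsSupportSection V (g '' F) := by
  obtain ⟨m, d, hm, hle, rfl⟩ := hF
  obtain ⟨R, -, hR⟩ := hg.1
  have hinv : ∀ v : S2, inner ℝ (R m) (v : E3) = inner ℝ m (g⁻¹ v : E3) := fun v => by
    rw [← R.inner_map_map m, ← hR]
    rw [show g (g⁻¹ v) = v from g.apply_symm_apply v]
  have hV : ∀ v, v ∈ V ↔ g⁻¹ v ∈ V := fun v =>
    ⟨fun h => mem_of_mem_rotationGroup (inv_mem hg) h, fun h => by
      have := mem_of_mem_rotationGroup hg h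
      rwa [show g (g⁻¹ v) = v from g.apply_symm_apply v] at this⟩
  refine ⟨R m, d, fun h => hm (by simpa using h), fun v hv => ?_, ?_⟩
  · rw [hinv]; exact hle _ ((hV v).1 hv)
  · ext v
    rw [g.image_eq_preimage_symm]
    change g⁻¹ v ∈ V ∧ _ ↔ _ ∧ _
    rw [hinv, ← hV]
    rfl

theorem isFace_image {V F : Set S2} {g : Equiv.Perm S2} (hg : g ∈ rotationGroup V)
    (hF : IsFace V F) : IsFace V (g '' F) :=
  ⟨isSupportSection_image hg hF.1, by
    rw [Set.ncard_image_of_injective _ g.injective]; exact hF.2⟩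

theorem isEdge_image {V : Set S2} {X Y : S2} {g : Equiv.Perm S2} (hg : g ∈ rotationGroup V)
    (h : IsEdge V X Y) : IsEdge V (g X) (g Y) :=
  ⟨g.injective.ne h.1, by
    have := isSupportSection_image hg h.2
    rwa [Set.image_pair] at this⟩

theorem IsEdge.mem_left {V : Set S2} {X Y : S2} (h : IsEdge V X Y) : X ∈ V := by
  obtain ⟨-, m, d, -, -, h⟩ := h
  exact (h.subset (Set.mem_insert X {Y})).1

theorem IsEdge.symm {V : Set S2} {X Y : S2} (h : IsEdge V X Y) : IsEdge V Y X :=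
  ⟨h.1.symm, by rw [Set.pair_comm]; exact h.2⟩

theorem isRadialProj_image {g : Equiv.Perm S2} {R : E3 ≃ₗᵢ[ℝ] E3} (hR : ∀ x : S2, (g x : E3) = R x)
    {p : E3} {x : S2} (h : IsRadialProj p x) : IsRadialProj (R p) (g x) := by
  obtain ⟨r, hr, rfl⟩ := h
  exact ⟨r, hr, by rw [hR, R.map_smul]⟩

theorem IsRadialProj.unique {p : E3} {x y : S2} (hx : IsRadialProj p x) (hy : IsRadialProj p y) :
    x = y := by
  obtain ⟨r, hr, rfl⟩ := hx
  obtain ⟨s, hs, h⟩ := hy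
  have h1 := congrArg norm h
  rw [norm_smul, norm_smul, norm_eq_of_mem_sphere, norm_eq_of_mem_sphere, Real.norm_of_nonneg hr.le,
    Real.norm_of_nonneg hs.le, mul_one, mul_one] at h1
  rw [h1] at h
  exact Subtype.ext (smul_right_injective _ hs.ne' h)

theorem faceCentre_image {F : Set S2} (hF : F.Finite) {g : Equiv.Perm S2} {R : E3 ≃ₗᵢ[ℝ] E3}
    (hR : ∀ x : S2, (g x : E3) = R x) : faceCentre (g '' F) = R (faceCentre F) := by
  unfold faceCentre
  rw [Set.ncard_image_of_injective _ g.injective, finsum_mem_image g.injective.injOn, R.map_smul]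
  congr 1
  simp only [hR]
  exact ((R.toLinearEquiv : E3 →ₗ[ℝ] E3).toAddMonoidHom.map_finsum_mem _ hF).symm

theorem midpoint_image {g : Equiv.Perm S2} {R : E3 ≃ₗᵢ[ℝ] E3} (hR : ∀ x : S2, (g x : E3) = R x)
    (X Y : S2) : midpoint ℝ (g X : E3) (g Y : E3) = R (midpoint ℝ (X : E3) (Y : E3)) := by
  rw [hR, hR, midpoint_eq_smul_add, midpoint_eq_smul_add, R.map_smul, map_add]

/-- A simple vertex of a polyhedron whose rotations act transitively on the vertices and
cyclically on the neighbours of this one. -/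
structure RegularVertex (V : Set S2) (A : S2) (B : Fin 3 → S2) (n : Fin 3 → E3) (c : Fin 3 → ℝ) :
    Prop extends SimpleVertex V A B n c where
  transitive : ∀ v ∈ V, ∃ g ∈ rotationGroup V, g v = A
  cyclic : ∃ r ∈ rotationGroup V, r A = A ∧ ∀ i, r (B i) = B (i + 1)

namespace RegularVertex

variable {V : Set S2} {A : S2} {B : Fin 3 → S2} {n : Fin 3 → E3} {c : Fin 3 → ℝ}

theorem exists_rotate (h : RegularVertex V A B n c) (i j : Fin 3) :
    ∃ g ∈ rotationGroup V, g A = A ∧ ∀ k, g (B (k + i)) = B (k + j) := by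
  obtain ⟨r, hr, hA, hB⟩ := h.cyclic
  have hpow : ∀ m : ℕ, ∃ g ∈ rotationGroup V, g A = A ∧ ∀ k, g (B k) = B (k + m • (1 : Fin 3)) := by
    intro m
    induction m with
    | zero => exact ⟨1, one_mem _, rfl, by simp⟩
    | succ m ih =>
      obtain ⟨g, hg, h1, h2⟩ := ih
      refine ⟨r * g, mul_mem hr hg, ?_, fun k => ?_⟩
      · rw [Equiv.Perm.mul_apply, h1, hA]
      · rw [Equiv.Perm.mul_apply, h2, hB, succ_nsmul, add_assoc]
  obtain ⟨g, hg, h1, h2⟩ := hpow (j - i).val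
  refine ⟨g, hg, h1, fun k => ?_⟩
  have h3 : ∀ d : Fin 3, d.val • (1 : Fin 3) = d := by decide
  rw [h2, h3]
  congr 1
  abel

/-- After X is moved to A, the image of Y is a neighbour of A, and the cyclic rotation brings it to
the prescribed one. -/
theorem edge_transport (h : RegularVertex V A B n c) {X Y : S2} (hXY : IsEdge V X Y) (i : Fin 3) :
    ∃ g ∈ rotationGroup V, g X = A ∧ g Y = B i := by
  obtain ⟨g, hg, hX⟩ := h.transitive X hXY.mem_left
  have h1 := isEdge_image hg hXY
  rw [hX] at h1
  obtain ⟨m, hm⟩ := h.edge_at h1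
  obtain ⟨r, hr, hA, hB⟩ := h.exists_rotate m i
  have h2 := hB 0
  rw [zero_add, zero_add] at h2
  exact ⟨r * g, mul_mem hr hg, by rw [Equiv.Perm.mul_apply, hX, hA],
    by rw [Equiv.Perm.mul_apply, hm, h2]⟩

/-- A face at A is identified by the neighbour that it misses, so a rotation about A that takes B i
to B j takes face i to face j. -/
theorem rotate_face (h : RegularVertex V A B n c) (i j : Fin 3) :
    ∃ g ∈ rotationGroup V, g '' {v ∈ V | inner ℝ (n i) (v : E3) = c i}
      = {v ∈ V | inner ℝ (n j) (v : E3) = c j} := by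
  obtain ⟨r, hr, hA, hB⟩ := h.exists_rotate i j
  refine ⟨r, hr, ?_⟩
  have h1 := isFace_image hr (h.isFace i)
  obtain ⟨k, hk⟩ := h.face_at h1 ⟨A, ⟨h.mem_A, h.eq_A i⟩, hA⟩
  have h2 : j = k := by
    by_contra hne
    have h3 : B j ∈ r '' {v ∈ V | inner ℝ (n i) (v : E3) = c i} := by
      rw [hk]; exact ⟨h.mem_B j, h.eq_B k j hne⟩
    obtain ⟨w, hw, hwB⟩ := h3
    have h4 := hB 0
    rw [zero_add, zero_add, ← hwB] at h4
    rw [← r.injective h4] at hw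
    exact (h.lt_B i).ne hw.2
  rw [hk, h2]

theorem face_transport (h : RegularVertex V A B n c) {F : Set S2} (hF : IsFace V F) :
    ∃ g ∈ rotationGroup V, g '' F = {v ∈ V | inner ℝ (n 0) (v : E3) = c 0} := by
  obtain ⟨X, hX⟩ : F.Nonempty := by
    rw [Set.nonempty_iff_ne_empty]
    rintro rfl
    have := hF.2
    simp at this
  have hXV : X ∈ V := by
    obtain ⟨⟨m, d, -, -, rfl⟩, -⟩ := hF
    exact hX.1
  obtain ⟨g, hg, hgX⟩ := h.transitive X hXV
  obtain ⟨k, hk⟩ := h.face_at (isFace_image hg hF) ⟨X, hX, hgX⟩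
  obtain ⟨r, hr, h1⟩ := h.rotate_face k 0
  refine ⟨r * g, mul_mem hr hg, ?_⟩
  rw [Equiv.Perm.coe_mul, Set.image_comp, hk, h1]

theorem eq_rotOrbit (h : RegularVertex V A B n c) {X : S2} (hX : X ∈ V) : V = rotOrbit V X := by
  ext Y
  rw [mem_rotOrbit]
  constructor
  · intro hY
    obtain ⟨f, hf, hfX⟩ := h.transitive X hX
    obtain ⟨g, hg, hgY⟩ := h.transitive Y hY
    refine ⟨g⁻¹ * f, mul_mem (inv_mem hg) hf, ?_⟩
    rw [Equiv.Perm.mul_apply, hfX, ← hgY]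
    exact g.symm_apply_apply Y
  · rintro ⟨g, hg, rfl⟩
    exact mem_of_mem_rotationGroup hg hX

theorem edgeMidpoints_eq_rotOrbit (h : RegularVertex V A B n c) {X : S2}
    (hX : X ∈ edgeMidpoints V) : edgeMidpoints V = rotOrbit V X := by
  obtain ⟨P, Q, hPQ, hP⟩ := hX
  ext Y
  rw [mem_rotOrbit]
  constructor
  · rintro ⟨P', Q', hPQ', hP'⟩
    obtain ⟨f, hf, hf1, hf2⟩ := h.edge_transport hPQ 0
    obtain ⟨g, hg, hg1, hg2⟩ := h.edge_transport hPQ' 0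
    refine ⟨g⁻¹ * f, mul_mem (inv_mem hg) hf, ?_⟩
    have h1 : (g⁻¹ * f) P = P' := by
      rw [Equiv.Perm.mul_apply, hf1, ← hg1]; exact g.symm_apply_apply P'
    have h2 : (g⁻¹ * f) Q = Q' := by
      rw [Equiv.Perm.mul_apply, hf2, ← hg2]; exact g.symm_apply_apply Q'
    obtain ⟨R, -, hR⟩ := (mul_mem (inv_mem hg) hf : g⁻¹ * f ∈ rotationGroup V).1
    refine (isRadialProj_image hR hP).unique ?_
    rw [← midpoint_image hR, h1, h2]
    exact hP'
  · rintro ⟨g, hg, rfl⟩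
    obtain ⟨R, -, hR⟩ := hg.1
    exact ⟨g P, g Q, isEdge_image hg hPQ, by
      rw [midpoint_image hR]; exact isRadialProj_image hR hP⟩

theorem faceCentres_eq_rotOrbit (h : RegularVertex V A B n c) {X : S2}
    (hX : X ∈ faceCentres V) : faceCentres V = rotOrbit V X := by
  have hfin : ∀ F, IsFace V F → F.Finite := by
    rintro F ⟨⟨m, d, -, -, rfl⟩, -⟩
    exact h.finite.subset (Set.sep_subset _ _)
  obtain ⟨F, hF, hP⟩ := hX
  ext Y
  rw [mem_rotOrbit]
  constructor
  · rintro ⟨F', hF', hP'⟩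
    obtain ⟨f, hf, hf1⟩ := h.face_transport hF
    obtain ⟨g, hg, hg1⟩ := h.face_transport hF'
    refine ⟨g⁻¹ * f, mul_mem (inv_mem hg) hf, ?_⟩
    have h1 : (g⁻¹ * f : Equiv.Perm S2) '' F = F' := by
      rw [Equiv.Perm.coe_mul, Set.image_comp, hf1, ← hg1, ← Set.image_comp, ← Equiv.Perm.coe_mul]
      simp
    obtain ⟨R, -, hR⟩ := (mul_mem (inv_mem hg) hf : g⁻¹ * f ∈ rotationGroup V).1
    refine (isRadialProj_image hR hP).unique ?_
    rw [← faceCentre_image (hfin F hF) hR, h1]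
    exact hP'
  · rintro ⟨g, hg, rfl⟩
    obtain ⟨R, -, hR⟩ := hg.1
    exact ⟨g '' F, isFace_image hg hF, by
      rw [faceCentre_image (hfin F hF) hR]; exact isRadialProj_image hR hP⟩

/-- The unions of elements of the orbit family are the invariant sets. -/
theorem isUnionOfElements_iff (h : RegularVertex V A B n c) (α : Set S2) :
    IsUnionOfElements (orbitFamily V) α ↔ ∀ g ∈ rotationGroup V, ∀ x ∈ α, g x ∈ α := by
  -- All members of the family are orbits. Conversely every point lies in some member, so the
  -- members inside an invariant set cover it.
  have horb : ∀ {S : Set S2}, S ∈ orbitFamily V → ∀ x ∈ S, S = rotOrbit V x := by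
    rintro S ((rfl | rfl | rfl) | ⟨X, -, rfl⟩) x hx
    · exact h.eq_rotOrbit hx
    · exact h.faceCentres_eq_rotOrbit hx
    · exact h.edgeMidpoints_eq_rotOrbit hx
    · exact (rotOrbit_eq_of_mem hx).symm
  constructor
  · rintro ⟨𝓢, h𝓢, rfl⟩ g hg x ⟨S, hS, hx⟩
    refine ⟨S, hS, ?_⟩
    rw [horb (h𝓢 hS) x hx, mem_rotOrbit]
    exact ⟨g, hg, rfl⟩
  · intro hα
    refine ⟨{S ∈ orbitFamily V | S ⊆ α}, Set.sep_subset _ _, ?_⟩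
    apply Set.Subset.antisymm
    · intro x hx
      obtain ⟨S, hS, hxS⟩ : ∃ S ∈ orbitFamily V, x ∈ S := by
        by_cases hs : x ∈ specialPoints V
        · rcases hs with (hs | hs) | hs
          · exact ⟨V, Or.inl (by simp), hs⟩
          · exact ⟨_, Or.inl (by simp), hs⟩
          · exact ⟨_, Or.inl (by simp), hs⟩
        · exact ⟨_, Or.inr ⟨x, hs, rfl⟩, mem_rotOrbit_self V x⟩
      refine ⟨S, ⟨hS, ?_⟩, hxS⟩
      rw [horb hS x hxS]
      intro y hy
      obtain ⟨g, hg, rfl⟩ := mem_rotOrbit.1 hy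
      exact hα g hg x hx
    · rintro x ⟨S, ⟨-, hS⟩, hx⟩
      exact hS hx

end RegularVertex

/-! ### Bounds for the order of the rotation group -/

namespace SimpleVertex

variable {V : Set S2} {A : S2} {B : Fin 3 → S2} {n : Fin 3 → E3} {c : Fin 3 → ℝ}

/-- A rotation that fixes A is determined by the neighbour to which it sends B 0, because A and B 0
are not antipodal. -/
theorem card_stabilizer (h : SimpleVertex V A B n c) :
    Finite (MulAction.stabilizer (rotationGroup V) A) ∧
      Nat.card (MulAction.stabilizer (rotationGroup V) A) ≤ 3 := by
  have hmap : ∀ g : MulAction.stabilizer (rotationGroup V) A,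
      ∃ m, (g.1.1 : Equiv.Perm S2) (B 0) = B m := fun g => by
    have h1 := isEdge_image g.1.2 (h.isEdge 0)
    rw [show (g.1.1 : Equiv.Perm S2) A = A from g.2] at h1
    exact h.edge_at h1
  choose m hm using hmap
  have hinj : Function.Injective m := by
    intro f g hfg
    have h1 : (g.1.1⁻¹ * f.1.1 : Equiv.Perm S2) = 1 := by
      refine rotation_eq_one (mul_mem (inv_mem g.1.2.1) f.1.2.1) (x := B 0) (y := A) ?_ ?_
        (h.B_ne_A 0) (h.ne_neg 0)
      · rw [Equiv.Perm.mul_apply, hm f, hfg, ← hm g]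
        exact (g.1.1 : Equiv.Perm S2).symm_apply_apply _
      · rw [Equiv.Perm.mul_apply, show (f.1.1 : Equiv.Perm S2) A = A from f.2]
        exact (g.1.1 : Equiv.Perm S2).symm_apply_eq.2
          (show (g.1.1 : Equiv.Perm S2) A = A from g.2).symm
    exact Subtype.ext (Subtype.ext (inv_mul_eq_one.1 h1).symm)
  exact ⟨Finite.of_injective m hinj, by simpa using Nat.card_le_card_of_injective m hinj⟩

theorem orbit_subset (h : SimpleVertex V A B n c) : rotOrbit V A ⊆ V := by
  intro x hx
  obtain ⟨g, hg, rfl⟩ := mem_rotOrbit.1 hx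
  exact mem_of_mem_rotationGroup hg h.mem_A

theorem card_eq (V : Set S2) (A : S2) : (rotOrbit V A).ncard *
    Nat.card (MulAction.stabilizer (rotationGroup V) A) = Nat.card (rotationGroup V) := by
  rw [← (MulAction.stabilizer (rotationGroup V) A).index_mul_card, MulAction.index_stabilizer]
  rfl

theorem finite_rotationGroup (h : SimpleVertex V A B n c) : Finite (rotationGroup V) := by
  have := h.card_stabilizer.1
  apply Nat.finite_of_card_ne_zero
  rw [← card_eq V A]
  refine mul_ne_zero ?_ Nat.card_pos.ne'
  have h1 : 0 < (rotOrbit V A).ncard :=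
    (Set.ncard_pos (h.finite.subset h.orbit_subset)).2 ⟨A, mem_rotOrbit_self V A⟩
  exact h1.ne'

theorem card_le (h : SimpleVertex V A B n c) : Nat.card (rotationGroup V) ≤ V.ncard * 3 := by
  rw [← card_eq V A]
  exact Nat.mul_le_mul (Set.ncard_le_ncard h.orbit_subset h.finite) h.card_stabilizer.2

/-- Stabilizers have at most three elements, so a group of order at least 3 |V| can only have the
orbit V. Transitivity thus comes from counting and needs no list of rotations. -/
theorem transitive_of_card (h : SimpleVertex V A B n c)
    (hc : V.ncard * 3 ≤ Nat.card (rotationGroup V)) :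
    ∀ v ∈ V, ∃ g ∈ rotationGroup V, g v = A := by
  rw [← card_eq V A] at hc
  have h1 := Nat.mul_le_mul_left (rotOrbit V A).ncard h.card_stabilizer.2
  have h2 := Set.eq_of_subset_of_ncard_le h.orbit_subset (by omega) h.finite
  intro v hv
  rw [← h2, mem_rotOrbit] at hv
  obtain ⟨g, hg, rfl⟩ := hv
  exact ⟨g⁻¹, inv_mem hg, g.symm_apply_apply A⟩

end SimpleVertex

end

section

open scoped Quaternion

/-! ### The tetrahedron, the cube and the dodecahedron in coordinates -/

/-- The point with the given coordinates, normalized by `√3`. -/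
noncomputable def vertexPt (b : OrthonormalBasis (Fin 3) ℝ E3) (u v w : ℝ)
    (h : u ^ 2 + v ^ 2 + w ^ 2 = 3) : S2 :=
  (exists_pt b (u := u / √3) (v := v / √3) (w := w / √3) (by
    rw [div_pow, div_pow, div_pow, Real.sq_sqrt (by norm_num)]
    linear_combination h / 3)).choose

/-- The tetrahedron with vertices `(1, 1, 1)`, `(1, -1, -1)`, `(-1, 1, -1)`, `(-1, -1, 1)`,
divided by `√3`. -/
def tetra (b : OrthonormalBasis (Fin 3) ℝ E3) : Set S2 :=
  {x | (∀ i, |b.repr x i| = 1 / √3) ∧ 0 < b.repr x 0 * b.repr x 1 * b.repr x 2}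

/-- The cube with vertices `(±1, ±1, ±1) / √3`. -/
def cube (b : OrthonormalBasis (Fin 3) ℝ E3) : Set S2 := {x | ∀ i, |b.repr x i| = 1 / √3}

/-- The dodecahedron that extends the cube `cube b`. -/
def dodec (b : OrthonormalBasis (Fin 3) ℝ E3) : Set S2 :=
  {x | (∀ i, |b.repr x i| = 1 / √3) ∨
    ∃ i : Fin 3, b.repr x i = 0 ∧ |b.repr x (i + 1)| = Real.goldenRatio⁻¹ / √3 ∧
      |b.repr x (i + 2)| = Real.goldenRatio / √3}

theorem inv_sqrt_three_pos : 0 < 1 / √3 := by positivity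

theorem inv_sqrt_three_sq : (1 / √3) ^ 2 = 1 / 3 := by
  rw [div_pow, Real.sq_sqrt (by norm_num)]; norm_num

theorem golden_sq : φ ^ 2 = φ + 1 := Real.goldenRatio_sq

theorem golden_inv : φ⁻¹ = φ - 1 := by
  apply inv_eq_of_mul_eq_one_right
  linear_combination golden_sq

theorem golden_gt : 1.6 < φ := by
  have := golden_sq
  have := Real.goldenRatio_pos
  nlinarith

theorem golden_lt : φ < 1.7 := by
  have := golden_sq
  have := Real.goldenRatio_pos
  nlinarith

/-- `b.repr x` is `s` times `(u, v, w)`. -/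
def HasCoords (b : OrthonormalBasis (Fin 3) ℝ E3) (x : S2) (u v w : ℝ) : Prop :=
  b.repr x 0 = u * (1 / √3) ∧ b.repr x 1 = v * (1 / √3) ∧ b.repr x 2 = w * (1 / √3)

variable {b : OrthonormalBasis (Fin 3) ℝ E3}

theorem vertexPt_coords (u v w : ℝ) (h : u ^ 2 + v ^ 2 + w ^ 2 = 3) :
    HasCoords b (vertexPt b u v w h) u v w := by
  obtain ⟨h0, h1, h2⟩ := (exists_pt b (u := u / √3) (v := v / √3) (w := w / √3) (by
    rw [div_pow, div_pow, div_pow, Real.sq_sqrt (by norm_num)]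
    linear_combination h / 3)).choose_spec
  exact ⟨h0.trans (div_eq_mul_one_div _ _), h1.trans (div_eq_mul_one_div _ _),
    h2.trans (div_eq_mul_one_div _ _)⟩

theorem HasCoords.ext {x y : S2} {u v w u' v' w' : ℝ} (hx : HasCoords b x u v w)
    (hy : HasCoords b y u' v' w') (h0 : u = u') (h1 : v = v') (h2 : w = w') : x = y := by
  subst h0 h1 h2
  exact pt_ext b (hx.1.trans hy.1.symm) (hx.2.1.trans hy.2.1.symm) (hx.2.2.trans hy.2.2.symm)

theorem HasCoords.inj {x : S2} {u v w u' v' w' : ℝ} (hx : HasCoords b x u v w)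
    (hy : HasCoords b x u' v' w') : u = u' ∧ v = v' ∧ w = w' := by
  have h := inv_sqrt_three_pos.ne'
  exact ⟨mul_right_cancel₀ h (hx.1.symm.trans hy.1),
    mul_right_cancel₀ h (hx.2.1.symm.trans hy.2.1), mul_right_cancel₀ h (hx.2.2.symm.trans hy.2.2)⟩

theorem exists_hasCoords (x : S2) : ∃ u v w, HasCoords b x u v w := by
  have h := inv_sqrt_three_pos.ne'
  exact ⟨b.repr x 0 / (1 / √3), b.repr x 1 / (1 / √3), b.repr x 2 / (1 / √3),
    by rw [div_mul_cancel₀ _ h], by rw [div_mul_cancel₀ _ h], by rw [div_mul_cancel₀ _ h]⟩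

theorem HasCoords.sq_sum {x : S2} {u v w : ℝ} (hx : HasCoords b x u v w) :
    u ^ 2 + v ^ 2 + w ^ 2 = 3 := by
  have h := coord_sq_sum b x
  rw [hx.1, hx.2.1, hx.2.2] at h
  have := inv_sqrt_three_sq
  nlinarith

theorem HasCoords.inner {x y : S2} {u v w u' v' w' : ℝ} (hx : HasCoords b x u v w)
    (hy : HasCoords b y u' v' w') :
    inner ℝ (x : E3) (y : E3) = (u * u' + v * v' + w * w') / 3 := by
  rw [coord_inner b, hx.1, hx.2.1, hx.2.2, hy.1, hy.2.1, hy.2.2]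
  linear_combination (u * u' + v * v' + w * w') * inv_sqrt_three_sq

theorem HasCoords.neg {x : S2} {u v w : ℝ} (hx : HasCoords b x u v w) :
    HasCoords b (-x) (-u) (-v) (-w) := by
  obtain ⟨h0, h1, h2⟩ := hx
  refine ⟨?_, ?_, ?_⟩ <;> simp [h0, h1, h2]

theorem abs_mul_inv_sqrt_three {u t : ℝ} (ht : 0 ≤ t) :
    |u * (1 / √3)| = t * (1 / √3) ↔ u = t ∨ u = -t := by
  rw [abs_mul, abs_of_pos inv_sqrt_three_pos, mul_left_inj' inv_sqrt_three_pos.ne', abs_eq ht]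

theorem HasCoords.mem_cube {x : S2} {u v w : ℝ} (hx : HasCoords b x u v w) :
    x ∈ cube b ↔ (u = 1 ∨ u = -1) ∧ (v = 1 ∨ v = -1) ∧ (w = 1 ∨ w = -1) := by
  have h1 := fun u : ℝ => abs_mul_inv_sqrt_three (u := u) zero_le_one
  simp only [one_mul] at h1
  simp only [cube, Set.mem_ofPred_eq, Fin.forall_fin_succ, Fin.succ_zero_eq_one, hx.1, hx.2.1,
    Fin.succ_one_eq_two, hx.2.2, h1, IsEmpty.forall_iff, and_true]

theorem HasCoords.mem_tetra {x : S2} {u v w : ℝ} (hx : HasCoords b x u v w) :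
    x ∈ tetra b ↔ (u = 1 ∧ v = 1 ∧ w = 1) ∨ (u = 1 ∧ v = -1 ∧ w = -1) ∨
      (u = -1 ∧ v = 1 ∧ w = -1) ∨ (u = -1 ∧ v = -1 ∧ w = 1) := by
  have h1 : x ∈ tetra b ↔ x ∈ cube b ∧ 0 < u * v * w := by
    refine and_congr_right fun _ => ?_
    rw [hx.1, hx.2.1, hx.2.2]
    have h3 : u * (1 / √3) * (v * (1 / √3)) * (w * (1 / √3)) = u * v * w * (1 / √3) ^ 3 := by ring
    rw [h3, mul_pos_iff_of_pos_right (pow_pos inv_sqrt_three_pos 3)]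
  rw [h1, hx.mem_cube]
  constructor
  · rintro ⟨⟨rfl | rfl, rfl | rfl, rfl | rfl⟩, h⟩ <;>
      first | (exfalso; norm_num at h; done) | norm_num
  · rintro (⟨rfl, rfl, rfl⟩ | ⟨rfl, rfl, rfl⟩ | ⟨rfl, rfl, rfl⟩ | ⟨rfl, rfl, rfl⟩) <;> norm_num

theorem HasCoords.mem_dodec {x : S2} {u v w : ℝ} (hx : HasCoords b x u v w) :
    x ∈ dodec b ↔ ((u = 1 ∨ u = -1) ∧ (v = 1 ∨ v = -1) ∧ (w = 1 ∨ w = -1)) ∨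
      (u = 0 ∧ (v = φ - 1 ∨ v = -(φ - 1)) ∧ (w = φ ∨ w = -φ)) ∨
      (v = 0 ∧ (w = φ - 1 ∨ w = -(φ - 1)) ∧ (u = φ ∨ u = -φ)) ∨
      (w = 0 ∧ (u = φ - 1 ∨ u = -(φ - 1)) ∧ (v = φ ∨ v = -φ)) := by
  have h1 := fun u : ℝ => abs_mul_inv_sqrt_three (u := u) (t := φ - 1) (by linarith [golden_gt])
  have h2 := fun u : ℝ => abs_mul_inv_sqrt_three (u := u) (t := φ) (by linarith [golden_gt])
  have h3 : ∀ u : ℝ, u * (1 / √3) = 0 ↔ u = 0 := fun u => by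
    rw [mul_eq_zero, or_iff_left inv_sqrt_three_pos.ne']
  have h5 : φ⁻¹ / √3 = (φ - 1) * (1 / √3) := by rw [golden_inv, ← div_eq_mul_one_div]
  have h6 : φ / √3 = φ * (1 / √3) := div_eq_mul_one_div _ _
  have h4 : x ∈ dodec b ↔ x ∈ cube b ∨
      (b.repr x 0 = 0 ∧ |b.repr x 1| = φ⁻¹ / √3 ∧ |b.repr x 2| = φ / √3) ∨
      (b.repr x 1 = 0 ∧ |b.repr x 2| = φ⁻¹ / √3 ∧ |b.repr x 0| = φ / √3) ∨
      (b.repr x 2 = 0 ∧ |b.repr x 0| = φ⁻¹ / √3 ∧ |b.repr x 1| = φ / √3) := by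
    refine or_congr_right ⟨?_, ?_⟩
    · rintro ⟨i, h⟩
      fin_cases i
      · exact Or.inl h
      · exact Or.inr (Or.inl h)
      · exact Or.inr (Or.inr h)
    · rintro (h | h | h)
      exacts [⟨0, h⟩, ⟨1, h⟩, ⟨2, h⟩]
  rw [h4, hx.mem_cube, hx.1, hx.2.1, hx.2.2, h5, h6, h1, h1, h1, h2, h2, h2, h3, h3, h3]

theorem cube_neg {x : S2} (hx : x ∈ cube b) : -x ∈ cube b := by
  intro i
  simpa using hx i

theorem dodec_neg {x : S2} (hx : x ∈ dodec b) : -x ∈ dodec b := by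
  rcases hx with hx | ⟨i, h0, h1, h2⟩
  · exact Or.inl (cube_neg hx)
  · exact Or.inr ⟨i, by simpa using h0, by simpa using h1, by simpa using h2⟩

/-- The coordinate condition in `IsCube` describes a set of vectors of `E3`, compared with the image
of V; all these vectors have norm 1, so nothing is lost on the sphere. -/
theorem isCube_iff {V : Set S2} : IsCube V ↔ ∃ b, V = cube b := by
  have key : ∀ b : OrthonormalBasis (Fin 3) ℝ E3,
      Subtype.val '' cube b = {x : E3 | ∀ i, |b.repr x i| = 1 / √3} := by
    intro b
    ext x
    constructor
    · rintro ⟨y, hy, rfl⟩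
      exact hy
    · intro hx
      have h : ∀ i, b.repr x i ^ 2 = 1 / 3 := fun i => by
        rw [← sq_abs, show |b.repr x i| = 1 / √3 from hx i, inv_sqrt_three_sq]
      refine ⟨⟨x, ?_⟩, hx, rfl⟩
      have h1 := coord_norm_sq b x
      rw [h, h, h] at h1
      rw [mem_sphere_zero_iff_norm]
      nlinarith [norm_nonneg x]
  constructor
  · rintro ⟨b, hb⟩
    rw [← key] at hb
    exact ⟨b, Subtype.val_injective.image_injective hb⟩
  · rintro ⟨b, rfl⟩
    exact ⟨b, key b⟩

theorem isRegularDodecahedron_iff {V : Set S2} : IsRegularDodecahedron V ↔ ∃ b, V = dodec b := by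
  have key : ∀ b : OrthonormalBasis (Fin 3) ℝ E3,
      Subtype.val '' dodec b = {x : E3 | (∀ i, |b.repr x i| = 1 / √3) ∨
        ∃ i : Fin 3, b.repr x i = 0 ∧ |b.repr x (i + 1)| = Real.goldenRatio⁻¹ / √3 ∧
        |b.repr x (i + 2)| = Real.goldenRatio / √3} := by
    intro b
    ext x
    constructor
    · rintro ⟨y, hy, rfl⟩
      exact hy
    · intro hx
      refine ⟨⟨x, ?_⟩, hx, rfl⟩
      have h1 := coord_norm_sq b x
      have h2 : b.repr x 0 ^ 2 + b.repr x 1 ^ 2 + b.repr x 2 ^ 2 = 1 := by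
        rcases hx with hx | ⟨i, h0, h1, h2⟩
        · have h : ∀ i, b.repr x i ^ 2 = 1 / 3 := fun i => by
            rw [← sq_abs, hx i, inv_sqrt_three_sq]
          rw [h, h, h]; norm_num
        · have e0 : b.repr x i ^ 2 = 0 := by rw [h0]; norm_num
          have e1 : b.repr x (i + 1) ^ 2 = (2 - φ) / 3 := by
            rw [← sq_abs, h1, div_pow, Real.sq_sqrt (by norm_num), golden_inv]
            linear_combination golden_sq / 3
          have e2 : b.repr x (i + 2) ^ 2 = (φ + 1) / 3 := by
            rw [← sq_abs, h2, div_pow, Real.sq_sqrt (by norm_num), golden_sq]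
          have a1 : ((1 : Fin 3) + 1) = 2 := rfl
          have a2 : ((1 : Fin 3) + 2) = 0 := rfl
          have a3 : ((2 : Fin 3) + 1) = 0 := rfl
          have a4 : ((2 : Fin 3) + 2) = 1 := rfl
          fin_cases i <;> simp only [Fin.zero_eta, Fin.mk_one, Fin.reduceFinMk, zero_add, a1, a2,
            a3, a4] at e0 e1 e2 <;> linarith
      rw [mem_sphere_zero_iff_norm]
      nlinarith [norm_nonneg x]
  constructor
  · rintro ⟨b, hb⟩
    rw [← key] at hb
    exact ⟨b, Subtype.val_injective.image_injective hb⟩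
  · rintro ⟨b, rfl⟩
    exact ⟨b, key b⟩

theorem finite_of_coords {V : Set S2} (T : Finset (ℝ × ℝ × ℝ))
    (h : ∀ x u v w, x ∈ V → HasCoords b x u v w → (u, v, w) ∈ T) :
    V.Finite ∧ V.ncard ≤ T.card := by
  choose u v w hc using fun x : S2 => exists_hasCoords (b := b) x
  have hinj : Set.InjOn (fun x => (u x, v x, w x)) V := fun x _ y _ hxy => by
    simp only [Prod.mk.injEq] at hxy
    exact (hc x).ext (hc y) hxy.1 hxy.2.1 hxy.2.2
  have hmaps : Set.MapsTo (fun x => (u x, v x, w x)) V (T : Set (ℝ × ℝ × ℝ)) := fun x hx =>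
    h x _ _ _ hx (hc x)
  refine ⟨Set.Finite.of_injOn hmaps hinj T.finite_toSet, ?_⟩
  rw [← Set.ncard_coe_finset]
  exact Set.ncard_le_ncard_of_injOn _ hmaps hinj T.finite_toSet

theorem tetra_finite : (tetra b).Finite ∧ (tetra b).ncard ≤ 4 := by
  classical
  have h := finite_of_coords (b := b) (V := tetra b)
    (T := {(1, 1, 1), (1, -1, -1), (-1, 1, -1), (-1, -1, 1)}) (fun x u v w hx hc => by
      rw [hc.mem_tetra] at hx
      simpa [Prod.ext_iff] using hx)
  exact ⟨h.1, h.2.trans Finset.card_le_four⟩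

theorem card_pair_le {p q : ℝ} : ({p, q} : Finset ℝ).card ≤ 2 := Finset.card_le_two

theorem card_pair_product {p q r s : ℝ} : (({p, q} : Finset ℝ) ×ˢ ({r, s} : Finset ℝ)).card ≤ 4 := by
  rw [Finset.card_product]
  exact (Nat.mul_le_mul card_pair_le card_pair_le : _ ≤ 2 * 2)

/-- Only the upper bound is counted here; equality follows later from the order of the group, and
likewise for the dodecahedron. -/
theorem cube_finite : (cube b).Finite ∧ (cube b).ncard ≤ 8 := by
  classical
  have h := finite_of_coords (b := b) (V := cube b)
    (({1, -1} : Finset ℝ) ×ˢ ({1, -1} : Finset ℝ) ×ˢ ({1, -1} : Finset ℝ)) (fun x u v w hx hc => by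
      rw [hc.mem_cube] at hx
      simpa using hx)
  refine ⟨h.1, h.2.trans ?_⟩
  rw [Finset.card_product]
  exact (Nat.mul_le_mul card_pair_le card_pair_product : _ ≤ 2 * 4)

theorem dodec_finite : (dodec b).Finite ∧ (dodec b).ncard ≤ 20 := by
  classical
  obtain ⟨T₀, hT₀⟩ : ∃ T : Finset (ℝ × ℝ × ℝ), T
    = ({1, -1} : Finset ℝ) ×ˢ ({1, -1} : Finset ℝ) ×ˢ ({1, -1} : Finset ℝ) := ⟨_, rfl⟩
  obtain ⟨T₁, hT₁⟩ : ∃ T : Finset (ℝ × ℝ × ℝ), T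
    = ({0} : Finset ℝ) ×ˢ ({φ - 1, -(φ - 1)} : Finset ℝ) ×ˢ ({φ, -φ} : Finset ℝ) := ⟨_, rfl⟩
  obtain ⟨T₂, hT₂⟩ : ∃ T : Finset (ℝ × ℝ × ℝ), T
    = ({φ, -φ} : Finset ℝ) ×ˢ ({0} : Finset ℝ) ×ˢ ({φ - 1, -(φ - 1)} : Finset ℝ) := ⟨_, rfl⟩
  obtain ⟨T₃, hT₃⟩ : ∃ T : Finset (ℝ × ℝ × ℝ), T
    = ({φ - 1, -(φ - 1)} : Finset ℝ) ×ˢ ({φ, -φ} : Finset ℝ) ×ˢ ({0} : Finset ℝ) := ⟨_, rfl⟩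
  have h := finite_of_coords (b := b) (V := dodec b) (T₀ ∪ T₁ ∪ T₂ ∪ T₃)
    (fun x u v w hx hc => by
      rw [hc.mem_dodec] at hx
      simp only [Finset.mem_union, hT₀, hT₁, hT₂, hT₃, Finset.mem_product, Finset.mem_insert,
        Finset.mem_singleton]
      rcases hx with h | ⟨h0, h1, h2⟩ | ⟨h0, h1, h2⟩ | ⟨h0, h1, h2⟩
      · exact Or.inl (Or.inl (Or.inl h))
      · exact Or.inl (Or.inl (Or.inr ⟨h0, h1, h2⟩))
      · exact Or.inl (Or.inr ⟨h2, h0, h1⟩)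
      · exact Or.inr ⟨h1, h2, h0⟩)
  have c₀ : T₀.card ≤ 2 * 4 := by
    rw [hT₀, Finset.card_product]
    exact Nat.mul_le_mul card_pair_le card_pair_product
  have c₁ : T₁.card ≤ 1 * 4 := by
    rw [hT₁, Finset.card_product]
    exact Nat.mul_le_mul (by simp) card_pair_product
  have c₂ : T₂.card ≤ 2 * (1 * 2) := by
    rw [hT₂, Finset.card_product, Finset.card_product]
    exact Nat.mul_le_mul card_pair_le (Nat.mul_le_mul (by simp) card_pair_le)
  have c₃ : T₃.card ≤ 2 * (2 * 1) := by
    rw [hT₃, Finset.card_product, Finset.card_product]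
    exact Nat.mul_le_mul card_pair_le (Nat.mul_le_mul card_pair_le (by simp))
  have e₁ := Finset.card_union_le (T₀ ∪ T₁ ∪ T₂) T₃
  have e₂ := Finset.card_union_le (T₀ ∪ T₁) T₂
  have e₃ := Finset.card_union_le T₀ T₁
  exact ⟨h.1, h.2.trans (by omega)⟩

/-! ### The generating rotations -/

/-- The rotation described by a unit quaternion. -/
noncomputable def quatRot (b : OrthonormalBasis (Fin 3) ℝ E3) (q : ℍ[ℝ]) : Equiv.Perm S2 :=
  open Classical in if h : Quaternion.normSq q = 1 then (exists_rotation b h).choose else 1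

theorem quatRot_rep {q : ℍ[ℝ]} (h : Quaternion.normSq q = 1) : QuatRep b q (quatRot b q) := by
  rw [quatRot, dif_pos h]
  exact (exists_rotation b h).choose_spec.2

/-- The quaternion unit `i`. -/
def quatI : ℍ[ℝ] := ⟨0, 1, 0, 0⟩
/-- The quaternion unit `j`. -/
def quatJ : ℍ[ℝ] := ⟨0, 0, 1, 0⟩
/-- The quaternion `(1 + i + j + k) / 2`. -/
noncomputable def quatW : ℍ[ℝ] := ⟨1 / 2, 1 / 2, 1 / 2, 1 / 2⟩
/-- The quaternion of a quarter turn about the third axis. -/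
noncomputable def quatO : ℍ[ℝ] := ⟨√2 / 2, 0, 0, √2 / 2⟩
/-- The quaternion of a fifth of a turn about the axis `(1, 0, φ)`. -/
noncomputable def quatP : ℍ[ℝ] := ⟨φ / 2, (φ - 1) / 2, 0, 1 / 2⟩

theorem quatI_rep : QuatRep b quatI (quatRot b quatI) :=
  quatRot_rep (by rw [Quaternion.normSq_def']; norm_num [quatI])

theorem quatJ_rep : QuatRep b quatJ (quatRot b quatJ) :=
  quatRot_rep (by rw [Quaternion.normSq_def']; norm_num [quatJ])

theorem quatW_rep : QuatRep b quatW (quatRot b quatW) :=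
  quatRot_rep (by rw [Quaternion.normSq_def']; norm_num [quatW])

theorem quatO_rep : QuatRep b quatO (quatRot b quatO) :=
  quatRot_rep (by
    rw [Quaternion.normSq_def']
    have : √2 ^ 2 = 2 := Real.sq_sqrt (by norm_num)
    simp only [quatO]
    linear_combination this / 2)

theorem quatP_rep : QuatRep b quatP (quatRot b quatP) :=
  quatRot_rep (by
    rw [Quaternion.normSq_def']
    simp only [quatP]
    linear_combination golden_sq / 2)

section
variable {f : Equiv.Perm S2} {x : S2} {u v w : ℝ}

theorem QuatRep.hasCoords {p : ℍ[ℝ]} (hf : QuatRep b p f) (hx : HasCoords b x u v w) :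
    HasCoords b (f x)
      ((p.re ^ 2 + p.imI ^ 2 - p.imJ ^ 2 - p.imK ^ 2) * u
        + 2 * (p.imI * p.imJ - p.re * p.imK) * v + 2 * (p.imI * p.imK + p.re * p.imJ) * w)
      (2 * (p.imI * p.imJ + p.re * p.imK) * u
        + (p.re ^ 2 - p.imI ^ 2 + p.imJ ^ 2 - p.imK ^ 2) * v
        + 2 * (p.imJ * p.imK - p.re * p.imI) * w)
      (2 * (p.imI * p.imK - p.re * p.imJ) * u + 2 * (p.imJ * p.imK + p.re * p.imI) * v
        + (p.re ^ 2 - p.imI ^ 2 - p.imJ ^ 2 + p.imK ^ 2) * w) := by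
  obtain ⟨h0, h1, h2⟩ := hf.coords x
  rw [hx.1, hx.2.1, hx.2.2] at h0 h1 h2
  refine ⟨?_, ?_, ?_⟩
  · rw [h0]; ring
  · rw [h1]; ring
  · rw [h2]; ring

theorem HasCoords.congr {u' v' w' : ℝ} (hx : HasCoords b x u v w) (h0 : u = u') (h1 : v = v')
    (h2 : w = w') : HasCoords b x u' v' w' := by
  subst h0 h1 h2; exact hx

theorem HasCoords.rotI (hx : HasCoords b x u v w) :
    HasCoords b (quatRot b quatI x) u (-v) (-w) :=
  (quatI_rep.hasCoords hx).congr (by simp [quatI]) (by simp [quatI]) (by simp [quatI])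

theorem HasCoords.rotJ (hx : HasCoords b x u v w) :
    HasCoords b (quatRot b quatJ x) (-u) v (-w) :=
  (quatJ_rep.hasCoords hx).congr (by simp [quatJ]) (by simp [quatJ]) (by simp [quatJ])

theorem HasCoords.rotW (hx : HasCoords b x u v w) :
    HasCoords b (quatRot b quatW x) w u v :=
  (quatW_rep.hasCoords hx).congr (by simp only [quatW]; ring) (by simp only [quatW]; ring)
    (by simp only [quatW]; ring)

theorem HasCoords.rotO (hx : HasCoords b x u v w) :
    HasCoords b (quatRot b quatO x) (-v) u w := by
  have h : √2 ^ 2 = 2 := Real.sq_sqrt (by norm_num)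
  refine (quatO_rep.hasCoords hx).congr ?_ ?_ ?_ <;> simp only [quatO]
  · linear_combination -v / 2 * h
  · linear_combination u / 2 * h
  · linear_combination w / 2 * h

theorem HasCoords.rotP (hx : HasCoords b x u v w) :
    HasCoords b (quatRot b quatP x) ((u - φ * v + (φ - 1) * w) / 2)
      ((φ * u + (φ - 1) * v - w) / 2) (((φ - 1) * u + v + φ * w) / 2) := by
  refine (quatP_rep.hasCoords hx).congr ?_ ?_ ?_ <;> simp only [quatP]
  · linear_combination (u / 2) * golden_sq
  · linear_combination (-w / 2) * golden_sq
  · linear_combination (v / 2) * golden_sq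

end

end

section

open scoped Quaternion

variable {b : OrthonormalBasis (Fin 3) ℝ E3}

/-! ### Vertices, neighbours and groups of the three polyhedra -/

/-- The vector with the given coordinates. -/
noncomputable def coordVec (b : OrthonormalBasis (Fin 3) ℝ E3) (m : Fin 3 → ℝ) : E3 :=
  b.repr.symm (WithLp.toLp 2 m)

theorem inner_coordVec {x : S2} {u v w : ℝ} (hx : HasCoords b x u v w) (m : Fin 3 → ℝ) :
    inner ℝ (coordVec b m) (x : E3) = (m 0 * u + m 1 * v + m 2 * w) * (1 / √3) := by
  rw [coord_inner b, hx.1, hx.2.1, hx.2.2]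
  simp only [coordVec, LinearIsometryEquiv.apply_symm_apply]
  ring

/-- All conditions become scalar ones in coordinates scaled by √3. In the last hypothesis, -3 is the
coordinate sum of the antipode of A. -/
theorem simpleVertex_of_coords {V : Set S2} (hV : V.Finite) {A : S2} {B : Fin 3 → S2}
    {a m : Fin 3 → Fin 3 → ℝ} {d : ℝ} (hA : HasCoords b A 1 1 1)
    (hB : ∀ i, HasCoords b (B i) (a i 0) (a i 1) (a i 2)) (memA : A ∈ V) (memB : ∀ i, B i ∈ V)
    (hle : ∀ x u v w, x ∈ V → HasCoords b x u v w → ∀ k, m k 0 * u + m k 1 * v + m k 2 * w ≤ d)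
    (eqA : ∀ k, m k 0 + m k 1 + m k 2 = d)
    (eqB : ∀ k i, i ≠ k → m k 0 * a i 0 + m k 1 * a i 1 + m k 2 * a i 2 = d)
    (ltB : ∀ k, m k 0 * a k 0 + m k 1 * a k 1 + m k 2 * a k 2 < d)
    (hne : ∀ i, a i 0 + a i 1 + a i 2 ≠ -3) :
    SimpleVertex V A B (fun k => coordVec b (m k)) (fun _ => d * (1 / √3)) where
  finite := hV
  mem_A := memA
  mem_B := memB
  le k x hx := by
    obtain ⟨u, v, w, hc⟩ := exists_hasCoords (b := b) x
    rw [inner_coordVec hc]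
    exact mul_le_mul_of_nonneg_right (hle x u v w hx hc k) inv_sqrt_three_pos.le
  eq_A k := by rw [inner_coordVec hA, mul_one, mul_one, mul_one, eqA]
  eq_B k i hik := by rw [inner_coordVec (hB i), eqB k i hik]
  lt_B k := by
    rw [inner_coordVec (hB k)]
    exact mul_lt_mul_of_pos_right (ltB k) inv_sqrt_three_pos
  ne_neg i h := by
    have h1 := hA.neg
    rw [← h] at h1
    obtain ⟨e0, e1, e2⟩ := (hB i).inj h1
    exact hne i (by rw [e0, e1, e2]; norm_num)

/-- The vertex `(1, 1, 1) / √3`. -/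
noncomputable def baseVertex (b : OrthonormalBasis (Fin 3) ℝ E3) : S2 :=
  vertexPt b 1 1 1 (by norm_num)

theorem baseVertex_coords : HasCoords b (baseVertex b) 1 1 1 :=
  vertexPt_coords _ _ _ (by norm_num)

/-- The other vertices of the tetrahedron. -/
noncomputable def tetraNbr (b : OrthonormalBasis (Fin 3) ℝ E3) : Fin 3 → S2 :=
  ![vertexPt b 1 (-1) (-1) (by norm_num), vertexPt b (-1) 1 (-1) (by norm_num),
    vertexPt b (-1) (-1) 1 (by norm_num)]

/-- The neighbours of `baseVertex b` in the cube. -/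
noncomputable def cubeNbr (b : OrthonormalBasis (Fin 3) ℝ E3) : Fin 3 → S2 :=
  ![vertexPt b (-1) 1 1 (by norm_num), vertexPt b 1 (-1) 1 (by norm_num),
    vertexPt b 1 1 (-1) (by norm_num)]

/-- The neighbours of `baseVertex b` in the dodecahedron. -/
noncomputable def dodecNbr (b : OrthonormalBasis (Fin 3) ℝ E3) : Fin 3 → S2 :=
  ![vertexPt b 0 (φ - 1) φ (by linear_combination 2 * golden_sq),
    vertexPt b φ 0 (φ - 1) (by linear_combination 2 * golden_sq),
    vertexPt b (φ - 1) φ 0 (by linear_combination 2 * golden_sq)]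

theorem tetraNbr_coords (i : Fin 3) : HasCoords b (tetraNbr b i)
    ((!![1, -1, -1; -1, 1, -1; -1, -1, 1] : Matrix (Fin 3) (Fin 3) ℝ) i 0)
    ((!![1, -1, -1; -1, 1, -1; -1, -1, 1] : Matrix (Fin 3) (Fin 3) ℝ) i 1)
    ((!![1, -1, -1; -1, 1, -1; -1, -1, 1] : Matrix (Fin 3) (Fin 3) ℝ) i 2) := by
  fin_cases i <;> apply vertexPt_coords <;> norm_num

theorem cubeNbr_coords (i : Fin 3) : HasCoords b (cubeNbr b i)
    ((!![-1, 1, 1; 1, -1, 1; 1, 1, -1] : Matrix (Fin 3) (Fin 3) ℝ) i 0)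
    ((!![-1, 1, 1; 1, -1, 1; 1, 1, -1] : Matrix (Fin 3) (Fin 3) ℝ) i 1)
    ((!![-1, 1, 1; 1, -1, 1; 1, 1, -1] : Matrix (Fin 3) (Fin 3) ℝ) i 2) := by
  fin_cases i <;> apply vertexPt_coords <;> norm_num

theorem dodecNbr_coords (i : Fin 3) : HasCoords b (dodecNbr b i)
    ((!![0, φ - 1, φ; φ, 0, φ - 1; φ - 1, φ, 0] : Matrix (Fin 3) (Fin 3) ℝ) i 0)
    ((!![0, φ - 1, φ; φ, 0, φ - 1; φ - 1, φ, 0] : Matrix (Fin 3) (Fin 3) ℝ) i 1)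
    ((!![0, φ - 1, φ; φ, 0, φ - 1; φ - 1, φ, 0] : Matrix (Fin 3) (Fin 3) ℝ) i 2) := by
  fin_cases i <;> apply vertexPt_coords <;> linear_combination 2 * golden_sq

theorem tetra_simpleVertex : SimpleVertex (tetra b) (baseVertex b) (tetraNbr b)
    (fun k => coordVec b ((!![-1, 1, 1; 1, -1, 1; 1, 1, -1] : Matrix (Fin 3) (Fin 3) ℝ) k))
    (fun _ => 1 * (1 / √3)) := by
  refine simpleVertex_of_coords tetra_finite.1 baseVertex_coords tetraNbr_coords
    (baseVertex_coords.mem_tetra.2 (by simp)) (fun i => (tetraNbr_coords i).mem_tetra.2 ?_)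
    ?_ ?_ ?_ ?_ ?_
  · fin_cases i <;> simp
  · intro x u v w hx hc k
    rw [hc.mem_tetra] at hx
    rcases hx with ⟨rfl, rfl, rfl⟩ | ⟨rfl, rfl, rfl⟩ | ⟨rfl, rfl, rfl⟩ | ⟨rfl, rfl, rfl⟩ <;>
      fin_cases k <;> simp <;> norm_num
  · intro k; fin_cases k <;> simp
  · intro k i hik; fin_cases k <;> fin_cases i <;> simp at hik ⊢
  · intro k; fin_cases k <;> simp <;> norm_num
  · intro k; fin_cases k <;> simp

theorem cube_simpleVertex : SimpleVertex (cube b) (baseVertex b) (cubeNbr b)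
    (fun k => coordVec b ((!![1, 0, 0; 0, 1, 0; 0, 0, 1] : Matrix (Fin 3) (Fin 3) ℝ) k))
    (fun _ => 1 * (1 / √3)) := by
  refine simpleVertex_of_coords cube_finite.1 baseVertex_coords cubeNbr_coords
    (baseVertex_coords.mem_cube.2 (by simp)) (fun i => (cubeNbr_coords i).mem_cube.2 ?_)
    ?_ ?_ ?_ ?_ ?_
  · fin_cases i <;> simp
  · intro x u v w hx hc k
    rw [hc.mem_cube] at hx
    obtain ⟨h0, h1, h2⟩ := hx
    fin_cases k <;> simp
    · rcases h0 with rfl | rfl <;> norm_num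
    · rcases h1 with rfl | rfl <;> norm_num
    · rcases h2 with rfl | rfl <;> norm_num
  · intro k; fin_cases k <;> simp
  · intro k i hik; fin_cases k <;> fin_cases i <;> simp at hik ⊢
  · intro k; fin_cases k <;> simp
  · intro k; fin_cases k <;> simp <;> norm_num

/-- The normals are the directions of the centres of the three pentagons around (1, 1, 1). -/
theorem dodec_simpleVertex : SimpleVertex (dodec b) (baseVertex b) (dodecNbr b)
    (fun k => coordVec b ((!![φ, 1, 0; 0, φ, 1; 1, 0, φ] : Matrix (Fin 3) (Fin 3) ℝ) k))
    (fun _ => (φ + 1) * (1 / √3)) := by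
  have hs := golden_sq
  have hg := golden_gt
  refine simpleVertex_of_coords dodec_finite.1 baseVertex_coords dodecNbr_coords
    (baseVertex_coords.mem_dodec.2 (by simp)) (fun i => (dodecNbr_coords i).mem_dodec.2 ?_)
    ?_ ?_ ?_ ?_ ?_
  · fin_cases i <;> simp
  · intro x u v w hx hc k
    rw [hc.mem_dodec] at hx
    rcases hx with ⟨h0, h1, h2⟩ | ⟨rfl, h1, h2⟩ | ⟨rfl, h1, h2⟩ | ⟨rfl, h1, h2⟩
    · fin_cases k <;> simp <;> rcases h0 with rfl | rfl <;> rcases h1 with rfl | rfl <;>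
        rcases h2 with rfl | rfl <;> linarith
    all_goals fin_cases k <;> simp <;> rcases h1 with rfl | rfl <;> rcases h2 with rfl | rfl <;>
      nlinarith
  · intro k; fin_cases k <;> simp; ring
  · intro k i hik
    fin_cases k <;> fin_cases i <;> simp at hik ⊢ <;> linear_combination hs
  · intro k; fin_cases k <;> simp <;> nlinarith
  · intro k; fin_cases k <;> simp <;> nlinarith

end

section

open scoped Quaternion

variable {b : OrthonormalBasis (Fin 3) ℝ E3}

/-! ### The rotation groups of the three polyhedra -/

theorem rotI_mem_tetra : quatRot b quatI ∈ rotationGroup (tetra b) :=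
  mem_rotationGroup_of_maps tetra_finite.1 quatI_rep.mem_rotations fun x hx => by
    obtain ⟨u, v, w, hc⟩ := exists_hasCoords (b := b) x
    rw [hc.mem_tetra] at hx
    rw [hc.rotI.mem_tetra]
    rcases hx with ⟨rfl, rfl, rfl⟩ | ⟨rfl, rfl, rfl⟩ | ⟨rfl, rfl, rfl⟩ | ⟨rfl, rfl, rfl⟩ <;> simp

theorem rotJ_mem_tetra : quatRot b quatJ ∈ rotationGroup (tetra b) :=
  mem_rotationGroup_of_maps tetra_finite.1 quatJ_rep.mem_rotations fun x hx => by
    obtain ⟨u, v, w, hc⟩ := exists_hasCoords (b := b) x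
    rw [hc.mem_tetra] at hx
    rw [hc.rotJ.mem_tetra]
    rcases hx with ⟨rfl, rfl, rfl⟩ | ⟨rfl, rfl, rfl⟩ | ⟨rfl, rfl, rfl⟩ | ⟨rfl, rfl, rfl⟩ <;> simp

theorem rotW_mem_tetra : quatRot b quatW ∈ rotationGroup (tetra b) :=
  mem_rotationGroup_of_maps tetra_finite.1 quatW_rep.mem_rotations fun x hx => by
    obtain ⟨u, v, w, hc⟩ := exists_hasCoords (b := b) x
    rw [hc.mem_tetra] at hx
    rw [hc.rotW.mem_tetra]
    rcases hx with ⟨rfl, rfl, rfl⟩ | ⟨rfl, rfl, rfl⟩ | ⟨rfl, rfl, rfl⟩ | ⟨rfl, rfl, rfl⟩ <;> simp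

theorem neg_eq_or {u t : ℝ} (h : u = t ∨ u = -t) : -u = t ∨ -u = -t := by
  rcases h with rfl | rfl <;> simp

theorem rotI_mem_cube : quatRot b quatI ∈ rotationGroup (cube b) :=
  mem_rotationGroup_of_maps cube_finite.1 quatI_rep.mem_rotations fun x hx => by
    obtain ⟨u, v, w, hc⟩ := exists_hasCoords (b := b) x
    rw [hc.mem_cube] at hx
    exact hc.rotI.mem_cube.2 ⟨hx.1, neg_eq_or hx.2.1, neg_eq_or hx.2.2⟩

theorem rotJ_mem_cube : quatRot b quatJ ∈ rotationGroup (cube b) :=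
  mem_rotationGroup_of_maps cube_finite.1 quatJ_rep.mem_rotations fun x hx => by
    obtain ⟨u, v, w, hc⟩ := exists_hasCoords (b := b) x
    rw [hc.mem_cube] at hx
    exact hc.rotJ.mem_cube.2 ⟨neg_eq_or hx.1, hx.2.1, neg_eq_or hx.2.2⟩

theorem rotW_mem_cube : quatRot b quatW ∈ rotationGroup (cube b) :=
  mem_rotationGroup_of_maps cube_finite.1 quatW_rep.mem_rotations fun x hx => by
    obtain ⟨u, v, w, hc⟩ := exists_hasCoords (b := b) x
    rw [hc.mem_cube] at hx
    exact hc.rotW.mem_cube.2 ⟨hx.2.2, hx.1, hx.2.1⟩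

theorem rotO_mem_cube : quatRot b quatO ∈ rotationGroup (cube b) :=
  mem_rotationGroup_of_maps cube_finite.1 quatO_rep.mem_rotations fun x hx => by
    obtain ⟨u, v, w, hc⟩ := exists_hasCoords (b := b) x
    rw [hc.mem_cube] at hx
    exact hc.rotO.mem_cube.2 ⟨neg_eq_or hx.2.1, hx.1, hx.2.2⟩

theorem rotI_mem_dodec : quatRot b quatI ∈ rotationGroup (dodec b) :=
  mem_rotationGroup_of_maps dodec_finite.1 quatI_rep.mem_rotations fun x hx => by
    obtain ⟨u, v, w, hc⟩ := exists_hasCoords (b := b) x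
    rw [hc.mem_dodec] at hx
    rw [hc.rotI.mem_dodec]
    simp only [neg_eq_zero]
    exact hx.imp (fun h => ⟨h.1, neg_eq_or h.2.1, neg_eq_or h.2.2⟩)
      (Or.imp (fun h => ⟨h.1, neg_eq_or h.2.1, neg_eq_or h.2.2⟩)
        (Or.imp (fun h => ⟨h.1, neg_eq_or h.2.1, h.2.2⟩) fun h => ⟨h.1, h.2.1, neg_eq_or h.2.2⟩))

theorem rotJ_mem_dodec : quatRot b quatJ ∈ rotationGroup (dodec b) :=
  mem_rotationGroup_of_maps dodec_finite.1 quatJ_rep.mem_rotations fun x hx => by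
    obtain ⟨u, v, w, hc⟩ := exists_hasCoords (b := b) x
    rw [hc.mem_dodec] at hx
    rw [hc.rotJ.mem_dodec]
    simp only [neg_eq_zero]
    exact hx.imp (fun h => ⟨neg_eq_or h.1, h.2.1, neg_eq_or h.2.2⟩)
      (Or.imp (fun h => ⟨h.1, h.2.1, neg_eq_or h.2.2⟩)
        (Or.imp (fun h => ⟨h.1, neg_eq_or h.2.1, neg_eq_or h.2.2⟩)
          fun h => ⟨h.1, neg_eq_or h.2.1, h.2.2⟩))

theorem rotW_mem_dodec : quatRot b quatW ∈ rotationGroup (dodec b) :=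
  mem_rotationGroup_of_maps dodec_finite.1 quatW_rep.mem_rotations fun x hx => by
    obtain ⟨u, v, w, hc⟩ := exists_hasCoords (b := b) x
    rw [hc.mem_dodec] at hx
    rw [hc.rotW.mem_dodec]
    rcases hx with h | h | h | h
    · exact Or.inl ⟨h.2.2, h.1, h.2.1⟩
    · exact Or.inr (Or.inr (Or.inl h))
    · exact Or.inr (Or.inr (Or.inr h))
    · exact Or.inr (Or.inl h)

theorem rotP_mem_dodec : quatRot b quatP ∈ rotationGroup (dodec b) := by
  have hs := golden_sq
  refine mem_rotationGroup_of_maps dodec_finite.1 quatP_rep.mem_rotations fun x hx => ?_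
  obtain ⟨u, v, w, hc⟩ := exists_hasCoords (b := b) x
  rw [hc.mem_dodec] at hx
  rw [hc.rotP.mem_dodec]
  -- The twenty vertices are treated one by one; the relation φ² = φ + 1 makes each image coordinate
  -- linear in φ.
  rcases hx with ⟨rfl | rfl, rfl | rfl, rfl | rfl⟩ | ⟨rfl, rfl | rfl, rfl | rfl⟩ |
    ⟨rfl, rfl | rfl, rfl | rfl⟩ | ⟨rfl, rfl | rfl, rfl | rfl⟩ <;>
  first
  | exact Or.inr (Or.inl ⟨by linarith, by first | exact Or.inl (by linarith) | exact Or.inr (by linarith),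
      by first | exact Or.inl (by linarith) | exact Or.inr (by linarith)⟩)
  | exact Or.inr (Or.inr (Or.inl ⟨by linarith,
      by first | exact Or.inl (by linarith) | exact Or.inr (by linarith),
      by first | exact Or.inl (by linarith) | exact Or.inr (by linarith)⟩))
  | exact Or.inr (Or.inr (Or.inr ⟨by linarith,
      by first | exact Or.inl (by linarith) | exact Or.inr (by linarith),
      by first | exact Or.inl (by linarith) | exact Or.inr (by linarith)⟩))
  | exact Or.inl ⟨by first | exact Or.inl (by linarith) | exact Or.inr (by linarith),
      by first | exact Or.inl (by linarith) | exact Or.inr (by linarith),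
      by first | exact Or.inl (by linarith) | exact Or.inr (by linarith)⟩

theorem rotW_pow_three : quatRot b quatW ^ 3 = 1 :=
  Equiv.ext fun x => by
    obtain ⟨u, v, w, hc⟩ := exists_hasCoords (b := b) x
    exact hc.rotW.rotW.rotW.ext hc rfl rfl rfl

theorem rotW_ne_one : quatRot b quatW ≠ 1 := fun h => by
  have h1 := (quatW_rep (b := b)).eq_one_iff.1 h
  norm_num [quatW] at h1

theorem rotW_baseVertex : quatRot b quatW (baseVertex b) = baseVertex b :=
  (baseVertex_coords (b := b)).rotW.ext baseVertex_coords rfl rfl rfl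

theorem orderOf_rotW : orderOf (quatRot b quatW) = 3 :=
  have : Fact (Nat.Prime 3) := ⟨Nat.prime_three⟩
  orderOf_eq_prime rotW_pow_three rotW_ne_one

/-- The trace of this quaternion is φ, so its square is φ q - 1. With φ² = φ + 1 its fifth power is
-1, which acts trivially. -/
theorem rotP_pow_five : quatRot b quatP ^ 5 = 1 := by
  have h0 : star quatP = φ • (1 : ℍ[ℝ]) - quatP := by
    ext <;> simp <;> simp [quatP] <;> ring
  have h1 : quatP * quatP = φ • quatP - 1 := by
    have h := self_mul_star_of_unit (quatP_rep (b := b)).1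
    rw [h0, mul_sub, mul_smul_comm, mul_one] at h
    rw [← h, sub_sub_cancel]
  have h2 : quatP * quatP * (quatP * quatP) = quatP - φ • 1 := by
    rw [h1, mul_sub, sub_mul, smul_mul_smul_comm, h1, ← sq, golden_sq, mul_one, one_mul, smul_sub,
      smul_smul, add_mul, ← sq, golden_sq]
    module
  have h3 : quatP ^ 5 = -1 := by
    rw [show quatP ^ 5 = quatP * quatP * (quatP * quatP) * quatP by simp only [pow_succ]; simp only [pow_zero, one_mul, mul_assoc],
      h2, sub_mul, h1, smul_mul_assoc, one_mul]
    abel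
  refine ((quatP_rep (b := b)).pow 5).eq_one_of_im ?_ ?_ ?_ <;> simp [h3]

theorem rotP_ne_one : quatRot b quatP ≠ 1 := fun h => by
  have h1 := (quatP_rep (b := b)).eq_one_iff.1 h
  norm_num [quatP] at h1

theorem orderOf_rotP : orderOf (quatRot b quatP) = 5 :=
  have : Fact (Nat.Prime 5) := ⟨Nat.prime_five⟩
  orderOf_eq_prime rotP_pow_five rotP_ne_one

section
variable {L : Subgroup (Equiv.Perm S2)}

theorem tetra_subset_orbit (hI : quatRot b quatI ∈ L) (hJ : quatRot b quatJ ∈ L) :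
    tetra b ⊆ MulAction.orbit L (baseVertex b) := by
  intro x hx
  obtain ⟨u, v, w, hc⟩ := exists_hasCoords (b := b) x
  rw [hc.mem_tetra] at hx
  have hA := baseVertex_coords (b := b)
  rcases hx with ⟨rfl, rfl, rfl⟩ | ⟨rfl, rfl, rfl⟩ | ⟨rfl, rfl, rfl⟩ | ⟨rfl, rfl, rfl⟩
  · exact ⟨1, hA.ext hc rfl rfl rfl⟩
  · exact ⟨⟨_, hI⟩, hA.rotI.ext hc rfl rfl rfl⟩
  · exact ⟨⟨_, hJ⟩, hA.rotJ.ext hc rfl rfl rfl⟩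
  · exact ⟨⟨_, mul_mem hI hJ⟩, hA.rotJ.rotI.ext hc rfl rfl (neg_neg _)⟩

theorem tetra_ncard : (tetra b).ncard = 4 := by
  refine le_antisymm tetra_finite.2 ?_
  have h := tetra_simpleVertex (b := b)
  have h1 : insert (baseVertex b) (Set.range (tetraNbr b)) ⊆ tetra b :=
    Set.insert_subset h.mem_A (Set.range_subset_iff.2 h.mem_B)
  refine le_trans ?_ (Set.ncard_le_ncard h1 tetra_finite.1)
  rw [Set.ncard_insert_of_notMem (by rintro ⟨i, hi⟩; exact h.B_ne_A i hi) (Set.finite_range _),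
    ← Set.image_univ, Set.ncard_image_of_injective _ h.B_injective, Set.ncard_univ]
  simp

theorem four_le_orbit [Finite L] (hI : quatRot b quatI ∈ L) (hJ : quatRot b quatJ ∈ L) :
    4 ≤ (MulAction.orbit L (baseVertex b)).ncard := by
  rw [← tetra_ncard (b := b)]
  exact Set.ncard_le_ncard (tetra_subset_orbit hI hJ) (Set.finite_range _)

/-- The half-turns move the base vertex to four points, and its stabilizer contains an element of
order three. -/
theorem twelve_le_card [Finite L] (hI : quatRot b quatI ∈ L) (hJ : quatRot b quatJ ∈ L)
    (hW : quatRot b quatW ∈ L) : 12 ≤ Nat.card L := by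
  rw [← (MulAction.stabilizer L (baseVertex b)).index_mul_card, MulAction.index_stabilizer]
  refine Nat.mul_le_mul (four_le_orbit hI hJ) (?_ : 3 ≤ _)
  have h : (⟨_, hW⟩ : L) ∈ MulAction.stabilizer L (baseVertex b) := rotW_baseVertex
  refine le_of_eq_of_le ?_ (orderOf_le_card (x := (⟨_, h⟩ : MulAction.stabilizer L (baseVertex b))))
  rw [Subgroup.orderOf_mk, Subgroup.orderOf_mk, orderOf_rotW]

theorem card_tetra : Nat.card (rotationGroup (tetra b)) = 12 := by
  have := (tetra_simpleVertex (b := b)).finite_rotationGroup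
  refine le_antisymm ?_ (twelve_le_card rotI_mem_tetra rotJ_mem_tetra rotW_mem_tetra)
  have := (tetra_simpleVertex (b := b)).card_le
  rwa [tetra_ncard] at this

/-- The three rotations generate: the intersection with L has at least 12 elements, which is the
whole order. -/
theorem tetra_le_iff : rotationGroup (tetra b) ≤ L ↔
    quatRot b quatI ∈ L ∧ quatRot b quatJ ∈ L ∧ quatRot b quatW ∈ L := by
  refine ⟨fun h => ⟨h rotI_mem_tetra, h rotJ_mem_tetra, h rotW_mem_tetra⟩, fun ⟨hI, hJ, hW⟩ => ?_⟩
  have := (tetra_simpleVertex (b := b)).finite_rotationGroup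
  have : Finite (rotationGroup (tetra b) ⊓ L : Subgroup (Equiv.Perm S2)) :=
    Finite.of_injective _ (Subgroup.inclusion_injective inf_le_left)
  have h := twelve_le_card (L := rotationGroup (tetra b) ⊓ L) ⟨rotI_mem_tetra, hI⟩
    ⟨rotJ_mem_tetra, hJ⟩ ⟨rotW_mem_tetra, hW⟩
  rw [← Subgroup.eq_of_le_of_card_ge (inf_le_left : rotationGroup (tetra b) ⊓ L ≤ _)
    (by rwa [card_tetra])]
  exact inf_le_right

theorem tetra_le_cube : rotationGroup (tetra b) ≤ rotationGroup (cube b) :=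
  tetra_le_iff.2 ⟨rotI_mem_cube, rotJ_mem_cube, rotW_mem_cube⟩

theorem tetra_le_dodec : rotationGroup (tetra b) ≤ rotationGroup (dodec b) :=
  tetra_le_iff.2 ⟨rotI_mem_dodec, rotJ_mem_dodec, rotW_mem_dodec⟩

theorem rotO_not_mem_tetra : quatRot b quatO ∉ rotationGroup (tetra b) := fun h => by
  have h1 := mem_of_mem_rotationGroup h tetra_simpleVertex.mem_A
  rw [(baseVertex_coords (b := b)).rotO.mem_tetra] at h1
  norm_num at h1

/-- The order is a multiple of 12, at most 24, and not 12, because the quarter turn does not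
preserve the tetrahedron. -/
theorem card_cube_of_le (hG : rotationGroup (tetra b) ≤ L) (hL : L ≤ rotationGroup (cube b))
    (h : quatRot b quatO ∈ L) : Nat.card L = 24 := by
  have := (cube_simpleVertex (b := b)).finite_rotationGroup
  have : Finite L := Finite.of_injective _ (Subgroup.inclusion_injective hL)
  have h1 := Subgroup.card_dvd_of_le hG
  have h2 := (cube_simpleVertex (b := b)).card_le
  have h3 := Nat.mul_le_mul_right 3 (cube_finite (b := b)).2
  have h4 := Nat.le_of_dvd Nat.card_pos (Subgroup.card_dvd_of_le hL)
  rw [card_tetra] at h1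
  have h5 : Nat.card L ≠ 12 := fun h5 => by
    have h6 := Subgroup.eq_of_le_of_card_ge hG (by rw [card_tetra, h5])
    exact rotO_not_mem_tetra (h6 ▸ h)
  have h6 : 0 < Nat.card L := Nat.card_pos
  omega

/-- The order is divisible by 12 and by 5 and is at most 60. Applied to an intersection, this shows
that G and one rotation of order five generate the icosahedral group. -/
theorem card_dodec_of_le (hG : rotationGroup (tetra b) ≤ L) (hL : L ≤ rotationGroup (dodec b))
    (h : quatRot b quatP ∈ L) : Nat.card L = 60 := by
  have := (dodec_simpleVertex (b := b)).finite_rotationGroup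
  have : Finite L := Finite.of_injective _ (Subgroup.inclusion_injective hL)
  have h1 := Subgroup.card_dvd_of_le hG
  have h2 := (dodec_simpleVertex (b := b)).card_le
  have h3 := Nat.mul_le_mul_right 3 (dodec_finite (b := b)).2
  have h4 := Nat.le_of_dvd Nat.card_pos (Subgroup.card_dvd_of_le hL)
  rw [card_tetra] at h1
  have h5 := Subgroup.orderOf_dvd_natCard L h
  rw [orderOf_rotP] at h5
  have h6 : 0 < Nat.card L := Nat.card_pos
  omega

theorem card_cube : Nat.card (rotationGroup (cube b)) = 24 :=
  card_cube_of_le tetra_le_cube le_rfl rotO_mem_cube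

theorem card_dodec : Nat.card (rotationGroup (dodec b)) = 60 :=
  card_dodec_of_le tetra_le_dodec le_rfl rotP_mem_dodec

theorem cube_le_of_mem (hG : rotationGroup (tetra b) ≤ L) (h : quatRot b quatO ∈ L) :
    rotationGroup (cube b) ≤ L := by
  have := (cube_simpleVertex (b := b)).finite_rotationGroup
  rw [← Subgroup.eq_of_le_of_card_ge (inf_le_left : rotationGroup (cube b) ⊓ L ≤ _) (by
    rw [card_cube, card_cube_of_le (le_inf tetra_le_cube hG) inf_le_left ⟨rotO_mem_cube, h⟩])]
  exact inf_le_right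

theorem dodec_le_of_mem (hG : rotationGroup (tetra b) ≤ L) (h : quatRot b quatP ∈ L) :
    rotationGroup (dodec b) ≤ L := by
  have := (dodec_simpleVertex (b := b)).finite_rotationGroup
  rw [← Subgroup.eq_of_le_of_card_ge (inf_le_left : rotationGroup (dodec b) ⊓ L ≤ _) (by
    rw [card_dodec, card_dodec_of_le (le_inf tetra_le_dodec hG) inf_le_left ⟨rotP_mem_dodec, h⟩])]
  exact inf_le_right

end

theorem tetra_regularVertex : RegularVertex (tetra b) (baseVertex b) (tetraNbr b)
    (fun k => coordVec b ((!![-1, 1, 1; 1, -1, 1; 1, 1, -1] : Matrix (Fin 3) (Fin 3) ℝ) k))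
    (fun _ => 1 * (1 / √3)) where
  toSimpleVertex := tetra_simpleVertex
  transitive := tetra_simpleVertex.transitive_of_card (by rw [tetra_ncard, card_tetra])
  cyclic := by
    refine ⟨_, rotW_mem_tetra, rotW_baseVertex, fun i => ?_⟩
    refine (tetraNbr_coords i).rotW.ext (tetraNbr_coords (i + 1)) ?_ ?_ ?_ <;> fin_cases i <;> rfl

theorem cube_regularVertex : RegularVertex (cube b) (baseVertex b) (cubeNbr b)
    (fun k => coordVec b ((!![1, 0, 0; 0, 1, 0; 0, 0, 1] : Matrix (Fin 3) (Fin 3) ℝ) k))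
    (fun _ => 1 * (1 / √3)) where
  toSimpleVertex := cube_simpleVertex
  transitive := cube_simpleVertex.transitive_of_card (by
    rw [card_cube]; exact Nat.mul_le_mul_right 3 cube_finite.2)
  cyclic := by
    refine ⟨_, rotW_mem_cube, rotW_baseVertex, fun i => ?_⟩
    refine (cubeNbr_coords i).rotW.ext (cubeNbr_coords (i + 1)) ?_ ?_ ?_ <;> fin_cases i <;> rfl

theorem dodec_regularVertex : RegularVertex (dodec b) (baseVertex b) (dodecNbr b)
    (fun k => coordVec b ((!![φ, 1, 0; 0, φ, 1; 1, 0, φ] : Matrix (Fin 3) (Fin 3) ℝ) k))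
    (fun _ => (φ + 1) * (1 / √3)) where
  toSimpleVertex := dodec_simpleVertex
  transitive := dodec_simpleVertex.transitive_of_card (by
    rw [card_dodec]; exact Nat.mul_le_mul_right 3 dodec_finite.2)
  cyclic := by
    refine ⟨_, rotW_mem_dodec, rotW_baseVertex, fun i => ?_⟩
    refine (dodecNbr_coords i).rotW.ext (dodecNbr_coords (i + 1)) ?_ ?_ ?_ <;> fin_cases i <;> rfl

end

section

open scoped Quaternion

variable {b : OrthonormalBasis (Fin 3) ℝ E3}

/-! ### Regular tetrahedra and their rotation groups -/

/-- The action on the four vertices is faithful, its image has index two, and the alternating group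
is the only subgroup of index two. -/
theorem rotationGroup_tetra_equiv :
    Nonempty (rotationGroup (tetra b) ≃* alternatingGroup (Fin 4)) := by
  classical
  let p : SubMulAction (rotationGroup (tetra b)) S2 :=
    { carrier := tetra b
      smul_mem' := fun g _ hx => mem_of_mem_rotationGroup g.2 hx }
  have hp : Nat.card p = 4 := tetra_ncard
  have : Finite p := Nat.finite_of_card_ne_zero (by rw [hp]; norm_num)
  have : Fintype p := Fintype.ofFinite p
  let ρ := MulAction.toPermHom (rotationGroup (tetra b)) p
  have hρ : Function.Injective ρ := by
    refine (injective_iff_map_eq_one ρ).2 fun g hg => ?_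
    have hfix : ∀ x ∈ tetra b, g.1 x = x := fun x hx =>
      congrArg (Subtype.val : p → S2) (Equiv.congr_fun hg ⟨x, hx⟩)
    have h := tetra_simpleVertex (b := b)
    exact Subtype.ext (rotation_eq_one g.2.1 (hfix _ (h.mem_B 0)) (hfix _ h.mem_A) (h.B_ne_A 0)
      (h.ne_neg 0))
  have hcard : Nat.card ρ.range = 12 := by
    rw [← Nat.card_congr (MonoidHom.ofInjective hρ).toEquiv, card_tetra]
  have hindex : ρ.range.index = 2 := by
    have h := ρ.range.index_mul_card
    rw [hcard, Nat.card_perm, hp] at h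
    exact Nat.eq_of_mul_eq_mul_right (by norm_num : 0 < 12) (h.trans rfl)
  have hr := Equiv.Perm.eq_alternatingGroup_of_index_eq_two hindex
  have e : p ≃ Fin 4 := Finite.equivFinOfCardEq hp
  exact ⟨((MonoidHom.ofInjective hρ).trans (MulEquiv.subgroupCongr hr)).trans
    (Equiv.altCongrHom e)⟩

/-- The frame consists of the vectors y₀ + y₁ - y₂ - y₃ and the two similar ones, normalized. They
are orthogonal because all inner products of distinct vertices agree. -/
theorem exists_tetra {V : Set S2} (hV : IsRegularTetrahedron V) : ∃ b, V = tetra b := by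
  obtain ⟨hcard, d, hd⟩ := hV
  have hfin : V.Finite := Set.finite_of_ncard_ne_zero (by rw [hcard]; norm_num)
  have : Finite V := hfin
  let e : V ≃ Fin 4 := Finite.equivFinOfCardEq hcard
  let y : Fin 4 → S2 := fun i => (e.symm i : S2)
  have hy : Function.Injective y := Subtype.val_injective.comp e.symm.injective
  have hrange : ∀ x ∈ V, ∃ i, y i = x := fun x hx => ⟨e ⟨x, hx⟩, by simp [y]⟩
  have hn : ∀ i, inner ℝ (y i : E3) (y i : E3) = 1 := fun i => by
    rw [real_inner_self_eq_norm_sq, norm_eq_of_mem_sphere]; norm_num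
  obtain ⟨s, hs⟩ : ∃ s : ℝ, s = 1 - d ^ 2 / 2 := ⟨_, rfl⟩
  have hdist : ∀ i j, i ≠ j → ‖(y i : E3) - y j‖ = d := fun i j hij => by
    rw [← dist_eq_norm]
    exact hd (e.symm i).2 (e.symm j).2 (hy.ne hij)
  have hin : ∀ i j, i ≠ j → inner ℝ (y i : E3) (y j : E3) = s := fun i j hij => by
    have h := norm_sub_sq_real (y i : E3) (y j : E3)
    rw [hdist i j hij, norm_eq_of_mem_sphere, norm_eq_of_mem_sphere] at h
    rw [hs]; linarith
  have hd0 : 0 < d := by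
    rw [← hdist 0 1 (by decide), norm_pos_iff, sub_ne_zero]
    exact fun h => hy.ne (by decide : (0 : Fin 4) ≠ 1) (Subtype.ext h)
  have hs1 : 0 < 1 - s := by rw [hs]; nlinarith
  -- The squared norm of y₀ + y₁ - y₂ - y₃ is 4 (1 - s).
  obtain ⟨t, ht⟩ : ∃ t : ℝ, t = (2 * √(1 - s))⁻¹ := ⟨_, rfl⟩
  have ht0 : 0 < t := by rw [ht]; have := Real.sqrt_pos.2 hs1; positivity
  have ht2 : t ^ 2 * (4 * (1 - s)) = 1 := by
    rw [ht, inv_pow, mul_pow, Real.sq_sqrt hs1.le]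
    have := hs1.ne'
    field_simp
    norm_num
  let F : ℝ → ℝ → ℝ → E3 := fun p q r => t • (y 0 + p • y 1 + q • y 2 + r • y 3 : E3)
  have hFy : ∀ p q r i, inner ℝ (F p q r) (y i : E3)
      = t * (s * (1 + p + q + r) + (1 - s) * (![1, p, q, r] : Fin 4 → ℝ) i) := by
    intro p q r i
    simp only [F, real_inner_smul_left, inner_add_left]
    fin_cases i <;> simp [hin] <;> left <;> ring
  have hFF : ∀ p q r p' q' r', inner ℝ (F p q r) (F p' q' r')
      = t ^ 2 * (s * (1 + p + q + r) * (1 + p' + q' + r')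
        + (1 - s) * (1 + p * p' + q * q' + r * r')) := by
    intro p q r p' q' r'
    conv_lhs => rw [show F p' q' r' = t • (y 0 + p' • y 1 + q' • y 2 + r' • y 3 : E3) from rfl]
    simp only [real_inner_smul_right, inner_add_right, hFy]
    simp
    ring
  let f : Fin 3 → E3 := ![F 1 (-1) (-1), F (-1) 1 (-1), F (-1) (-1) 1]
  have hf : Orthonormal ℝ f := by
    rw [orthonormal_iff_ite]
    intro i j
    fin_cases i <;> fin_cases j <;> (refine (hFF _ _ _ _ _ _).trans ?_) <;>
      simp only [Fin.reduceFinMk, Fin.reduceEq, Fin.zero_eta, Fin.mk_one, if_true, if_false] <;>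
      linarith
  let b := (basisOfOrthonormalOfCardEqFinrank hf (by simp)).toOrthonormalBasis
    (by simpa using hf)
  have hb : ∀ (v : E3) i, b.repr v i = inner ℝ (f i) v := fun v i => by
    rw [b.repr_apply_apply]
    simp [b]
  -- The sum of the vertices is orthogonal to all three axes, so it vanishes; this fixes s = -1/3.
  have hsum : (y 0 + y 1 + y 2 + y 3 : E3) = 0 := by
    refine vec_ext b ?_ ?_ ?_ <;> rw [hb, hb, inner_zero_right] <;>
      simp only [inner_add_right, f, Matrix.cons_val, hFy] <;> ring
  have hs3 : s = -1 / 3 := by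
    have h : inner ℝ (y 0 + y 1 + y 2 + y 3 : E3) (y 0 : E3) = 0 := by
      rw [hsum, inner_zero_left]
    simp [inner_add_left, hin] at h
    linarith
  have htv : t * (4 / 3) = 1 / √3 := by
    rw [hs3] at ht2
    have h1 := inv_sqrt_three_sq
    have h2 := inv_sqrt_three_pos
    have h3 : 0 < t * (4 / 3) := by positivity
    rw [← sq_eq_sq₀ h3.le h2.le, h1]
    linarith
  refine ⟨b, Set.eq_of_subset_of_ncard_le (fun x hx => ?_) (by rw [tetra_ncard, hcard]) tetra_finite.1⟩
  obtain ⟨i, rfl⟩ := hrange x hx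
  have key : HasCoords b (y i) ((![1, 1, -1, -1] : Fin 4 → ℝ) i) ((![1, -1, 1, -1] : Fin 4 → ℝ) i)
      ((![1, -1, -1, 1] : Fin 4 → ℝ) i) := by
    refine ⟨?_, ?_, ?_⟩ <;> rw [hb, ← htv] <;> simp only [f, Matrix.cons_val, hFy] <;> rw [hs3] <;>
      ring
  rw [key.mem_tetra]
  fin_cases i <;> simp

end

section

open scoped Quaternion

variable {b : OrthonormalBasis (Fin 3) ℝ E3} {f : Equiv.Perm S2} {p q : ℍ[ℝ]}
  {H : Subgroup (Equiv.Perm S2)}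

/-! ### Finite rotation groups that properly contain a tetrahedral group -/

theorem QuatRep.sq_sum (hf : QuatRep b q f) :
    q.re ^ 2 + q.imI ^ 2 + q.imJ ^ 2 + q.imK ^ 2 = 1 := by
  rw [← Quaternion.normSq_def', hf.1]

theorem QuatRep.mul_self (hf : QuatRep b q f) : q * q = (2 * q.re) • q - 1 := by
  have h := self_mul_star_of_unit hf.1
  have h1 : star q = (2 * q.re) • (1 : ℍ[ℝ]) - q := by
    ext <;> simp <;> ring
  rw [h1, mul_sub, mul_smul_comm, mul_one] at h
  rw [← h, sub_sub_cancel]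

/-- The power qⁿ is real when fⁿ = 1. Hence either the coefficient of q vanishes or q is itself
real, that is ±1. The coefficients below are the Chebyshev polynomials in 2 re q. -/
theorem QuatRep.re_of_smul (hf : QuatRep b q f) {n : ℕ} (hn : f ^ n = 1) {c d : ℝ}
    (h : q ^ n = c • q + d • 1) : c = 0 ∨ (2 * q.re) ^ 2 = 4 := by
  have h1 := (hf.pow n).eq_one_iff.1 hn
  rw [h] at h1
  simp at h1
  rcases eq_or_ne c 0 with hc | hc
  · exact Or.inl hc
  · simp only [hc, false_or] at h1
    have := hf.sq_sum
    rw [h1.1, h1.2.1, h1.2.2] at this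
    right; linarith

theorem QuatRep.re_of_pow_one (hf : QuatRep b q f) (h : f = 1) : (2 * q.re) ^ 2 = 4 :=
  (hf.re_of_smul (n := 1) (by rw [h, pow_one]) (c := 1) (d := 0) (by simp)).resolve_left one_ne_zero

theorem QuatRep.re_of_pow_two (hf : QuatRep b q f) (h : f ^ 2 = 1) :
    (2 * q.re) ^ 2 = 0 ∨ (2 * q.re) ^ 2 = 4 := by
  refine (hf.re_of_smul h (c := 2 * q.re) (d := -1) ?_).imp_left fun h => by rw [h]; norm_num
  rw [sq, hf.mul_self, neg_one_smul, sub_eq_add_neg]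

theorem QuatRep.pow_three (hf : QuatRep b q f) :
    q ^ 3 = ((2 * q.re) ^ 2 - 1) • q + (-(2 * q.re)) • 1 := by
  rw [pow_succ, sq, hf.mul_self, sub_mul, smul_mul_assoc, hf.mul_self, one_mul]
  module

theorem QuatRep.pow_four (hf : QuatRep b q f) :
    q ^ 4 = ((2 * q.re) ^ 3 - 2 * (2 * q.re)) • q + (1 - (2 * q.re) ^ 2) • 1 := by
  rw [pow_succ, hf.pow_three, add_mul, smul_mul_assoc, hf.mul_self, smul_mul_assoc, one_mul]
  module

theorem QuatRep.pow_five (hf : QuatRep b q f) :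
    q ^ 5 = ((2 * q.re) ^ 4 - 3 * (2 * q.re) ^ 2 + 1) • q + (2 * (2 * q.re) - (2 * q.re) ^ 3) • 1 := by
  rw [pow_succ, hf.pow_four, add_mul, smul_mul_assoc, hf.mul_self, smul_mul_assoc, one_mul]
  module

theorem QuatRep.re_of_pow_three (hf : QuatRep b q f) (h : f ^ 3 = 1) :
    (2 * q.re) ^ 2 = 1 ∨ (2 * q.re) ^ 2 = 4 :=
  (hf.re_of_smul h hf.pow_three).imp_left sub_eq_zero.1

theorem QuatRep.re_of_pow_four (hf : QuatRep b q f) (h : f ^ 4 = 1) :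
    (2 * q.re) ^ 2 = 0 ∨ (2 * q.re) ^ 2 = 2 ∨ (2 * q.re) ^ 2 = 4 := by
  rcases hf.re_of_smul h hf.pow_four with h | h
  · rw [show (2 * q.re) ^ 3 - 2 * (2 * q.re) = (2 * q.re) * ((2 * q.re) ^ 2 - 2) by ring,
      mul_eq_zero, sub_eq_zero] at h
    rcases h with h | h
    · left; rw [h]; norm_num
    · exact Or.inr (Or.inl h)
  · exact Or.inr (Or.inr h)

theorem QuatRep.re_of_pow_five (hf : QuatRep b q f) (h : f ^ 5 = 1) :
    (2 * q.re) ^ 2 = φ + 1 ∨ (2 * q.re) ^ 2 = 2 - φ ∨ (2 * q.re) ^ 2 = 4 := by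
  rcases hf.re_of_smul h hf.pow_five with h | h
  · have h1 : ((2 * q.re) ^ 2 - (φ + 1)) * ((2 * q.re) ^ 2 - (2 - φ)) = 0 := by
      linear_combination h - golden_sq
    rw [mul_eq_zero, sub_eq_zero, sub_eq_zero] at h1
    tauto
  · exact Or.inr (Or.inr h)

/-! ### Quaternions outside the tetrahedral group, normalized by it -/

/-- The rotations described by `q` belong to `H` but not to the tetrahedral group. -/
def Outer (b : OrthonormalBasis (Fin 3) ℝ E3) (H : Subgroup (Equiv.Perm S2)) (q : ℍ[ℝ]) : Prop :=
  ∃ h ∈ H, h ∉ rotationGroup (tetra b) ∧ QuatRep b q h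

namespace Outer

theorem neg (hq : Outer b H q) : Outer b H (-q) := by
  obtain ⟨h, h1, h2, h3⟩ := hq
  exact ⟨h, h1, h2, h3.neg⟩

theorem mul_left (hG : rotationGroup (tetra b) ≤ H) (hq : Outer b H q)
    (hf : f ∈ rotationGroup (tetra b)) (hp : QuatRep b p f) : Outer b H (p * q) := by
  obtain ⟨h, h1, h2, h3⟩ := hq
  exact ⟨f * h, mul_mem (hG hf) h1, fun h4 => h2 ((mul_mem_cancel_left hf).1 h4), hp.mul h3⟩

theorem conj (hG : rotationGroup (tetra b) ≤ H) (hq : Outer b H q)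
    (hf : f ∈ rotationGroup (tetra b)) (hp : QuatRep b p f) : Outer b H (p * q * star p) := by
  obtain ⟨h, h1, h2, h3⟩ := hq.mul_left hG hf hp
  exact ⟨h * f⁻¹, mul_mem h1 (inv_mem (hG hf)),
    fun h4 => h2 ((mul_mem_cancel_right (inv_mem hf)).1 h4), h3.mul hp.inv⟩

theorem not_mem (hq : Outer b H q) (hf : QuatRep b q f) : f ∉ rotationGroup (tetra b) := by
  obtain ⟨h, -, h2, h3⟩ := hq
  rwa [hf.unique h3]

theorem mem (hq : Outer b H q) (hf : QuatRep b q f) : f ∈ H := by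
  obtain ⟨h, h1, -, h3⟩ := hq
  rwa [hf.unique h3]

theorem sq_sum (hq : Outer b H q) :
    (2 * q.re) ^ 2 + (2 * q.imI) ^ 2 + (2 * q.imJ) ^ 2 + (2 * q.imK) ^ 2 = 4 := by
  obtain ⟨h, -, -, h3⟩ := hq
  linear_combination 4 * h3.sq_sum

/-- Multiplication by i or j permutes the components up to sign, conjugation by them changes two
signs, and conjugation by (1 + i + j + k)/2 cycles the imaginary components. The following lemmas
use these moves to normalize q. -/
theorem leftI (hG : rotationGroup (tetra b) ≤ H) (hq : Outer b H q) :
    ∃ p, Outer b H p ∧ p.re = -q.imI ∧ p.imI = q.re ∧ p.imJ = -q.imK ∧ p.imK = q.imJ :=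
  ⟨_, hq.mul_left hG rotI_mem_tetra quatI_rep, by simp; simp [quatI], by simp; simp [quatI],
    by simp; simp [quatI], by simp; simp [quatI]⟩

theorem leftJ (hG : rotationGroup (tetra b) ≤ H) (hq : Outer b H q) :
    ∃ p, Outer b H p ∧ p.re = -q.imJ ∧ p.imI = q.imK ∧ p.imJ = q.re ∧ p.imK = -q.imI :=
  ⟨_, hq.mul_left hG rotJ_mem_tetra quatJ_rep, by simp; simp [quatJ], by simp; simp [quatJ],
    by simp; simp [quatJ], by simp; simp [quatJ]⟩

theorem conjI (hG : rotationGroup (tetra b) ≤ H) (hq : Outer b H q) :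
    ∃ p, Outer b H p ∧ p.re = q.re ∧ p.imI = q.imI ∧ p.imJ = -q.imJ ∧ p.imK = -q.imK :=
  ⟨_, hq.conj hG rotI_mem_tetra quatI_rep, by simp; simp [quatI], by simp; simp [quatI],
    by simp; simp [quatI], by simp; simp [quatI]⟩

theorem conjJ (hG : rotationGroup (tetra b) ≤ H) (hq : Outer b H q) :
    ∃ p, Outer b H p ∧ p.re = q.re ∧ p.imI = -q.imI ∧ p.imJ = q.imJ ∧ p.imK = -q.imK :=
  ⟨_, hq.conj hG rotJ_mem_tetra quatJ_rep, by simp; simp [quatJ], by simp; simp [quatJ],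
    by simp; simp [quatJ], by simp; simp [quatJ]⟩

theorem conjW (hG : rotationGroup (tetra b) ≤ H) (hq : Outer b H q) :
    ∃ p, Outer b H p ∧ p.re = q.re ∧ p.imI = q.imK ∧ p.imJ = q.imI ∧ p.imK = q.imJ :=
  ⟨_, hq.conj hG rotW_mem_tetra quatW_rep, by simp; simp [quatW]; ring, by simp; simp [quatW]; ring,
    by simp; simp [quatW]; ring, by simp; simp [quatW]; ring⟩

theorem leftW_re (hG : rotationGroup (tetra b) ≤ H) (hq : Outer b H q) :
    ∃ p, Outer b H p ∧ 2 * p.re = q.re - q.imI - q.imJ - q.imK :=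
  ⟨_, hq.mul_left hG rotW_mem_tetra quatW_rep, by simp; simp [quatW]; ring⟩

/-- One may normalize the signs of the first two components. -/
theorem abs_re_abs_imI (hG : rotationGroup (tetra b) ≤ H) (hq : Outer b H q) :
    ∃ p, Outer b H p ∧ p.re = |q.re| ∧ p.imI = |q.imI| ∧ p.imJ ^ 2 = q.imJ ^ 2 ∧
      p.imK ^ 2 = q.imK ^ 2 := by
  obtain ⟨r, hr, r0, r1, r2, r3⟩ : ∃ p, Outer b H p ∧ p.re = |q.re| ∧ |p.imI| = |q.imI| ∧
      p.imJ ^ 2 = q.imJ ^ 2 ∧ p.imK ^ 2 = q.imK ^ 2 := by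
    rcases le_total 0 q.re with h | h
    · exact ⟨q, hq, (abs_of_nonneg h).symm, rfl, rfl, rfl⟩
    · exact ⟨-q, hq.neg, (abs_of_nonpos h).symm, by simp, by simp, by simp⟩
  rcases le_total 0 r.imI with h | h
  · exact ⟨r, hr, r0, by rw [← r1, abs_of_nonneg h], r2, r3⟩
  · obtain ⟨p, hp, p0, p1, p2, p3⟩ := hr.conjJ hG
    exact ⟨p, hp, p0.trans r0, by rw [← r1, abs_of_nonpos h, p1], by rw [p2, r2],
      by rw [p3, neg_sq, r3]⟩

theorem abs_imJ (hG : rotationGroup (tetra b) ≤ H) (hq : Outer b H q) :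
    ∃ p, Outer b H p ∧ p.re = |q.re| ∧ p.imI = |q.imI| ∧ p.imJ = |q.imJ| ∧
      p.imK ^ 2 = q.imK ^ 2 := by
  obtain ⟨r, hr, r0, r1, r2, r3⟩ := hq.abs_re_abs_imI hG
  rw [sq_eq_sq_iff_abs_eq_abs] at r2
  rcases le_total 0 r.imJ with h | h
  · exact ⟨r, hr, r0, r1, by rw [← r2, abs_of_nonneg h], r3⟩
  · obtain ⟨p, hp, p0, p1, p2, p3⟩ := hr.conjI hG
    exact ⟨p, hp, p0.trans r0, p1.trans r1, by rw [← r2, abs_of_nonpos h, p2],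
      by rw [p3, neg_sq, r3]⟩

theorem abs_imK (hG : rotationGroup (tetra b) ≤ H) (hq : Outer b H q) (h0 : q.imJ = 0) :
    ∃ p, Outer b H p ∧ p.re = |q.re| ∧ p.imI = |q.imI| ∧ p.imJ = 0 ∧ p.imK = |q.imK| := by
  obtain ⟨r, hr, r0, r1, r2, r3⟩ := hq.abs_re_abs_imI hG
  rw [sq_eq_sq_iff_abs_eq_abs] at r3
  rw [h0, zero_pow two_ne_zero, sq_eq_zero_iff] at r2
  rcases le_total 0 r.imK with h | h
  · exact ⟨r, hr, r0, r1, r2, by rw [← r3, abs_of_nonneg h]⟩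
  · obtain ⟨p, hp, p0, p1, p2, p3⟩ := hr.conjI hG
    exact ⟨p, hp, p0.trans r0, p1.trans r1, by rw [p2, r2, neg_zero],
      by rw [← r3, abs_of_nonpos h, p3]⟩

/-- Any component may be moved to the first place. -/
theorem exists_re (hG : rotationGroup (tetra b) ≤ H) (hq : Outer b H q) {c : ℝ}
    (h : (2 * q.re) ^ 2 = c ∨ (2 * q.imI) ^ 2 = c ∨ (2 * q.imJ) ^ 2 = c ∨ (2 * q.imK) ^ 2 = c) :
    ∃ p, Outer b H p ∧ (2 * p.re) ^ 2 = c := by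
  rcases h with h | h | h | h
  · exact ⟨q, hq, h⟩
  · obtain ⟨p, hp, p0, -⟩ := hq.leftI hG
    exact ⟨p, hp, by rw [p0, ← h]; ring⟩
  · obtain ⟨p, hp, p0, -⟩ := hq.leftJ hG
    exact ⟨p, hp, by rw [p0, ← h]; ring⟩
  · obtain ⟨r, hr, -, -, r2, -⟩ := hq.leftI hG
    obtain ⟨p, hp, p0, -⟩ := hr.leftJ hG
    exact ⟨p, hp, by rw [p0, r2, ← h]; ring⟩

/-- Any of the last three components may be moved to the third place. -/
theorem exists_imJ (hG : rotationGroup (tetra b) ≤ H) (hq : Outer b H q) {c : ℝ}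
    (h : (2 * q.imI) ^ 2 = c ∨ (2 * q.imJ) ^ 2 = c ∨ (2 * q.imK) ^ 2 = c) :
    ∃ p, Outer b H p ∧ p.re = q.re ∧ (2 * p.imJ) ^ 2 = c := by
  rcases h with h | h | h
  · obtain ⟨p, hp, p0, p1, p2, p3⟩ := hq.conjW hG
    exact ⟨p, hp, p0, by rw [p2, h]⟩
  · exact ⟨q, hq, rfl, h⟩
  · obtain ⟨r, hr, r0, r1, r2, r3⟩ := hq.conjW hG
    obtain ⟨p, hp, p0, p1, p2, p3⟩ := hr.conjW hG
    exact ⟨p, hp, p0.trans r0, by rw [p2, r1, h]⟩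

/-- Each component becomes a real part, up to sign, after multiplication by an element of G, so a
restriction on the real parts of all outer quaternions holds for all components. -/
theorem forall_components (hG : rotationGroup (tetra b) ≤ H) {P : ℝ → Prop}
    (hP : ∀ p, Outer b H p → P ((2 * p.re) ^ 2)) (hq : Outer b H q) :
    P ((2 * q.re) ^ 2) ∧ P ((2 * q.imI) ^ 2) ∧ P ((2 * q.imJ) ^ 2) ∧ P ((2 * q.imK) ^ 2) := by
  obtain ⟨p1, h1, e1, -⟩ := hq.leftI hG
  obtain ⟨p2, h2, e2, -⟩ := hq.leftJ hG
  obtain ⟨p3, h3, -, -, e3, -⟩ := hq.leftI hG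
  obtain ⟨p4, h4, e4, -⟩ := h3.leftJ hG
  refine ⟨hP q hq, ?_, ?_, ?_⟩
  · have := hP p1 h1; rwa [e1, mul_neg, neg_sq] at this
  · have := hP p2 h2; rwa [e2, mul_neg, neg_sq] at this
  · have := hP p4 h4; rwa [e4, e3, neg_neg] at this

theorem re_ne_four (hq : Outer b H q) : (2 * q.re) ^ 2 ≠ 4 := fun h => by
  have h1 := hq.sq_sum
  obtain ⟨f, -, h2, h3⟩ := hq
  refine h2 ?_
  rw [h3.eq_one_of_im (by nlinarith [sq_nonneg q.imI, sq_nonneg q.imJ, sq_nonneg q.imK])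
    (by nlinarith [sq_nonneg q.imI, sq_nonneg q.imJ, sq_nonneg q.imK])
    (by nlinarith [sq_nonneg q.imI, sq_nonneg q.imJ, sq_nonneg q.imK])]
  exact one_mem _

/-- The sixteen quaternions (±1 ± i ± j ± k)/2 describe rotations of G. With three signs normalized
only two of them have to be considered. -/
theorem not_all_one (hG : rotationGroup (tetra b) ≤ H) (hq : Outer b H q)
    (h0 : (2 * q.re) ^ 2 = 1) (h1 : (2 * q.imI) ^ 2 = 1) (h2 : (2 * q.imJ) ^ 2 = 1)
    (h3 : (2 * q.imK) ^ 2 = 1) : False := by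
  obtain ⟨p, hp, p0, p1, p2, p3⟩ := hq.abs_imJ hG
  have key : ∀ t : ℝ, (2 * t) ^ 2 = 1 → |t| = 1 / 2 := fun t ht => by
    rw [← abs_of_pos (by norm_num : (0 : ℝ) < 1 / 2), ← sq_eq_sq_iff_abs_eq_abs]
    linarith
  rw [key _ h0] at p0
  rw [key _ h1] at p1
  rw [key _ h2] at p2
  have h4 := key p.imK (by linarith)
  rcases (abs_eq (by norm_num)).1 h4 with h | h
  · have : p = quatW := QuaternionAlgebra.ext p0 p1 p2 h
    exact (this ▸ hp).not_mem quatW_rep rotW_mem_tetra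
  · have : p = quatI * star quatW := by
      ext
      · rw [p0]; simp; simp [quatI, quatW]
      · rw [p1]; simp; simp [quatI, quatW]
      · rw [p2]; simp; simp [quatI, quatW]
      · rw [h]; simp; simp [quatI, quatW]
    exact (this ▸ hp).not_mem (quatI_rep.mul quatW_rep.inv)
      (mul_mem rotI_mem_tetra (inv_mem rotW_mem_tetra))

/-- The squares `(2 q.re) ^ 2` that occur in an icosahedral group are `m + k φ` with these `m`. -/
def goldenM : Fin 5 → ℤ := ![0, 1, 1, 2, 4]
/-- The squares `(2 q.re) ^ 2` that occur in an icosahedral group are `m + k φ` with these `k`. -/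
def goldenK : Fin 5 → ℤ := ![0, 0, 1, -1, 0]

theorem _root_.eq_of_add_mul_golden {m k : ℤ} (h : (m : ℝ) + k * φ = 4) : m = 4 ∧ k = 0 := by
  have hk : k = 0 := by
    by_contra hk
    have hk' : (k : ℝ) ≠ 0 := Int.cast_ne_zero.2 hk
    refine Real.goldenRatio_irrational ⟨(4 - m) / k, ?_⟩
    push_cast
    rw [div_eq_iff hk']
    linarith
  refine ⟨?_, hk⟩
  rw [hk, Int.cast_zero, zero_mul, add_zero] at h
  exact_mod_cast h

theorem golden_indices (hG : rotationGroup (tetra b) ≤ H)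
    (hP : ∀ p, Outer b H p → ∃ i, (2 * p.re) ^ 2 = goldenM i + goldenK i * φ)
    (hq : Outer b H q) : ∃ i j k l, (2 * q.re) ^ 2 = goldenM i + goldenK i * φ ∧
      (2 * q.imI) ^ 2 = goldenM j + goldenK j * φ ∧ (2 * q.imJ) ^ 2 = goldenM k + goldenK k * φ ∧
      (2 * q.imK) ^ 2 = goldenM l + goldenK l * φ ∧
      goldenM i + goldenM j + goldenM k + goldenM l = 4 ∧
      goldenK i + goldenK j + goldenK k + goldenK l = 0 := by
  obtain ⟨⟨i, hi⟩, ⟨j, hj⟩, ⟨k, hk⟩, ⟨l, hl⟩⟩ := hq.forall_components hG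
    (P := fun x => ∃ i, x = goldenM i + goldenK i * φ) hP
  refine ⟨i, j, k, l, hi, hj, hk, hl, eq_of_add_mul_golden ?_⟩
  push_cast
  linarith [hq.sq_sum]

/-- The doubled components have squares among 0, 1, φ + 1, 2 - φ, 4 with sum 4. All equal to 1, or
one equal to 4, means an element of G. Otherwise they are φ + 1, 1, 2 - φ, 0 in some order; G brings
φ to the real place and 0 to the place of j, which leaves two orders of the rest. -/
theorem exists_golden (hG : rotationGroup (tetra b) ≤ H)
    (hP : ∀ p, Outer b H p → ∃ i, (2 * p.re) ^ 2 = goldenM i + goldenK i * φ)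
    (hq : Outer b H q) : Outer b H quatP ∨ Outer b H ⟨φ / 2, 1 / 2, 0, (φ - 1) / 2⟩ := by
  have hφ := golden_gt
  have v0 : (goldenM 0 + goldenK 0 * φ : ℝ) = 0 := by simp [goldenM, goldenK]
  have v1 : (goldenM 1 + goldenK 1 * φ : ℝ) = 1 := by simp [goldenM, goldenK]
  have v2 : (goldenM 2 + goldenK 2 * φ : ℝ) = φ + 1 := by simp [goldenM, goldenK]; ring
  have v3 : (goldenM 3 + goldenK 3 * φ : ℝ) = 2 - φ := by simp [goldenM, goldenK]; ring
  have v4 : (goldenM 4 + goldenK 4 * φ : ℝ) = 4 := by simp [goldenM, goldenK]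
  obtain ⟨p, hp, hre⟩ : ∃ p, Outer b H p ∧ (2 * p.re) ^ 2 = φ + 1 := by
    obtain ⟨i, j, k, l, hi, hj, hk, hl, h⟩ := hq.golden_indices hG hP
    have h1 : (i = 1 ∧ j = 1 ∧ k = 1 ∧ l = 1) ∨ (i = 4 ∨ j = 4 ∨ k = 4 ∨ l = 4) ∨
        (i = 2 ∨ j = 2 ∨ k = 2 ∨ l = 2) := by
      clear hi hj hk hl
      decide +revert
    rcases h1 with ⟨rfl, rfl, rfl, rfl⟩ | h1 | h1
    · rw [v1] at hi hj hk hl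
      exact (hq.not_all_one hG hi hj hk hl).elim
    · obtain ⟨p, hp, h4⟩ := hq.exists_re hG (c := 4) (by
        rcases h1 with rfl | rfl | rfl | rfl <;> rw [v4] at * <;> tauto)
      exact (hp.re_ne_four h4).elim
    · exact hq.exists_re hG (by rcases h1 with rfl | rfl | rfl | rfl <;> rw [v2] at * <;> tauto)
  have hidx : ∀ i, (φ + 1 : ℝ) = goldenM i + goldenK i * φ → i = 2 := fun i hi => by
    fin_cases i
    · exact absurd (hi.trans v0) (by linarith)
    · exact absurd (hi.trans v1) (by linarith)
    · rfl
    · exact absurd (hi.trans v3) (by linarith)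
    · exact absurd (hi.trans v4) (by linarith [golden_lt])
  obtain ⟨r, hr, hre', hJ⟩ : ∃ r, Outer b H r ∧ (2 * r.re) ^ 2 = φ + 1 ∧ (2 * r.imJ) ^ 2 = 0 := by
    obtain ⟨i, j, k, l, hi, hj, hk, hl, h⟩ := hp.golden_indices hG hP
    obtain rfl := hidx i (hre ▸ hi)
    have h1 : j = 0 ∨ k = 0 ∨ l = 0 := by
      clear hi hj hk hl
      decide +revert
    obtain ⟨r, hr, e, h0⟩ := hp.exists_imJ hG (c := 0) (by
      rcases h1 with rfl | rfl | rfl <;> rw [v0] at * <;> tauto)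
    exact ⟨r, hr, by rw [e, hre], h0⟩
  have hJ0 : r.imJ = 0 := by nlinarith
  -- Since the j-component vanishes, the sign changes available make all the other components
  -- nonnegative.
  obtain ⟨s, hs, s0, s1, s2, s3⟩ := hr.abs_imK hG hJ0
  have key : ∀ t x : ℝ, 0 ≤ x → (2 * t) ^ 2 = x ^ 2 → |t| = x / 2 := fun t x hx ht => by
    rw [← abs_of_nonneg (by positivity : 0 ≤ x / 2), ← sq_eq_sq_iff_abs_eq_abs]
    linarith
  rw [key _ φ (by linarith) (hre'.trans golden_sq.symm)] at s0
  have h2 : (φ - 1) ^ 2 = 2 - φ := by linear_combination golden_sq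
  obtain ⟨i, j, k, l, hi, hj, hk, hl, h⟩ := hr.golden_indices hG hP
  obtain rfl := hidx i (hre' ▸ hi)
  have hk0 : k = 0 := by
    rw [hJ] at hk
    fin_cases k
    · rfl
    · exact absurd (hk.trans v1) (by norm_num)
    · exact absurd (hk.trans v2) (by linarith)
    · exact absurd (hk.trans v3) (by linarith [golden_lt])
    · exact absurd (hk.trans v4) (by norm_num)
  subst hk0
  have h1 : j = 3 ∧ l = 1 ∨ j = 1 ∧ l = 3 := by
    clear hi hj hk hl
    decide +revert
  rcases h1 with ⟨rfl, rfl⟩ | ⟨rfl, rfl⟩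
  · rw [key _ (φ - 1) (by linarith) (by rw [hj, v3, h2])] at s1
    rw [key _ 1 zero_le_one (by rw [hl, v1, one_pow])] at s3
    exact Or.inl ((QuaternionAlgebra.ext s0 s1 s2 s3 : s = quatP) ▸ hs)
  · rw [key _ 1 zero_le_one (by rw [hj, v1, one_pow])] at s1
    rw [key _ (φ - 1) (by linarith) (by rw [hl, v3, h2])] at s3
    exact Or.inr ((QuaternionAlgebra.ext s0 s1 s2 s3 : s = ⟨φ / 2, 1 / 2, 0, (φ - 1) / 2⟩) ▸ hs)

/-- Here the squares are among 0, 1, 2, 4 with sum 4. Outside G this leaves 2, 2, 0, 0, a quarter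
turn after normalization, and 2, 1, 1, 0, which multiplication by (1 + i + j + k)/2 refutes. -/
theorem exists_quatO (hG : rotationGroup (tetra b) ≤ H)
    (hP : ∀ p, Outer b H p → ∃ i : Fin 4, (2 * p.re) ^ 2 = ((![0, 1, 2, 4] : Fin 4 → ℕ) i : ℝ))
    (hq : Outer b H q) : Outer b H quatO := by
  have hind : ∀ {q}, Outer b H q → ∃ i j k l : Fin 4,
      (2 * q.re) ^ 2 = ((![0, 1, 2, 4] : Fin 4 → ℕ) i : ℝ) ∧
      (2 * q.imI) ^ 2 = ((![0, 1, 2, 4] : Fin 4 → ℕ) j : ℝ) ∧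
      (2 * q.imJ) ^ 2 = ((![0, 1, 2, 4] : Fin 4 → ℕ) k : ℝ) ∧
      (2 * q.imK) ^ 2 = ((![0, 1, 2, 4] : Fin 4 → ℕ) l : ℝ) ∧
      (![0, 1, 2, 4] : Fin 4 → ℕ) i + (![0, 1, 2, 4] : Fin 4 → ℕ) j +
        (![0, 1, 2, 4] : Fin 4 → ℕ) k + (![0, 1, 2, 4] : Fin 4 → ℕ) l = 4 := fun {q} hq => by
    obtain ⟨⟨i, hi⟩, ⟨j, hj⟩, ⟨k, hk⟩, ⟨l, hl⟩⟩ := hq.forall_components hG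
      (P := fun x => ∃ i : Fin 4, x = ((![0, 1, 2, 4] : Fin 4 → ℕ) i : ℝ)) hP
    refine ⟨i, j, k, l, hi, hj, hk, hl, ?_⟩
    have := hq.sq_sum
    rw [hi, hj, hk, hl] at this
    exact_mod_cast this
  have v0 : (((![0, 1, 2, 4] : Fin 4 → ℕ) 0 : ℕ) : ℝ) = 0 := by simp
  have v1 : (((![0, 1, 2, 4] : Fin 4 → ℕ) 1 : ℕ) : ℝ) = 1 := by simp
  have v2 : (((![0, 1, 2, 4] : Fin 4 → ℕ) 2 : ℕ) : ℝ) = 2 := by simp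
  have v3 : (((![0, 1, 2, 4] : Fin 4 → ℕ) 3 : ℕ) : ℝ) = 4 := by simp
  obtain ⟨p, hp, hre⟩ : ∃ p, Outer b H p ∧ (2 * p.re) ^ 2 = 2 := by
    obtain ⟨i, j, k, l, hi, hj, hk, hl, h⟩ := hind hq
    have h1 : (i = 1 ∧ j = 1 ∧ k = 1 ∧ l = 1) ∨ (i = 3 ∨ j = 3 ∨ k = 3 ∨ l = 3) ∨
        (i = 2 ∨ j = 2 ∨ k = 2 ∨ l = 2) := by
      clear hi hj hk hl
      decide +revert
    rcases h1 with ⟨rfl, rfl, rfl, rfl⟩ | h1 | h1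
    · rw [v1] at hi hj hk hl
      exact (hq.not_all_one hG hi hj hk hl).elim
    · obtain ⟨p, hp, h4⟩ := hq.exists_re hG (c := 4) (by
        rcases h1 with rfl | rfl | rfl | rfl <;> rw [v3] at * <;> tauto)
      exact (hp.re_ne_four h4).elim
    · exact hq.exists_re hG (by rcases h1 with rfl | rfl | rfl | rfl <;> rw [v2] at * <;> tauto)
  have hidx : ∀ i : Fin 4, (2 : ℝ) = ((![0, 1, 2, 4] : Fin 4 → ℕ) i : ℝ) → i = 2 := fun i hi => by
    have hi' : 2 = (![0, 1, 2, 4] : Fin 4 → ℕ) i := by exact_mod_cast hi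
    clear hi
    decide +revert
  obtain ⟨r, hr, hre', hJ⟩ : ∃ r, Outer b H r ∧ r.re = p.re ∧ (2 * r.imJ) ^ 2 = 0 := by
    obtain ⟨i, j, k, l, hi, hj, hk, hl, h⟩ := hind hp
    obtain rfl := hidx i (hre ▸ hi)
    have h1 : j = 0 ∨ k = 0 ∨ l = 0 := by
      clear hi hj hk hl
      decide +revert
    exact hp.exists_imJ hG (c := 0) (by rcases h1 with rfl | rfl | rfl <;> rw [v0] at * <;> tauto)
  have hre2 : (2 * r.re) ^ 2 = 2 := by rw [hre', hre]
  have hJ0 : r.imJ = 0 := by nlinarith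
  have habs : ∀ t : ℝ, (2 * t) ^ 2 = 2 → |t| = √2 / 2 := fun t ht => by
    rw [← abs_of_nonneg (by positivity : 0 ≤ √2 / 2), ← sq_eq_sq_iff_abs_eq_abs, div_pow,
      Real.sq_sqrt (by norm_num)]
    linarith
  have hfin : ∀ r, Outer b H r → (2 * r.re) ^ 2 = 2 → r.imI = 0 → r.imJ = 0 →
      (2 * r.imK) ^ 2 = 2 → Outer b H quatO := by
    intro r hr h0 h1 h2 h3
    obtain ⟨s, hs, s0, s1, s2, s3⟩ := hr.abs_imK hG h2
    rw [habs _ h0] at s0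
    rw [h1, abs_zero] at s1
    rw [habs _ h3] at s3
    exact (QuaternionAlgebra.ext s0 s1 s2 s3 : s = quatO) ▸ hs
  obtain ⟨i, j, k, l, hi, hj, hk, hl, h⟩ := hind hr
  obtain rfl := hidx i (hre2 ▸ hi)
  have hk0 : k = 0 := by
    rw [hJ] at hk
    have hk' : 0 = (![0, 1, 2, 4] : Fin 4 → ℕ) k := by exact_mod_cast hk
    have h0 : ∀ k, 0 = (![0, 1, 2, 4] : Fin 4 → ℕ) k → k = 0 := by decide
    exact h0 k hk'
  subst hk0
  have h1 : j = 0 ∧ l = 2 ∨ j = 2 ∧ l = 0 ∨ j = 1 ∧ l = 1 := by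
    clear hi hj hk hl
    decide +revert
  rcases h1 with ⟨rfl, rfl⟩ | ⟨rfl, rfl⟩ | ⟨rfl, rfl⟩
  · rw [v0] at hj
    rw [v2] at hl
    exact hfin r hr hre2 (by nlinarith) hJ0 hl
  · rw [v2] at hj
    rw [v0] at hl
    obtain ⟨s, hs, s0, s1, s2, s3⟩ := hr.conjW hG
    obtain ⟨t, ht, t0, t1, t2, t3⟩ := hs.conjW hG
    exact hfin t ht (by rw [t0, s0, hre2]) (by rw [t1, s3, hJ0]) (by rw [t2, s1]; nlinarith)
      (by rw [t3, s2, hj])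
  · rw [v1] at hj hl
    obtain ⟨s, hs, hs0⟩ := hr.leftW_re hG
    obtain ⟨m, hm⟩ := hP s hs
    have hB : 2 * r.imI = 1 ∨ 2 * r.imI = -1 :=
      sq_eq_sq_iff_eq_or_eq_neg.1 (hj.trans (one_pow 2).symm)
    have hD : 2 * r.imK = 1 ∨ 2 * r.imK = -1 :=
      sq_eq_sq_iff_eq_or_eq_neg.1 (hl.trans (one_pow 2).symm)
    obtain ⟨y, hy⟩ : ∃ y, y = (2 * s.re) ^ 2 := ⟨_, rfl⟩
    have hy' : y = 0 ∨ y = 1 ∨ y = 2 ∨ y = 4 := by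
      rw [hy, hm]
      fin_cases m <;> simp
    obtain ⟨x, hx⟩ : ∃ x, x = 2 * r.re := ⟨_, rfl⟩
    obtain ⟨z, hz⟩ : ∃ z, z = 2 * r.imI + 2 * r.imK := ⟨_, rfl⟩
    have hz' : z = 2 ∨ z = 0 ∨ z = -2 := by
      rw [hz]
      rcases hB with hB | hB <;> rcases hD with hD | hD <;> rw [hB, hD] <;> norm_num
    have e : 2 * x * z = 2 + z ^ 2 - 4 * y := by
      rw [hy, hs0, hJ0, hz, hx]
      linear_combination hre2
    -- Here x is ±√2; squaring eliminates it and leaves an equation with no solution among the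
    -- finitely many values of y and z.
    have e2 : 8 * z ^ 2 = (2 + z ^ 2 - 4 * y) ^ 2 := by
      rw [← e]
      rw [← hx] at hre2
      linear_combination -4 * z ^ 2 * hre2
    rcases hz' with rfl | rfl | rfl <;> rcases hy' with rfl | rfl | rfl | rfl <;> norm_num at e2

end Outer

/-- Exchanging two coordinates reverses the orientation, so the imaginary part is permuted and also
negated. This interchanges the two icosahedral groups over one tetrahedron. -/
theorem QuatRep.reindex (hf : QuatRep b q f) (hre : p.re = q.re) (hI : p.imI = -q.imK)
    (hJ : p.imJ = -q.imJ) (hK : p.imK = -q.imI) : QuatRep (b.reindex (Equiv.swap 0 2)) p f := by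
  have hr : ∀ x : E3, ∀ i, (b.reindex (Equiv.swap 0 2)).repr x i = b.repr x (Equiv.swap 0 2 i) :=
    fun x i => by simp
  have e0 : Equiv.swap (0 : Fin 3) 2 0 = 2 := by decide
  have e1 : Equiv.swap (0 : Fin 3) 2 1 = 1 := by decide
  have e2 : Equiv.swap (0 : Fin 3) 2 2 = 0 := by decide
  refine ⟨?_, fun x => ?_⟩
  · rw [Quaternion.normSq_def', hre, hI, hJ, hK]
    linear_combination hf.sq_sum
  · obtain ⟨h0, h1, h2⟩ := hf.coords x
    ext
    · simp
      ring
    · rw [pureQuat_imI, hr, e0, h2]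
      simp [-OrthonormalBasis.repr_reindex, hr, e0, e1, e2, hre, hI, hJ, hK]
      ring
    · rw [pureQuat_imJ, hr, e1, h1]
      simp [-OrthonormalBasis.repr_reindex, hr, e0, e1, e2, hre, hI, hJ, hK]
      ring
    · rw [pureQuat_imK, hr, e2, h0]
      simp [-OrthonormalBasis.repr_reindex, hr, e0, e1, e2, hre, hI, hJ, hK]
      ring

theorem tetra_reindex (e : Equiv.Perm (Fin 3)) : tetra (b.reindex e) = tetra b := by
  have hp : ∀ x : S2, (b.reindex e).repr x 0 * (b.reindex e).repr x 1 * (b.reindex e).repr x 2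
      = b.repr x 0 * b.repr x 1 * b.repr x 2 := fun x => by
    rw [← Fin.prod_univ_three, ← Fin.prod_univ_three]
    simp only [OrthonormalBasis.repr_reindex]
    exact Equiv.prod_comp e.symm (fun i => b.repr x i)
  ext x
  simp only [tetra, Set.mem_ofPred_eq, hp]
  simp only [OrthonormalBasis.repr_reindex]
  rw [e.symm.forall_congr_right (q := fun i => |b.repr x i| = 1 / √3)]

theorem cube_reindex (e : Equiv.Perm (Fin 3)) : cube (b.reindex e) = cube b := by
  ext x
  simp only [cube, Set.mem_ofPred_eq, OrthonormalBasis.repr_reindex]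
  rw [e.symm.forall_congr_right (q := fun i => |b.repr x i| = 1 / √3)]

/-- A finite rotation group that properly contains a tetrahedral group contains the octahedral
group of the circumscribed cube or one of the two icosahedral groups. -/
theorem octahedral_or_icosahedral_le [Finite H] (hH : H ≤ rotations)
    (hG : rotationGroup (tetra b) ≤ H) (hne : ¬ H ≤ rotationGroup (tetra b)) :
    (rotationGroup (cube b) ≤ H ∧ ∀ f ∈ H, f ^ 5 = 1 → f = 1) ∨
      ∃ b', tetra b' = tetra b ∧ rotationGroup (dodec b') ≤ H := by
  obtain ⟨f, hf, hfG⟩ := SetLike.not_le_iff_exists.1 hne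
  obtain ⟨q, hq⟩ := exists_quatRep b (hH hf)
  have hout : Outer b H q := ⟨f, hf, hfG, hq⟩
  have hI := hG (rotI_mem_tetra (b := b))
  have hJ := hG (rotJ_mem_tetra (b := b))
  rcases element_orders hH (hG rotW_mem_tetra) rotW_ne_one rotW_pow_three rotW_baseVertex
    (four_le_orbit hI hJ) with h | h
  · left
    constructor
    · refine cube_le_of_mem hG ((Outer.exists_quatO hG ?_ hout).mem quatO_rep)
      rintro p ⟨f, hf, -, hp⟩
      rcases h f hf with h | h | h | h
      · exact ⟨3, by rw [hp.re_of_pow_one h]; simp⟩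
      · rcases hp.re_of_pow_two h with h | h
        exacts [⟨0, by rw [h]; simp⟩, ⟨3, by rw [h]; simp⟩]
      · rcases hp.re_of_pow_three h with h | h
        exacts [⟨1, by rw [h]; simp⟩, ⟨3, by rw [h]; simp⟩]
      · rcases hp.re_of_pow_four h with h | h | h
        exacts [⟨0, by rw [h]; simp⟩, ⟨2, by rw [h]; simp⟩, ⟨3, by rw [h]; simp⟩]
    -- The absence of order five is recorded in order to separate this case from the icosahedral
    -- one.
    · intro f hf h5
      rcases h f hf with h | h | h | h
      · exact h
      · calc f = f ^ 5 * (f ^ 2)⁻¹ * (f ^ 2)⁻¹ := by group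
          _ = 1 := by rw [h5, h]; simp
      · calc f = f ^ 3 * f ^ 3 * (f ^ 5)⁻¹ := by group
          _ = 1 := by rw [h5, h]; simp
      · calc f = f ^ 5 * (f ^ 4)⁻¹ := by group
          _ = 1 := by rw [h5, h]; simp
  · right
    have hP : ∀ p, Outer b H p →
        ∃ i, (2 * p.re) ^ 2 = Outer.goldenM i + Outer.goldenK i * φ := by
      rintro p ⟨f, hf, -, hp⟩
      rcases h f hf with h | h | h | h
      · exact ⟨4, by rw [hp.re_of_pow_one h]; simp [Outer.goldenM, Outer.goldenK]⟩
      · rcases hp.re_of_pow_two h with h | h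
        exacts [⟨0, by rw [h]; simp [Outer.goldenM, Outer.goldenK]⟩,
          ⟨4, by rw [h]; simp [Outer.goldenM, Outer.goldenK]⟩]
      · rcases hp.re_of_pow_three h with h | h
        exacts [⟨1, by rw [h]; simp [Outer.goldenM, Outer.goldenK]⟩,
          ⟨4, by rw [h]; simp [Outer.goldenM, Outer.goldenK]⟩]
      · rcases hp.re_of_pow_five h with h | h | h
        exacts [⟨2, by rw [h]; simp [Outer.goldenM, Outer.goldenK]; ring⟩,
          ⟨3, by rw [h]; simp [Outer.goldenM, Outer.goldenK]; ring⟩,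
          ⟨4, by rw [h]; simp [Outer.goldenM, Outer.goldenK]⟩]
    rcases Outer.exists_golden hG hP hout with h | h
    · exact ⟨b, rfl, dodec_le_of_mem hG (h.mem quatP_rep)⟩
    · obtain ⟨f, hf, -, hp⟩ := h
      refine ⟨b.reindex (Equiv.swap 0 2), tetra_reindex _, dodec_le_of_mem ?_ ?_⟩
      · rwa [tetra_reindex]
      · have h1 := (hp.reindex (p := star quatP) (by simp; simp [quatP]) (by simp; simp [quatP])
          (by simp; simp [quatP]) (by simp; simp [quatP])).inv
        rw [star_star] at h1
        rw [quatP_rep.unique h1]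
        exact inv_mem hf

end

section

variable {b : OrthonormalBasis (Fin 3) ℝ E3}

/-! ### The cubes and dodecahedra whose groups contain a tetrahedral group -/

theorem cube_ncard : (cube b).ncard = 8 := by
  have h := (cube_simpleVertex (b := b)).card_le
  have h2 := (cube_finite (b := b)).2
  rw [card_cube] at h
  omega

theorem dodec_ncard : (dodec b).ncard = 20 := by
  have h := (dodec_simpleVertex (b := b)).card_le
  have h2 := (dodec_finite (b := b)).2
  rw [card_dodec] at h
  omega

/-- The number of vertices is 2 modulo 3, so a rotation of order three that permutes them fixes one.
Its axis meets the sphere only there and at the antipode, which is a vertex too. -/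
theorem mem_of_order_three {V : Set S2} (hV : V.Finite) (hc : V.ncard % 3 = 2)
    (hneg : ∀ x ∈ V, -x ∈ V) {r : Equiv.Perm S2} (hr : r ∈ rotationGroup V) (h3 : r ^ 3 = 1)
    (hne : r ≠ 1) {x : S2} (hx : r x = x) : x ∈ V := by
  classical
  have : Fintype V := hV.fintype
  have : Fact (Nat.Prime 3) := ⟨Nat.prime_three⟩
  let f : Function.End V := fun y => ⟨r y, mem_of_mem_rotationGroup hr y.2⟩
  have hf : f ^ 3 ^ 1 = 1 := by
    funext y
    exact Subtype.ext (Equiv.congr_fun h3 (y : S2))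
  have hmod := Equiv.Perm.card_fixedPoints_modEq hf
  rw [← Nat.card_eq_fintype_card, Nat.card_coe_set_eq] at hmod
  have hpos : 0 < Fintype.card (Function.fixedPoints f) := by
    rw [Nat.ModEq, hc] at hmod
    by_contra h0
    rw [Nat.eq_zero_of_not_pos h0] at hmod
    norm_num at hmod
  obtain ⟨⟨y, hy⟩⟩ := Fintype.card_pos_iff.1 hpos
  have hy' : r y = y := congrArg Subtype.val hy
  by_contra hxV
  refine hne (rotation_eq_one hr.1 hx hy' (fun h => hxV (h ▸ y.2)) fun h => hxV (h ▸ hneg _ y.2))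

theorem exists_order_three {V : Set S2} (hV : ∀ v ∈ V, ∃ g ∈ rotationGroup V, g v = baseVertex b)
    (hW : quatRot b quatW ∈ rotationGroup V) {x : S2} (hx : x ∈ V) :
    ∃ r ∈ rotationGroup V, r ^ 3 = 1 ∧ r ≠ 1 ∧ r x = x := by
  obtain ⟨g, hg, hgx⟩ := hV x hx
  refine ⟨g⁻¹ * quatRot b quatW * g, mul_mem (mul_mem (inv_mem hg) hW) hg, ?_, fun h => ?_, ?_⟩
  · have := conj_pow (i := 3) (a := g⁻¹) (b := quatRot b quatW)
    rw [inv_inv] at this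
    rw [this, rotW_pow_three]
    simp
  · refine rotW_ne_one (b := b) ?_
    calc quatRot b quatW = g * (g⁻¹ * quatRot b quatW * g) * g⁻¹ := by group
      _ = 1 := by rw [h]; simp
  · simp only [Equiv.Perm.mul_apply, hgx, rotW_baseVertex]
    rw [← hgx]
    exact g.symm_apply_apply x

/-- The vertices are points on the axes of the rotations of order three, so the group determines the
dodecahedron. -/
theorem dodec_subset {b' : OrthonormalBasis (Fin 3) ℝ E3}
    (h : rotationGroup (dodec b) = rotationGroup (dodec b')) : dodec b ⊆ dodec b' := fun x hx => by
  obtain ⟨r, hr, h3, hne, hrx⟩ := exists_order_three dodec_regularVertex.transitive rotW_mem_dodec hx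
  exact mem_of_order_three dodec_finite.1 (by rw [dodec_ncard]) (fun _ => dodec_neg) (h ▸ hr) h3 hne hrx

theorem cube_subset {b' : OrthonormalBasis (Fin 3) ℝ E3}
    (h : rotationGroup (cube b) = rotationGroup (cube b')) : cube b ⊆ cube b' := fun x hx => by
  obtain ⟨r, hr, h3, hne, hrx⟩ := exists_order_three cube_regularVertex.transitive rotW_mem_cube hx
  exact mem_of_order_three cube_finite.1 (by rw [cube_ncard]) (fun _ => cube_neg) (h ▸ hr) h3 hne hrx

theorem not_le_of_card_lt {H K : Subgroup (Equiv.Perm S2)} [Finite H] (h : Nat.card H < Nat.card K) :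
    ¬ K ≤ H := fun hle =>
  absurd (Nat.le_of_dvd Nat.card_pos (Subgroup.card_dvd_of_le hle)) (not_le.2 h)

theorem dodec_of_tetra_le {V : Set S2} (hV : IsRegularDodecahedron V)
    (hG : rotationGroup (tetra b) ≤ rotationGroup V) :
    ∃ b', tetra b' = tetra b ∧ V = dodec b' := by
  obtain ⟨b₁, rfl⟩ := isRegularDodecahedron_iff.1 hV
  have := (dodec_simpleVertex (b := b₁)).finite_rotationGroup
  have := (tetra_simpleVertex (b := b)).finite_rotationGroup
  rcases octahedral_or_icosahedral_le (rotationGroup_le_rotations _) hG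
    (not_le_of_card_lt (by rw [card_tetra, card_dodec]; norm_num)) with h | ⟨b', hb, h⟩
  -- The octahedral alternative has no elements of order five.
  · exact absurd (h.2 _ rotP_mem_dodec rotP_pow_five) rotP_ne_one
  · have h1 := Subgroup.eq_of_le_of_card_ge h (by rw [card_dodec, card_dodec])
    exact ⟨b', hb, (dodec_subset h1.symm).antisymm (dodec_subset h1)⟩

theorem cube_of_tetra_le {V : Set S2} (hV : IsCube V)
    (hG : rotationGroup (tetra b) ≤ rotationGroup V) : V = cube b := by
  obtain ⟨b₁, rfl⟩ := isCube_iff.1 hV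
  have := (cube_simpleVertex (b := b₁)).finite_rotationGroup
  have := (tetra_simpleVertex (b := b)).finite_rotationGroup
  rcases octahedral_or_icosahedral_le (rotationGroup_le_rotations _) hG
    (not_le_of_card_lt (by rw [card_tetra, card_cube]; norm_num)) with h | ⟨b', hb, h⟩
  · have h1 := Subgroup.eq_of_le_of_card_ge h.1 (by rw [card_cube, card_cube])
    exact (cube_subset h1.symm).antisymm (cube_subset h1)
  · exact absurd h (not_le_of_card_lt (by rw [card_cube, card_dodec]; norm_num))

/-! ### The groups of linear fractional transformations that fix a finite set -/

theorem mem_fixingGroup_of_maps {α : Set S2} (hα : α.Finite) {g : Equiv.Perm S2}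
    (hg : g ∈ rotations) (h : ∀ x ∈ α, g x ∈ α) : g ∈ fixingGroup α :=
  ⟨rotations_le_linearFractional hg, (mem_rotationGroup_of_maps hα hg h).2⟩

theorem apply_mem_of_mem_fixingGroup {α : Set S2} {g : Equiv.Perm S2} (hg : g ∈ fixingGroup α)
    {x : S2} (hx : x ∈ α) : g x ∈ α := by
  have h : g '' α = α := hg.2
  rw [← h]; exact Set.mem_image_of_mem g hx

/-- A point on a coordinate axis is moved through all three axes by the cyclic rotation; any other
point and its images under the first two half-turns are distinct. -/
theorem exists_three_points {α : Set S2} (h : ∀ g ∈ rotationGroup (tetra b), ∀ x ∈ α, g x ∈ α)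
    (hne : α.Nonempty) : ∃ x ∈ α, ∃ y ∈ α, ∃ z ∈ α, x ≠ y ∧ x ≠ z ∧ y ≠ z := by
  obtain ⟨x, hx⟩ := hne
  obtain ⟨u, v, w, hc⟩ := exists_hasCoords (b := b) x
  have hI := h _ rotI_mem_tetra x hx
  have hJ := h _ rotJ_mem_tetra x hx
  have hW := h _ rotW_mem_tetra x hx
  have hWW := h _ rotW_mem_tetra _ hW
  have hsum := hc.sq_sum
  by_cases h1 : (v = 0 ∧ w = 0) ∨ (u = 0 ∧ w = 0) ∨ (u = 0 ∧ v = 0)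
  · refine ⟨_, hx, _, hW, _, hWW, fun h => ?_, fun h => ?_, fun h => ?_⟩
    · obtain ⟨e0, e1, e2⟩ := (h ▸ hc).inj hc.rotW
      rcases h1 with ⟨rfl, rfl⟩ | ⟨rfl, rfl⟩ | ⟨rfl, rfl⟩ <;> subst_vars <;> norm_num at hsum
    · obtain ⟨e0, e1, e2⟩ := (h ▸ hc).inj hc.rotW.rotW
      rcases h1 with ⟨rfl, rfl⟩ | ⟨rfl, rfl⟩ | ⟨rfl, rfl⟩ <;> subst_vars <;> norm_num at hsum
    · obtain ⟨e0, e1, e2⟩ := (h ▸ hc.rotW).inj hc.rotW.rotW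
      rcases h1 with ⟨rfl, rfl⟩ | ⟨rfl, rfl⟩ | ⟨rfl, rfl⟩ <;> subst_vars <;> norm_num at hsum
  · refine ⟨_, hx, _, hI, _, hJ, fun h => h1 ?_, fun h => h1 ?_, fun h => h1 ?_⟩
    · obtain ⟨e0, e1, e2⟩ := (h ▸ hc).inj hc.rotI
      exact Or.inl ⟨by linarith, by linarith⟩
    · obtain ⟨e0, e1, e2⟩ := (h ▸ hc).inj hc.rotJ
      exact Or.inr (Or.inl ⟨by linarith, by linarith⟩)
    · obtain ⟨e0, e1, e2⟩ := (h ▸ hc.rotI).inj hc.rotJ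
      exact Or.inr (Or.inr ⟨by linarith, by linarith⟩)

/-- With three points in α, an element is determined by its restriction to α. -/
theorem finite_fixingGroup {α : Set S2} (hα : α.Finite) {x y z : S2} (hx : x ∈ α) (hy : y ∈ α)
    (hz : z ∈ α) (hxy : x ≠ y) (hxz : x ≠ z) (hyz : y ≠ z) : Finite (fixingGroup α) := by
  have : Finite α := hα
  refine Finite.of_injective
    (fun g : fixingGroup α => fun a : α => (⟨g.1 a, apply_mem_of_mem_fixingGroup g.2 a.2⟩ : α)) ?_
  intro f g hfg
  have h : ∀ a ∈ α, (g⁻¹ * f).1 a = a := fun a ha => by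
    have h1 : f.1 a = g.1 a := congrArg Subtype.val (congrFun hfg ⟨a, ha⟩)
    change g.1⁻¹ (f.1 a) = a
    rw [h1]
    exact g.1.symm_apply_apply a
  have h2 := linearFractional_eq_one (g⁻¹ * f).2.1 (h x hx) (h y hy) (h z hz) hxy hxz hyz
  exact (inv_mul_eq_one.1 (Subtype.ext h2)).symm

theorem exists_moving (x : S2) : ∃ g ∈ rotationGroup (tetra b), g x ≠ x := by
  obtain ⟨u, v, w, hc⟩ := exists_hasCoords (b := b) x
  by_contra! h
  have hI := h _ rotI_mem_tetra
  have hJ := h _ rotJ_mem_tetra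
  obtain ⟨-, e1, e2⟩ := (hI ▸ hc.rotI).inj hc
  obtain ⟨e3, -, -⟩ := (hJ ▸ hc.rotJ).inj hc
  have hsum := hc.sq_sum
  nlinarith

theorem fixingGroup_eq_tetra_iff {α : Set S2} (hα : α.Finite) :
    fixingGroup α = rotationGroup (tetra b) ↔
      IsUnionOfElements (orbitFamily (tetra b)) α ∧
      (∀ VI : Set S2, IsRegularDodecahedron VI → rotationGroup (tetra b) ≤ rotationGroup VI →
        ¬ IsUnionOfElements (orbitFamily VI) α) ∧
      (∀ VO : Set S2, IsCube VO → rotationGroup (tetra b) ≤ rotationGroup VO →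
        ¬ IsUnionOfElements (orbitFamily VO) α) := by
  have := (tetra_simpleVertex (b := b)).finite_rotationGroup
  constructor
  · intro h
    refine ⟨?_, ?_, ?_⟩
    · rw [tetra_regularVertex.isUnionOfElements_iff, ← h]
      exact fun g hg x hx => apply_mem_of_mem_fixingGroup hg hx
    -- A union of icosahedral orbits would put sixty rotations into a group of order twelve.
    · intro VI hVI _ hu
      obtain ⟨b', rfl⟩ := isRegularDodecahedron_iff.1 hVI
      rw [dodec_regularVertex.isUnionOfElements_iff] at hu
      refine not_le_of_card_lt (H := rotationGroup (tetra b)) (K := rotationGroup (dodec b'))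
        (by rw [card_tetra, card_dodec]; norm_num) ?_
      rw [← h]
      exact fun g hg => mem_fixingGroup_of_maps hα hg.1 (hu g hg)
    · intro VO hVO _ hu
      obtain ⟨b', rfl⟩ := isCube_iff.1 hVO
      rw [cube_regularVertex.isUnionOfElements_iff] at hu
      refine not_le_of_card_lt (H := rotationGroup (tetra b)) (K := rotationGroup (cube b'))
        (by rw [card_tetra, card_cube]; norm_num) ?_
      rw [← h]
      exact fun g hg => mem_fixingGroup_of_maps hα hg.1 (hu g hg)
  · rintro ⟨hT, hI, hO⟩
    rw [tetra_regularVertex.isUnionOfElements_iff] at hT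
    have hG : rotationGroup (tetra b) ≤ fixingGroup α :=
      fun g hg => mem_fixingGroup_of_maps hα hg.1 (hT g hg)
    -- The empty set is a union of no orbits, which the condition on the cube `cube b` forbids.
    have hne : α.Nonempty := by
      rw [Set.nonempty_iff_ne_empty]
      rintro rfl
      exact hO _ (isCube_iff.2 ⟨b, rfl⟩) tetra_le_cube ⟨∅, Set.empty_subset _, by simp⟩
    obtain ⟨x, hx, y, hy, z, hz, hxy, hxz, hyz⟩ := exists_three_points hT hne
    have := finite_fixingGroup hα hx hy hz hxy hxz hyz
    have hrot : fixingGroup α ≤ rotations := finite_le_rotations inf_le_left fun x => by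
      obtain ⟨g, hg, hgx⟩ := exists_moving (b := b) x
      exact ⟨g, hG hg, hg.1, hgx⟩
    refine le_antisymm (by_contra fun hle => ?_) hG
    rcases octahedral_or_icosahedral_le hrot hG hle with h | ⟨b', hb, h⟩
    · refine hO _ (isCube_iff.2 ⟨b, rfl⟩) tetra_le_cube ?_
      rw [cube_regularVertex.isUnionOfElements_iff]
      exact fun g hg x hx => apply_mem_of_mem_fixingGroup (h.1 hg) hx
    · refine hI _ (isRegularDodecahedron_iff.2 ⟨b', rfl⟩) (hb ▸ tetra_le_dodec) ?_
      rw [dodec_regularVertex.isUnionOfElements_iff]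
      exact fun g hg x hx => apply_mem_of_mem_fixingGroup (h hg) hx

end

section

variable {b : OrthonormalBasis (Fin 3) ℝ E3}

/-! ### Decomposition of orbits -/

/-- The cosets G gⁱ for i < p are pairwise different by the hypothesis on powers, and since the
index is p they exhaust Γ. -/
theorem exists_mul_pow {Γ G : Subgroup (Equiv.Perm S2)} [Finite Γ] (hG : G ≤ Γ) {p : ℕ}
    (hc : Nat.card Γ = p * Nat.card G) {g : Equiv.Perm S2} (hg : g ∈ Γ)
    (hp : ∀ i < p, g ^ i ∈ G → i = 0) {k : Equiv.Perm S2} (hk : k ∈ Γ) :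
    ∃ i < p, ∃ s ∈ G, k = s * g ^ i := by
  have : Finite G := Finite.of_injective _ (Subgroup.inclusion_injective hG)
  let F : Fin p × G → Γ := fun x => ⟨x.2.1 * g ^ (x.1 : ℕ), mul_mem (hG x.2.2) (pow_mem hg _)⟩
  have hle : ∀ {x y : Fin p × G}, F x = F y → (x.1 : ℕ) ≤ y.1 → (x.1 : ℕ) = y.1 := by
    intro x y hxy h
    have h1 : x.2.1 * g ^ (x.1 : ℕ) = y.2.1 * g ^ (y.1 : ℕ) := congrArg Subtype.val hxy
    have h2 : g ^ ((y.1 : ℕ) - x.1) = y.2.1⁻¹ * x.2.1 := by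
      rw [pow_sub _ h, eq_inv_mul_iff_mul_eq, ← mul_assoc, ← h1, mul_inv_cancel_right]
    have h3 := hp _ (lt_of_le_of_lt (Nat.sub_le _ _) y.1.2)
      (h2 ▸ mul_mem (inv_mem y.2.2) x.2.2)
    omega
  have hF : Function.Injective F := by
    intro x y hxy
    have h1 : (x.1 : ℕ) = y.1 := by
      rcases le_total (x.1 : ℕ) y.1 with h | h
      · exact hle hxy h
      · exact (hle hxy.symm h).symm
    have h2 : x.2.1 * g ^ (x.1 : ℕ) = y.2.1 * g ^ (y.1 : ℕ) := congrArg Subtype.val hxy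
    rw [h1] at h2
    exact Prod.ext (Fin.ext h1) (Subtype.ext (mul_right_cancel h2))
  have hb := hF.bijective_of_nat_card_le (by
    rw [hc, Nat.card_prod, Nat.card_fin])
  obtain ⟨x, hx⟩ := hb.2 ⟨k, hk⟩
  exact ⟨x.1, x.1.2, x.2.1, x.2.2, (congrArg Subtype.val hx).symm⟩

theorem mem_rotOrbit_iff_exists_pow {V W : Set S2} [Finite (rotationGroup W)]
    (hG : rotationGroup V ≤ rotationGroup W) {p : ℕ}
    (hc : Nat.card (rotationGroup W) = p * Nat.card (rotationGroup V)) {g : Equiv.Perm S2}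
    (hg : g ∈ rotationGroup W) (hp : ∀ i < p, g ^ i ∈ rotationGroup V → i = 0) {X Y : S2} :
    Y ∈ rotOrbit W X ↔ ∃ i < p, Y ∈ rotOrbit V ((g ^ i) X) := by
  simp only [mem_rotOrbit]
  constructor
  · rintro ⟨k, hk, rfl⟩
    obtain ⟨i, hi, s, hs, rfl⟩ := exists_mul_pow hG hc hg hp hk
    exact ⟨i, hi, s, hs, rfl⟩
  · rintro ⟨i, -, s, hs, rfl⟩
    exact ⟨s * g ^ i, mul_mem (hG hs) (pow_mem hg i), rfl⟩

theorem rotP_pow_not_mem {i : ℕ} (hi : i < 5)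
    (h : quatRot b quatP ^ i ∈ rotationGroup (tetra b)) : i = 0 := by
  have := (tetra_simpleVertex (b := b)).finite_rotationGroup
  by_contra h0
  -- An inverse of i modulo 5 recovers the rotation itself from its power, and 5 does not divide 12.
  obtain ⟨j, hj⟩ : ∃ j, i * j % 5 = 1 := by
    interval_cases i
    exacts [absurd rfl h0, ⟨1, rfl⟩, ⟨3, rfl⟩, ⟨2, rfl⟩, ⟨4, rfl⟩]
  have h1 := pow_mem h j
  rw [← pow_mul, ← pow_mod_orderOf, orderOf_rotP, hj, pow_one] at h1
  have h2 := Subgroup.orderOf_dvd_natCard _ h1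
  rw [orderOf_rotP, card_tetra] at h2
  norm_num at h2

theorem rotOrbit_dodec (X : S2) : rotOrbit (dodec b) X = rotOrbit (tetra b) X ∪
    rotOrbit (tetra b) (quatRot b quatP X) ∪ rotOrbit (tetra b) ((quatRot b quatP ^ 2) X) ∪
    rotOrbit (tetra b) ((quatRot b quatP ^ 3) X) ∪
    rotOrbit (tetra b) ((quatRot b quatP ^ 4) X) := by
  have := (dodec_simpleVertex (b := b)).finite_rotationGroup
  ext Y
  rw [mem_rotOrbit_iff_exists_pow tetra_le_dodec (p := 5) (by rw [card_tetra, card_dodec])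
    rotP_mem_dodec (fun i hi h => rotP_pow_not_mem hi h)]
  constructor
  · rintro ⟨i, hi, h⟩
    interval_cases i
    · exact Or.inl (Or.inl (Or.inl (Or.inl h)))
    · exact Or.inl (Or.inl (Or.inl (Or.inr h)))
    · exact Or.inl (Or.inl (Or.inr h))
    · exact Or.inl (Or.inr h)
    · exact Or.inr h
  · rintro ((((h | h) | h) | h) | h)
    exacts [⟨0, by norm_num, h⟩, ⟨1, by norm_num, h⟩, ⟨2, by norm_num, h⟩, ⟨3, by norm_num, h⟩,
      ⟨4, by norm_num, h⟩]

theorem rotOrbit_cube (X : S2) :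
    rotOrbit (cube b) X = rotOrbit (tetra b) X ∪ rotOrbit (tetra b) (quatRot b quatO X) := by
  have := (cube_simpleVertex (b := b)).finite_rotationGroup
  ext Y
  rw [mem_rotOrbit_iff_exists_pow tetra_le_cube (p := 2) (by rw [card_tetra, card_cube])
    rotO_mem_cube (fun i hi h => by
      interval_cases i
      exacts [rfl, absurd h rotO_not_mem_tetra])]
  constructor
  · rintro ⟨i, hi, h⟩
    interval_cases i
    exacts [Or.inl h, Or.inr h]
  · rintro (h | h)
    exacts [⟨0, by norm_num, h⟩, ⟨1, by norm_num, h⟩]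

theorem RegularVertex.mem_specialPoints_of_apply {V : Set S2} {A : S2} {B : Fin 3 → S2}
    {n : Fin 3 → E3} {c : Fin 3 → ℝ} (h : RegularVertex V A B n c) {g : Equiv.Perm S2}
    (hg : g ∈ rotationGroup V) {X : S2} (hX : g X ∈ specialPoints V) : X ∈ specialPoints V := by
  have key : ∀ {S : Set S2}, S = rotOrbit V (g X) → X ∈ S := fun hS => by
    rw [hS, rotOrbit_apply hg]
    exact mem_rotOrbit_self V X
  rcases hX with (hX | hX) | hX
  · exact Or.inl (Or.inl (key (h.eq_rotOrbit hX)))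
  · exact Or.inl (Or.inr (key (h.faceCentres_eq_rotOrbit hX)))
  · exact Or.inr (key (h.edgeMidpoints_eq_rotOrbit hX))

/-! ### Projections of midpoints and centres -/

theorem exists_radialProj {p : E3} (hp : p ≠ 0) : ∃ x, IsRadialProj p x := by
  have h := norm_pos_iff.2 hp
  refine ⟨⟨‖p‖⁻¹ • p, ?_⟩, ‖p‖, h, ?_⟩
  · rw [mem_sphere_zero_iff_norm, norm_smul, norm_inv, norm_norm, inv_mul_cancel₀ h.ne']
  · exact (smul_inv_smul₀ h.ne' p).symm

theorem isRadialProj_of_coords {p : E3} {x : S2} {u v w r : ℝ} (hx : HasCoords b x u v w)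
    (hr : 0 < r) (h0 : b.repr p 0 = r * (u * (1 / √3))) (h1 : b.repr p 1 = r * (v * (1 / √3)))
    (h2 : b.repr p 2 = r * (w * (1 / √3))) : IsRadialProj p x :=
  ⟨r, hr, vec_ext b (by rw [h0, ← hx.1]; simp) (by rw [h1, ← hx.2.1]; simp)
    (by rw [h2, ← hx.2.2]; simp)⟩

theorem midpoint_radialProj {g : Equiv.Perm S2} (hg : g ∈ rotations) {P Q P' Q' x : S2}
    (hP : g P = P') (hQ : g Q = Q') (h : IsRadialProj (midpoint ℝ (P : E3) (Q : E3)) x) :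
    IsRadialProj (midpoint ℝ (P' : E3) (Q' : E3)) (g x) := by
  obtain ⟨R, -, hR⟩ := hg
  rw [← hP, ← hQ, midpoint_image hR]
  exact isRadialProj_image hR h

theorem midpoint_coord (x y : E3) (i : Fin 3) :
    b.repr (midpoint ℝ x y) i = (b.repr x i + b.repr y i) / 2 := by
  rw [midpoint_eq_smul_add]
  simp
  ring

theorem faceCentre_range {n : ℕ} {a : Fin n → S2} (ha : Function.Injective a) :
    faceCentre (Set.range a) = (n : ℝ)⁻¹ • ∑ i, (a i : E3) := by
  rw [faceCentre, finsum_mem_range ha, finsum_eq_sum_of_fintype, ← Set.image_univ,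
    Set.ncard_image_of_injective _ ha, Set.ncard_univ, Nat.card_eq_fintype_card, Fintype.card_fin]

theorem faceCentre_radialProj {F : Set S2} (hF : F.Finite) {g : Equiv.Perm S2} (hg : g ∈ rotations)
    (hgF : g '' F = F) {x : S2} (h : IsRadialProj (faceCentre F) x) : g x = x := by
  obtain ⟨R, -, hR⟩ := hg
  have h1 := isRadialProj_image hR h
  rw [← faceCentre_image hF hR, hgF] at h1
  exact h1.unique h

/-! ### The special points of the tetrahedron -/

theorem sqrt_three_sq : √3 ^ 2 = 3 := Real.sq_sqrt (by norm_num)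

/-- The point on the third coordinate axis. -/
noncomputable def polePt (b : OrthonormalBasis (Fin 3) ℝ E3) : S2 :=
  vertexPt b 0 0 √3 (by rw [sqrt_three_sq]; norm_num)

theorem polePt_coords : HasCoords b (polePt b) 0 0 √3 :=
  vertexPt_coords _ _ _ (by rw [sqrt_three_sq]; norm_num)

theorem polePt_mem_edgeMidpoints_tetra : polePt b ∈ edgeMidpoints (tetra b) := by
  refine ⟨_, _, tetra_simpleVertex.isEdge 2, ?_⟩
  have hA := baseVertex_coords (b := b)
  have hB := tetraNbr_coords (b := b) 2
  simp at hB
  have h3 : (√3)⁻¹ * √3 = 1 := inv_mul_cancel₀ (by positivity)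
  refine isRadialProj_of_coords polePt_coords (r := (√3)⁻¹) (by positivity) ?_ ?_ ?_ <;>
    rw [midpoint_coord]
  · rw [hA.1, hB.1]; ring
  · rw [hA.2.1, hB.2.1]; ring
  · rw [hA.2.2, hB.2.2, ← mul_assoc, h3]; ring

theorem neg_tetraNbr_mem_faceCentres : -tetraNbr b 0 ∈ faceCentres (tetra b) := by
  have h := tetra_simpleVertex (b := b)
  refine ⟨_, h.isFace 0, ?_⟩
  have hA := baseVertex_coords (b := b)
  have hB := fun i => tetraNbr_coords (b := b) i
  have hF : {v ∈ tetra b | inner ℝ (coordVec b ((!![-1, 1, 1; 1, -1, 1; 1, 1, -1] :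
      Matrix (Fin 3) (Fin 3) ℝ) 0)) (v : E3) = 1 * (1 / √3)}
      = Set.range ![baseVertex b, tetraNbr b 1, tetraNbr b 2] := by
    ext x
    simp only [Matrix.range_cons, Matrix.range_empty, Set.union_empty, Set.mem_union,
      Set.mem_singleton_iff]
    constructor
    · rintro ⟨hx, he⟩
      obtain ⟨u, v, w, hc⟩ := exists_hasCoords (b := b) x
      rw [inner_coordVec hc, mul_left_inj' inv_sqrt_three_pos.ne'] at he
      rw [hc.mem_tetra] at hx
      rcases hx with ⟨rfl, rfl, rfl⟩ | ⟨rfl, rfl, rfl⟩ | ⟨rfl, rfl, rfl⟩ | ⟨rfl, rfl, rfl⟩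
      · exact Or.inl (hc.ext hA rfl rfl rfl)
      · exact absurd he (by simp; norm_num)
      · exact Or.inr (Or.inl (hc.ext (hB 1) rfl rfl rfl))
      · exact Or.inr (Or.inr (hc.ext (hB 2) rfl rfl rfl))
    · rintro (rfl | rfl | rfl)
      exacts [⟨h.mem_A, h.eq_A 0⟩, ⟨h.mem_B 1, h.eq_B 0 1 (by decide)⟩,
        ⟨h.mem_B 2, h.eq_B 0 2 (by decide)⟩]
  have hinj : Function.Injective ![baseVertex b, tetraNbr b 1, tetraNbr b 2] := by
    intro i j hij
    have h1 := h.B_ne_A 1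
    have h2 := h.B_ne_A 2
    have h3 : tetraNbr b 1 ≠ tetraNbr b 2 := h.B_injective.ne (by decide)
    fin_cases i <;> fin_cases j <;> first | rfl | (exfalso; simp at hij; tauto)
  rw [hF, faceCentre_range hinj]
  refine isRadialProj_of_coords (hB 0).neg (r := 1 / 3) (by norm_num) ?_ ?_ ?_
  · simp [Fin.sum_univ_three, hA.1, (hB 1).1, (hB 2).1]
  · simp [Fin.sum_univ_three, hA.2.1, (hB 1).2.1, (hB 2).2.1]
  · simp [Fin.sum_univ_three, hA.2.2, (hB 1).2.2, (hB 2).2.2]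

/-- One face centre is the antipode of the opposite vertex, and rotations commute with the antipodal
map. -/
theorem mem_faceCentres_tetra {x : S2} : x ∈ faceCentres (tetra b) ↔ -x ∈ tetra b := by
  have h := tetra_regularVertex (b := b)
  rw [h.faceCentres_eq_rotOrbit neg_tetraNbr_mem_faceCentres, mem_rotOrbit]
  conv_rhs => rw [h.eq_rotOrbit (h.mem_B 0), mem_rotOrbit]
  refine exists_congr fun g => and_congr_right fun hg => ?_
  rw [rotation_neg hg.1]
  exact neg_eq_iff_eq_neg

/-- The coordinates of the special points of a tetrahedron, up to a factor, satisfy this. -/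
def IsSpecialTriple (u v w : ℝ) : Prop :=
  (u ^ 2 = v ^ 2 ∧ v ^ 2 = w ^ 2) ∨ (u * v = 0 ∧ v * w = 0 ∧ u * w = 0)

theorem isSpecialTriple_smul {r u v w : ℝ} (hr : r ≠ 0) :
    IsSpecialTriple (r * u) (r * v) (r * w) ↔ IsSpecialTriple u v w := by
  have h1 : ∀ x y : ℝ, (r * x) ^ 2 = (r * y) ^ 2 ↔ x ^ 2 = y ^ 2 := fun x y => by
    rw [mul_pow, mul_pow, mul_right_inj' (pow_ne_zero 2 hr)]
  have h2 : ∀ x y : ℝ, r * x * (r * y) = 0 ↔ x * y = 0 := fun x y => by simp [hr]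
  simp only [IsSpecialTriple, h1, h2]

/-- The condition is homogeneous, so it can be tested on p before projection. Only this direction is
needed, to show that points are not special. -/
theorem isSpecialTriple_of_mem {p : E3} {x : S2} (hp : IsRadialProj p x)
    (hx : x ∈ specialPoints (tetra b)) :
    IsSpecialTriple (b.repr p 0) (b.repr p 1) (b.repr p 2) := by
  have key : ∀ {p : E3} {x : S2}, IsRadialProj p x →
      (IsSpecialTriple (b.repr p 0) (b.repr p 1) (b.repr p 2) ↔
      IsSpecialTriple (b.repr x 0) (b.repr x 1) (b.repr x 2)) := by
    rintro p x ⟨r, hr, rfl⟩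
    simp only [map_smul, PiLp.smul_apply, smul_eq_mul, isSpecialTriple_smul hr.ne']
  have key2 : ∀ {x : S2} {u v w : ℝ}, HasCoords b x u v w →
      (IsSpecialTriple (b.repr x 0) (b.repr x 1) (b.repr x 2) ↔ IsSpecialTriple u v w) := by
    intro x u v w hc
    rw [hc.1, hc.2.1, hc.2.2, mul_comm u, mul_comm v, mul_comm w,
      isSpecialTriple_smul inv_sqrt_three_pos.ne']
  rw [key hp]
  obtain ⟨u, v, w, hc⟩ := exists_hasCoords (b := b) x
  rcases hx with (hx | hx) | ⟨P, Q, hPQ, hx⟩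
  · rw [key2 hc]
    rw [hc.mem_tetra] at hx
    rcases hx with ⟨rfl, rfl, rfl⟩ | ⟨rfl, rfl, rfl⟩ | ⟨rfl, rfl, rfl⟩ | ⟨rfl, rfl, rfl⟩ <;>
      exact Or.inl (by norm_num)
  · rw [key2 hc]
    rw [mem_faceCentres_tetra, hc.neg.mem_tetra] at hx
    simp only [neg_eq_iff_eq_neg, neg_neg] at hx
    rcases hx with ⟨rfl, rfl, rfl⟩ | ⟨rfl, rfl, rfl⟩ | ⟨rfl, rfl, rfl⟩ | ⟨rfl, rfl, rfl⟩ <;>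
      exact Or.inl (by norm_num)
  · rw [← key hx]
    simp only [midpoint_coord]
    obtain ⟨u, v, w, hc⟩ := exists_hasCoords (b := b) P
    obtain ⟨u', v', w', hc'⟩ := exists_hasCoords (b := b) Q
    have hP := hPQ.mem_left
    have hQ := hPQ.symm.mem_left
    have hne := hPQ.1
    rw [hc.mem_tetra] at hP
    rw [hc'.mem_tetra] at hQ
    rw [hc.1, hc.2.1, hc.2.2, hc'.1, hc'.2.1, hc'.2.2]
    rcases hP with ⟨rfl, rfl, rfl⟩ | ⟨rfl, rfl, rfl⟩ | ⟨rfl, rfl, rfl⟩ | ⟨rfl, rfl, rfl⟩ <;>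
    rcases hQ with ⟨rfl, rfl, rfl⟩ | ⟨rfl, rfl, rfl⟩ | ⟨rfl, rfl, rfl⟩ | ⟨rfl, rfl, rfl⟩ <;>
      first
      | exact absurd (hc.ext hc' rfl rfl rfl) hne
      | exact Or.inr (by norm_num)

end

section

variable {b : OrthonormalBasis (Fin 3) ℝ E3}

/-! ### Coordinates adapted to a labelled face -/

theorem apply_mem_iff {V : Set S2} {g : Equiv.Perm S2} (hg : g ∈ rotationGroup V) {x : S2} :
    g x ∈ V ↔ x ∈ V :=
  ⟨fun h => by simpa using mem_of_mem_rotationGroup (inv_mem hg) h, mem_of_mem_rotationGroup hg⟩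

/-- The frame is moved instead of the points: a labelled configuration is brought to standard
position while the polyhedra stay the same sets. -/
theorem exists_basis_apply {g : Equiv.Perm S2} (hg : g ∈ rotationGroup (tetra b)) :
    ∃ b', tetra b' = tetra b ∧ cube b' = cube b ∧ dodec b' = dodec b ∧
      ∀ x u v w, HasCoords b' x u v w ↔ HasCoords b (g x) u v w := by
  obtain ⟨R, -, hR⟩ := hg.1
  have h : ∀ (x : S2) i, (b.map R.symm).repr x i = b.repr (g x) i := fun x i => by
    rw [hR]; rfl
  refine ⟨b.map R.symm, ?_, ?_, ?_, fun x u v w => by simp only [HasCoords, h]⟩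
  · ext x
    rw [← apply_mem_iff hg]
    simp only [tetra, Set.mem_ofPred_eq, h]
  · ext x
    rw [← apply_mem_iff (tetra_le_cube hg)]
    simp only [cube, Set.mem_ofPred_eq, h]
  · ext x
    rw [← apply_mem_iff (tetra_le_dodec hg)]
    simp only [dodec, Set.mem_ofPred_eq, h]

/-- G is transitive on the vertices of the tetrahedron, and its rotation of order three about the
base vertex cycles the neighbours of this vertex in the larger polyhedron. -/
theorem exists_normalizing {V : Set S2} {Nb : Fin 3 → S2} {n : Fin 3 → E3} {c : Fin 3 → ℝ}
    (hV : SimpleVertex V (baseVertex b) Nb n c) (hW : ∀ i, quatRot b quatW (Nb i) = Nb (i + 1))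
    (hG : rotationGroup (tetra b) ≤ rotationGroup V) {A B : S2} (hA : A ∈ tetra b)
    (hAB : IsEdge V A B) :
    ∃ g ∈ rotationGroup (tetra b), g A = baseVertex b ∧ g B = Nb 0 := by
  obtain ⟨g, hg, hgA⟩ := tetra_regularVertex.transitive A hA
  have h1 := isEdge_image (hG hg) hAB
  rw [hgA] at h1
  obtain ⟨m, hm⟩ := hV.edge_at h1
  have hWT := rotW_mem_tetra (b := b)
  have hWb := rotW_baseVertex (b := b)
  fin_cases m
  · exact ⟨g, hg, hgA, hm⟩
  · refine ⟨quatRot b quatW * (quatRot b quatW * g), mul_mem hWT (mul_mem hWT hg), ?_, ?_⟩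
    · simp only [Equiv.Perm.mul_apply, hgA, hWb]
    · simp only [Equiv.Perm.mul_apply, hm, hW]
      rfl
  · refine ⟨quatRot b quatW * g, mul_mem hWT hg, ?_, ?_⟩
    · simp only [Equiv.Perm.mul_apply, hgA, hWb]
    · simp only [Equiv.Perm.mul_apply, hm, hW]
      rfl

theorem rotW_dodecNbr (i : Fin 3) : quatRot b quatW (dodecNbr b i) = dodecNbr b (i + 1) := by
  refine (dodecNbr_coords i).rotW.ext (dodecNbr_coords (i + 1)) ?_ ?_ ?_ <;> fin_cases i <;> rfl

theorem rotW_cubeNbr (i : Fin 3) : quatRot b quatW (cubeNbr b i) = cubeNbr b (i + 1) := by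
  refine (cubeNbr_coords i).rotW.ext (cubeNbr_coords (i + 1)) ?_ ?_ ?_ <;> fin_cases i <;> rfl

theorem RegularVertex.edge_inner {V : Set S2} {A : S2} {B : Fin 3 → S2} {n : Fin 3 → E3}
    {c : Fin 3 → ℝ} (h : RegularVertex V A B n c) {X Y : S2} (hXY : IsEdge V X Y) :
    inner ℝ (X : E3) (Y : E3) = inner ℝ (A : E3) (B 0 : E3) := by
  obtain ⟨g, hg, h1, h2⟩ := h.edge_transport hXY 0
  rw [← h1, ← h2, rotation_inner hg.1]

theorem dodec_edge_inner {X Y : S2} {u v w u' v' w' : ℝ} (hXY : IsEdge (dodec b) X Y)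
    (hX : HasCoords b X u v w) (hY : HasCoords b Y u' v' w') :
    u * u' + v * v' + w * w' = 2 * φ - 1 := by
  have h := dodec_regularVertex.edge_inner hXY
  rw [hX.inner hY, baseVertex_coords.inner (dodecNbr_coords 0)] at h
  simp at h
  linarith

theorem cube_edge_inner {X Y : S2} {u v w u' v' w' : ℝ} (hXY : IsEdge (cube b) X Y)
    (hX : HasCoords b X u v w) (hY : HasCoords b Y u' v' w') :
    u * u' + v * v' + w * w' = 1 := by
  have h := cube_regularVertex.edge_inner hXY
  rw [hX.inner hY, baseVertex_coords.inner (cubeNbr_coords 0)] at h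
  simp at h
  linarith

theorem mem_dodec_face {x : S2} {u v w : ℝ} (hx : HasCoords b x u v w) (k : Fin 3) :
    x ∈ {v ∈ dodec b | inner ℝ (coordVec b ((!![φ, 1, 0; 0, φ, 1; 1, 0, φ] :
      Matrix (Fin 3) (Fin 3) ℝ) k)) (v : E3) = (φ + 1) * (1 / √3)} ↔
    x ∈ dodec b ∧ ![φ * u + v, φ * v + w, u + φ * w] k = φ + 1 := by
  rw [Set.mem_ofPred_eq, inner_coordVec hx, mul_left_inj' inv_sqrt_three_pos.ne']
  refine and_congr_right fun _ => ?_
  fin_cases k <;> simp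

theorem mem_cube_face {x : S2} {u v w : ℝ} (hx : HasCoords b x u v w) (k : Fin 3) :
    x ∈ {v ∈ cube b | inner ℝ (coordVec b ((!![1, 0, 0; 0, 1, 0; 0, 0, 1] :
      Matrix (Fin 3) (Fin 3) ℝ) k)) (v : E3) = 1 * (1 / √3)} ↔
    x ∈ cube b ∧ ![u, v, w] k = 1 := by
  rw [Set.mem_ofPred_eq, inner_coordVec hx, mul_left_inj' inv_sqrt_three_pos.ne']
  refine and_congr_right fun _ => ?_
  fin_cases k <;> simp

/-- The vertices of a face of the dodecahedron in standard position. -/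
structure PentagonCoords (b : OrthonormalBasis (Fin 3) ℝ E3) (A B C D E : S2) : Prop where
  hA : HasCoords b A 1 1 1
  hB : HasCoords b B 0 (φ - 1) φ
  hC : HasCoords b C 0 (-(φ - 1)) φ
  hD : HasCoords b D 1 (-1) 1
  hE : HasCoords b E φ 0 (φ - 1)

/-- The vertices of a face of the cube in standard position. -/
structure SquareCoords (b : OrthonormalBasis (Fin 3) ℝ E3) (A B C D : S2) : Prop where
  hA : HasCoords b A 1 1 1
  hB : HasCoords b B (-1) 1 1
  hC : HasCoords b C (-1) (-1) 1
  hD : HasCoords b D 1 (-1) 1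

theorem axis_of_mem_edgeMidpoints {p : E3} {x : S2} (hx : x ∈ edgeMidpoints (tetra b))
    (hp : IsRadialProj p x) :
    b.repr p 0 * b.repr p 1 = 0 ∧ b.repr p 1 * b.repr p 2 = 0 ∧ b.repr p 0 * b.repr p 2 = 0 := by
  obtain ⟨P, Q, hPQ, hx⟩ := hx
  obtain ⟨r, hr, h1⟩ := hp
  obtain ⟨s, hs, h2⟩ := hx
  have h3 : p = (r * s⁻¹) • midpoint ℝ (P : E3) (Q : E3) := by
    rw [h2, mul_smul, inv_smul_smul₀ hs.ne', h1]
  have key : ∀ t : ℝ, ∀ i j, b.repr (midpoint ℝ (P : E3) (Q : E3)) i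
      * b.repr (midpoint ℝ (P : E3) (Q : E3)) j = 0 →
      b.repr (t • midpoint ℝ (P : E3) (Q : E3)) i * b.repr (t • midpoint ℝ (P : E3) (Q : E3)) j
        = 0 := fun t i j h => by
    simp only [map_smul, PiLp.smul_apply, smul_eq_mul]
    linear_combination t ^ 2 * h
  rw [h3]
  obtain ⟨u, v, w, hc⟩ := exists_hasCoords (b := b) P
  obtain ⟨u', v', w', hc'⟩ := exists_hasCoords (b := b) Q
  have hP := hPQ.mem_left
  have hQ := hPQ.symm.mem_left
  have hne := hPQ.1
  rw [hc.mem_tetra] at hP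
  rw [hc'.mem_tetra] at hQ
  have h4 : (u + u') * (v + v') = 0 ∧ (v + v') * (w + w') = 0 ∧ (u + u') * (w + w') = 0 := by
    rcases hP with ⟨rfl, rfl, rfl⟩ | ⟨rfl, rfl, rfl⟩ | ⟨rfl, rfl, rfl⟩ | ⟨rfl, rfl, rfl⟩ <;>
    rcases hQ with ⟨rfl, rfl, rfl⟩ | ⟨rfl, rfl, rfl⟩ | ⟨rfl, rfl, rfl⟩ | ⟨rfl, rfl, rfl⟩ <;>
      first
      | exact absurd (hc.ext hc' rfl rfl rfl) hne
      | norm_num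
  refine ⟨key _ _ _ ?_, key _ _ _ ?_, key _ _ _ ?_⟩ <;>
    simp only [midpoint_coord, hc.1, hc.2.1, hc.2.2, hc'.1, hc'.2.1, hc'.2.2]
  · linear_combination (1 / √3) ^ 2 / 4 * h4.1
  · linear_combination (1 / √3) ^ 2 / 4 * h4.2.1
  · linear_combination (1 / √3) ^ 2 / 4 * h4.2.2

/-- Once the edge AB is standard, two faces remain. The condition on the middle point of BC forces
C, which selects one of them; its equation and adjacency then determine D and E. -/
theorem exists_pentagonCoords {A B C D E : S2}
    (h : IsPentagonLabelling (tetra b) (dodec b) A B C D E) :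
    ∃ b', tetra b' = tetra b ∧ dodec b' = dodec b ∧ PentagonCoords b' A B C D E := by
  obtain ⟨g, hg, hgA, hgB⟩ := exists_normalizing dodec_simpleVertex rotW_dodecNbr tetra_le_dodec
    h.mem_A h.edge_AB
  obtain ⟨b', hT, -, hI, hc⟩ := exists_basis_apply hg
  refine ⟨b', hT, hI, ?_⟩
  have hA : HasCoords b' A 1 1 1 := (hc _ _ _ _).2 (hgA ▸ baseVertex_coords)
  have hB : HasCoords b' B 0 (φ - 1) φ := (hc _ _ _ _).2 (hgB ▸ dodecNbr_coords 0)
  rw [← hT, ← hI] at h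
  clear hc hgA hgB hg hT hI
  have hs := golden_sq
  have hgt := golden_gt
  have hlt := golden_lt
  have hA' : A = baseVertex b' := hA.ext baseVertex_coords rfl rfl rfl
  obtain ⟨u, v, w, hC⟩ := exists_hasCoords (b := b') C
  have hBC := dodec_edge_inner h.edge_BC hB hC
  have hCs := hC.sq_sum
  obtain ⟨x, hx, hxp⟩ := h.mid_BC
  obtain ⟨e0, e1, e2⟩ := axis_of_mem_edgeMidpoints hx hxp
  simp only [midpoint_coord, hB.1, hB.2.1, hB.2.2, hC.1, hC.2.1, hC.2.2] at e0 e1 e2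
  have key : ∀ p q r s : ℝ, (p * (1 / √3) + q * (1 / √3)) / 2 * ((r * (1 / √3) + s * (1 / √3)) / 2)
      = 0 → p + q = 0 ∨ r + s = 0 := fun p q r s h => by
    have h0 := inv_sqrt_three_pos.ne'
    rw [← mul_eq_zero, ← mul_right_inj' (mul_ne_zero h0 h0)]
    linear_combination 4 * h
  -- The sum B + C lies on a coordinate axis, so it has two vanishing coordinates. The edge length
  -- of BC and the norm of C leave only one solution.
  have hC' : HasCoords b' C 0 (-(φ - 1)) φ := by
    rcases key _ _ _ _ e1 with h1 | h1
    · rcases key _ _ _ _ e2 with h2 | h2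
      · have h3 : w = φ := by
          obtain rfl : v = -(φ - 1) := by linarith
          have h4 : φ * (w - φ) = 0 := by linear_combination hBC
          rcases mul_eq_zero.1 h4 with h5 | h5 <;> linarith
        exact hC.congr (by linarith) (by linarith) h3
      · obtain rfl : v = -(φ - 1) := by linarith
        obtain rfl : w = -φ := by linarith
        nlinarith
    · obtain rfl : w = -φ := by linarith
      rcases key _ _ _ _ e0 with h2 | h2
      · obtain rfl : u = 0 := by linarith
        nlinarith
      · obtain rfl : v = -(φ - 1) := by linarith
        nlinarith
  clear hC hBC hCs e0 e1 e2 hx hxp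
  have hsimple := dodec_simpleVertex (b := b')
  obtain ⟨k, hk⟩ := hsimple.face_at h.face (by rw [hA']; exact Set.mem_insert _ _)
  have hface : ∀ {y u v w}, HasCoords b' y u v w → (y ∈ ({A, B, C, D, E} : Set S2) ↔
      y ∈ dodec b' ∧ ![φ * u + v, φ * v + w, u + φ * w] k = φ + 1) := fun hy => by
    rw [hk]; exact mem_dodec_face hy k
  have hBf := ((hface hB).1 (by simp)).2
  have hCf := ((hface hC').1 (by simp)).2
  obtain rfl : k = 2 := by
    fin_cases k
    · simp at hBf
      linarith
    · simp at hCf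
      nlinarith
    · rfl
  obtain ⟨m, hm⟩ := hsimple.edge_at (hA' ▸ h.edge_EA.symm)
  have hE1 : HasCoords b' (dodecNbr b' 1) φ 0 (φ - 1) := dodecNbr_coords 1
  have hD1 : HasCoords b' (vertexPt b' 1 (-1) 1 (by norm_num)) 1 (-1) 1 := vertexPt_coords _ _ _ _
  have hEmem := (hface hE1).2 ⟨hsimple.mem_B 1, by simp; linarith⟩
  have hDmem := (hface hD1).2 ⟨hD1.mem_dodec.2 (by simp), by simp; linarith⟩
  -- Adjacency to A does not yet exclude E = B. That is excluded below, since the known point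
  -- `dodecNbr b' 1` of the face must occur among the five labels.
  have hEBE : E = B ∨ E = dodecNbr b' 1 := by
    fin_cases m
    · exact Or.inl (hm.trans ((dodecNbr_coords 0).ext hB rfl rfl rfl))
    · exact Or.inr hm
    · exfalso
      have hE2 : HasCoords b' E (φ - 1) φ 0 := hm ▸ dodecNbr_coords 2
      have := ((hface hE2).1 (by simp)).2
      simp at this
      linarith
  have hne : ∀ {y z : S2} {u v w u' v' w' : ℝ}, HasCoords b' y u v w → HasCoords b' z u' v' w' →
      y = z → u = u' ∧ v = v' ∧ w = w' := fun hy hz hyz => hy.inj (hyz ▸ hz)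
  have hD' : D = vertexPt b' 1 (-1) 1 (by norm_num) := by
    rcases hDmem with h1 | h1 | h1 | h1 | h1
    · have := (hne hD1 hA h1).2.1; norm_num at this
    · have := (hne hD1 hB h1).1; norm_num at this
    · have := (hne hD1 hC' h1).1; norm_num at this
    · exact h1.symm
    · rcases hEBE with h2 | h2
      · have := (hne hD1 hB (h1.trans h2)).1; norm_num at this
      · have := (hne hD1 hE1 (h1.trans h2)).2.1; norm_num at this
  have hE' : E = dodecNbr b' 1 := by
    rcases hEmem with h1 | h1 | h1 | h1 | h1
    · have := (hne hE1 hA h1).2.1; norm_num at this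
    · have := (hne hE1 hB h1).1; linarith
    · have := (hne hE1 hC' h1).1; linarith
    · have := (hne hE1 hD1 (h1.trans hD')).2.1; norm_num at this
    · exact h1.symm
  exact ⟨hA, hB, hC', hD' ▸ hD1, hE' ▸ hE1⟩

/-- The two faces along AB are exchanged by exchanging the last two coordinates. This preserves the
tetrahedron and the cube, so one face suffices. -/
theorem exists_squareCoords {A B C D : S2}
    (h : IsSquareLabelling (tetra b) (cube b) A B C D) :
    ∃ b', tetra b' = tetra b ∧ cube b' = cube b ∧ SquareCoords b' A B C D := by
  have aux : ∀ b' : OrthonormalBasis (Fin 3) ℝ E3, HasCoords b' A 1 1 1 → HasCoords b' B (-1) 1 1 →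
      IsSquareLabelling (tetra b') (cube b') A B C D → (∀ {y u v w}, HasCoords b' y u v w →
        (y ∈ ({A, B, C, D} : Set S2) ↔ y ∈ cube b' ∧ w = 1)) → SquareCoords b' A B C D := by
    intro b' hA hB h hface
    have hA' : A = baseVertex b' := hA.ext baseVertex_coords rfl rfl rfl
    have hsimple := cube_simpleVertex (b := b')
    obtain ⟨m, hm⟩ := hsimple.edge_at (hA' ▸ h.edge_DA.symm)
    have hD1 : HasCoords b' (cubeNbr b' 1) 1 (-1) 1 := cubeNbr_coords 1
    have hC1 : HasCoords b' (vertexPt b' (-1) (-1) 1 (by norm_num)) (-1) (-1) 1 :=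
      vertexPt_coords _ _ _ _
    have hDmem := (hface hD1).2 ⟨hsimple.mem_B 1, rfl⟩
    have hCmem := (hface hC1).2 ⟨hC1.mem_cube.2 (by simp), rfl⟩
    have hne : ∀ {y z : S2} {u v w u' v' w' : ℝ}, HasCoords b' y u v w → HasCoords b' z u' v' w' →
        y = z → u = u' ∧ v = v' ∧ w = w' := fun hy hz hyz => hy.inj (hyz ▸ hz)
    have hDBD : D = B ∨ D = cubeNbr b' 1 := by
      fin_cases m
      · exact Or.inl (hm.trans ((cubeNbr_coords 0).ext hB rfl rfl rfl))
      · exact Or.inr hm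
      · exfalso
        have hD2 : HasCoords b' D 1 1 (-1) := hm ▸ cubeNbr_coords 2
        have := ((hface hD2).1 (by simp)).2
        norm_num at this
    have hD' : D = cubeNbr b' 1 := by
      rcases hDmem with h1 | h1 | h1 | h1
      · have := (hne hD1 hA h1).2.1; norm_num at this
      · have := (hne hD1 hB h1).1; norm_num at this
      · have := cube_edge_inner h.edge_BC hB (h1 ▸ hD1); norm_num at this
      · exact h1.symm
    have hC' : C = vertexPt b' (-1) (-1) 1 (by norm_num) := by
      rcases hCmem with h1 | h1 | h1 | h1
      · have := (hne hC1 hA h1).2.1; norm_num at this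
      · have := (hne hC1 hB h1).2.1; norm_num at this
      · exact h1.symm
      · have := (hne hC1 hD1 (h1.trans hD')).1; norm_num at this
    exact ⟨hA, hB, hC' ▸ hC1, hD' ▸ hD1⟩
  obtain ⟨g, hg, hgA, hgB⟩ := exists_normalizing cube_simpleVertex rotW_cubeNbr tetra_le_cube
    h.mem_A h.edge_AB
  obtain ⟨b', hT, hO, -, hc⟩ := exists_basis_apply hg
  have hA : HasCoords b' A 1 1 1 := (hc _ _ _ _).2 (hgA ▸ baseVertex_coords)
  have hB : HasCoords b' B (-1) 1 1 := (hc _ _ _ _).2 (hgB ▸ cubeNbr_coords 0)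
  rw [← hT, ← hO] at h ⊢
  clear hc hgA hgB hg hT hO
  have hA' : A = baseVertex b' := hA.ext baseVertex_coords rfl rfl rfl
  obtain ⟨k, hk⟩ := (cube_simpleVertex (b := b')).face_at h.face
    (by rw [hA']; exact Set.mem_insert _ _)
  have hface : ∀ {y u v w}, HasCoords b' y u v w → (y ∈ ({A, B, C, D} : Set S2) ↔
      y ∈ cube b' ∧ ![u, v, w] k = 1) := fun hy => by
    rw [hk]; exact mem_cube_face hy k
  have hBf := ((hface hB).1 (by simp)).2
  fin_cases k
  · norm_num at hBf
  · have hr : ∀ {y u v w}, HasCoords (b'.reindex (Equiv.swap 1 2)) y u v w ↔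
        HasCoords b' y u w v := by
      intro y u v w
      have e0 : Equiv.swap (1 : Fin 3) 2 0 = 0 := by decide
      simp only [HasCoords, OrthonormalBasis.repr_reindex, Equiv.symm_swap, e0,
        Equiv.swap_apply_left, Equiv.swap_apply_right]
      tauto
    refine ⟨b'.reindex (Equiv.swap 1 2), tetra_reindex _, cube_reindex _,
      aux _ (hr.2 hA) (hr.2 hB) (by rwa [tetra_reindex, cube_reindex]) fun hy => ?_⟩
    rw [cube_reindex]
    exact hface (hr.1 hy)
  · exact ⟨b', rfl, rfl, aux b' hA hB h hface⟩

end

section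

variable {b : OrthonormalBasis (Fin 3) ℝ E3} {A B C D E : S2}

/-! ### The icosahedral case -/

theorem exists_pentagonCoords_points (b : OrthonormalBasis (Fin 3) ℝ E3) :
    ∃ A B C D E, PentagonCoords b A B C D E :=
  ⟨_, _, _, _, _, vertexPt_coords _ _ _ (by norm_num),
    vertexPt_coords _ _ _ (by linear_combination 2 * golden_sq),
    vertexPt_coords _ _ _ (by linear_combination 2 * golden_sq),
    vertexPt_coords _ _ _ (by norm_num), vertexPt_coords _ _ _ (by linear_combination 2 * golden_sq)⟩

namespace PentagonCoords

theorem rotP (h : PentagonCoords b A B C D E) :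
    quatRot b quatP A = B ∧ quatRot b quatP B = C ∧ quatRot b quatP C = D ∧
      quatRot b quatP D = E ∧ quatRot b quatP E = A := by
  have hs := golden_sq
  refine ⟨h.hA.rotP.ext h.hB ?_ ?_ ?_, h.hB.rotP.ext h.hC ?_ ?_ ?_, h.hC.rotP.ext h.hD ?_ ?_ ?_,
    h.hD.rotP.ext h.hE ?_ ?_ ?_, h.hE.rotP.ext h.hA ?_ ?_ ?_⟩ <;> linarith

theorem ne (h : PentagonCoords b A B C D E) :
    A ≠ B ∧ A ≠ C ∧ A ≠ D ∧ A ≠ E ∧ B ≠ C ∧ B ≠ D ∧ B ≠ E ∧ C ≠ D ∧ C ≠ E ∧ D ≠ E := by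
  have hg := golden_gt
  refine ⟨?_, ?_, ?_, ?_, ?_, ?_, ?_, ?_, ?_, ?_⟩ <;> rintro rfl
  · have := (h.hA.inj h.hB).1; norm_num at this
  · have := (h.hA.inj h.hC).1; norm_num at this
  · have := (h.hA.inj h.hD).2.1; norm_num at this
  · have := (h.hA.inj h.hE).2.1; norm_num at this
  · have := (h.hB.inj h.hC).2.1; linarith
  · have := (h.hB.inj h.hD).1; norm_num at this
  · have := (h.hB.inj h.hE).1; linarith
  · have := (h.hC.inj h.hD).1; norm_num at this
  · have := (h.hC.inj h.hE).1; linarith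
  · have := (h.hD.inj h.hE).2.1; norm_num at this

theorem face_eq (h : PentagonCoords b A B C D E) : ({A, B, C, D, E} : Set S2) =
    {v ∈ dodec b | inner ℝ (coordVec b ((!![φ, 1, 0; 0, φ, 1; 1, 0, φ] :
      Matrix (Fin 3) (Fin 3) ℝ) 2)) (v : E3) = (φ + 1) * (1 / √3)} := by
  have hs := golden_sq
  have hg := golden_gt
  have hl := golden_lt
  ext x
  obtain ⟨u, v, w, hx⟩ := exists_hasCoords (b := b) x
  rw [mem_dodec_face hx]
  simp only [Set.mem_insert_iff, Set.mem_singleton_iff, Matrix.cons_val]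
  constructor
  · rintro (rfl | rfl | rfl | rfl | rfl)
    · obtain ⟨rfl, rfl, rfl⟩ := hx.inj h.hA
      exact ⟨hx.mem_dodec.2 (by simp), by linarith⟩
    · obtain ⟨rfl, rfl, rfl⟩ := hx.inj h.hB
      exact ⟨hx.mem_dodec.2 (by simp), by linarith⟩
    · obtain ⟨rfl, rfl, rfl⟩ := hx.inj h.hC
      exact ⟨hx.mem_dodec.2 (by simp), by linarith⟩
    · obtain ⟨rfl, rfl, rfl⟩ := hx.inj h.hD
      exact ⟨hx.mem_dodec.2 (by simp), by linarith⟩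
    · obtain ⟨rfl, rfl, rfl⟩ := hx.inj h.hE
      exact ⟨hx.mem_dodec.2 (by simp), by linarith⟩
  · rintro ⟨hxV, he⟩
    rw [hx.mem_dodec] at hxV
    rcases hxV with ⟨rfl | rfl, rfl | rfl, rfl | rfl⟩ | ⟨rfl, rfl | rfl, rfl | rfl⟩ |
      ⟨rfl, rfl | rfl, rfl | rfl⟩ | ⟨rfl, rfl | rfl, rfl | rfl⟩ <;>
    first
    | (exfalso; linarith)
    | exact Or.inl (hx.ext h.hA rfl rfl rfl)
    | exact Or.inr (Or.inl (hx.ext h.hB rfl rfl rfl))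
    | exact Or.inr (Or.inr (Or.inl (hx.ext h.hC rfl rfl rfl)))
    | exact Or.inr (Or.inr (Or.inr (Or.inl (hx.ext h.hD rfl rfl rfl))))
    | exact Or.inr (Or.inr (Or.inr (Or.inr (hx.ext h.hE rfl rfl rfl))))

theorem isFace (h : PentagonCoords b A B C D E) : IsFace (dodec b) {A, B, C, D, E} := by
  rw [h.face_eq]
  exact dodec_simpleVertex.isFace 2

theorem edge_AB (h : PentagonCoords b A B C D E) : IsEdge (dodec b) A B := by
  have h1 := dodec_simpleVertex.isEdge (V := dodec b) 0
  rwa [baseVertex_coords.ext h.hA rfl rfl rfl, (dodecNbr_coords 0).ext h.hB rfl rfl rfl] at h1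

theorem isPentagonLabelling (h : PentagonCoords b A B C D E) :
    IsPentagonLabelling (tetra b) (dodec b) A B C D E := by
  obtain ⟨hA, hB, hC, hD, hE⟩ := h.rotP
  have hP := rotP_mem_dodec (b := b)
  have e1 := h.edge_AB
  have e2 := isEdge_image hP e1
  rw [hA, hB] at e2
  have e3 := isEdge_image hP e2
  rw [hB, hC] at e3
  have e4 := isEdge_image hP e3
  rw [hC, hD] at e4
  have e5 := isEdge_image hP e4
  rw [hD, hE] at e5
  refine ⟨h.isFace, e1, e2, e3, e4, e5, h.hA.mem_tetra.2 (by simp), polePt b,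
    polePt_mem_edgeMidpoints_tetra, ?_⟩
  have h3 : (√3)⁻¹ * √3 = 1 := inv_mul_cancel₀ (by positivity)
  have hφ := golden_gt
  -- The middle point of BC is (0, 0, φ)/√3.
  refine isRadialProj_of_coords polePt_coords (r := φ * (√3)⁻¹) (by positivity) ?_ ?_ ?_ <;>
    rw [midpoint_coord]
  · rw [h.hB.1, h.hC.1]; ring
  · rw [h.hB.2.1, h.hC.2.1]; ring
  · rw [h.hB.2.2, h.hC.2.2]; linear_combination -φ * (1 / √3) * h3

theorem image_face (h : PentagonCoords b A B C D E) :
    quatRot b quatP '' {A, B, C, D, E} = {A, B, C, D, E} := by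
  obtain ⟨hA, hB, hC, hD, hE⟩ := h.rotP
  simp only [Set.image_insert_eq, Set.image_singleton, hA, hB, hC, hD, hE]
  ext x
  simp only [Set.mem_insert_iff, Set.mem_singleton_iff]
  tauto

theorem faceCentre_coords (h : PentagonCoords b A B C D E) :
    b.repr (faceCentre {A, B, C, D, E}) 0 = (φ + 2) / 5 * (1 / √3) ∧
    b.repr (faceCentre {A, B, C, D, E}) 1 = 0 ∧
    b.repr (faceCentre {A, B, C, D, E}) 2 = (3 * φ + 1) / 5 * (1 / √3) := by
  have hr : ({A, B, C, D, E} : Set S2) = Set.range ![A, B, C, D, E] := by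
    simp only [Matrix.range_cons, Matrix.range_empty, Set.union_empty, Set.singleton_union]
  have hinj : Function.Injective ![A, B, C, D, E] := by
    obtain ⟨h1, h2, h3, h4, h5, h6, h7, h8, h9, h10⟩ := h.ne
    intro i j hij
    fin_cases i <;> fin_cases j <;> first | rfl | (exfalso; simp at hij; simp_all)
  rw [hr, faceCentre_range hinj]
  refine ⟨?_, ?_, ?_⟩
  · simp [Fin.sum_univ_five, h.hA.1, h.hB.1, h.hC.1, h.hD.1, h.hE.1]
    ring
  · simp [Fin.sum_univ_five, h.hA.2.1, h.hB.2.1, h.hC.2.1, h.hD.2.1, h.hE.2.1]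
    ring
  · simp [Fin.sum_univ_five, h.hA.2.2, h.hB.2.2, h.hC.2.2, h.hD.2.2, h.hE.2.2]
    ring

end PentagonCoords

theorem isRadialProj_self (x : S2) : IsRadialProj (x : E3) x := ⟨1, one_pos, (one_smul ℝ _).symm⟩

theorem ne_zero_of_repr {p : E3} {i : Fin 3} (h : b.repr p i ≠ 0) : p ≠ 0 := by
  rintro rfl
  simp at h

theorem not_mem_specialPoints {p : E3} {x : S2} {u v w : ℝ} (hp : IsRadialProj p x)
    (h0 : b.repr p 0 = u * (1 / √3)) (h1 : b.repr p 1 = v * (1 / √3))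
    (h2 : b.repr p 2 = w * (1 / √3)) (h : ¬ IsSpecialTriple u v w) :
    x ∉ specialPoints (tetra b) := fun hx => by
  have h3 := isSpecialTriple_of_mem hp hx
  rw [h0, h1, h2, mul_comm u, mul_comm v, mul_comm w,
    isSpecialTriple_smul inv_sqrt_three_pos.ne'] at h3
  exact h h3

theorem specialPoints_subset {V W : Set S2} (h1 : V ⊆ specialPoints W)
    (h2 : faceCentres V ⊆ specialPoints W) (h3 : edgeMidpoints V ⊆ specialPoints W) :
    specialPoints V ⊆ specialPoints W :=
  Set.union_subset (Set.union_subset h1 h2) h3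

/-- With g the fifth of a turn of the pentagon, the coset decomposition is applied to A, N and Q.
Among the images of A, the points B, C, E lie in one G-orbit and D is antipodal to a vertex of the
tetrahedron; N is fixed; the images of Q are the midpoints of the sides, which G identifies in pairs
except for BC. -/
theorem icosahedral_orbits (h : PentagonCoords b A B C D E) :
    ∃ N Q R : S2, ∃ g ∈ rotations,
      IsRadialProj (faceCentre {A, B, C, D, E}) N ∧
      IsRadialProj (midpoint ℝ (A : E3) (B : E3)) Q ∧
      IsRadialProj (midpoint ℝ (D : E3) (E : E3)) R ∧
      g '' {A, B, C, D, E} = {A, B, C, D, E} ∧ g A = B ∧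
      B ∉ specialPoints (tetra b) ∧ N ∉ specialPoints (tetra b) ∧
      Q ∉ specialPoints (tetra b) ∧ R ∉ specialPoints (tetra b) ∧
      dodec b = tetra b ∪ faceCentres (tetra b) ∪ rotOrbit (tetra b) B ∧
      faceCentres (dodec b) = rotOrbit (tetra b) N ∧
      edgeMidpoints (dodec b)
        = edgeMidpoints (tetra b) ∪ rotOrbit (tetra b) Q ∪ rotOrbit (tetra b) R ∧
      ∀ X : S2, X ∉ specialPoints (dodec b) →
        (∀ i : ℕ, (g ^ i) X ∉ specialPoints (tetra b)) ∧
        rotOrbit (dodec b) X = rotOrbit (tetra b) X ∪ rotOrbit (tetra b) (g X) ∪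
          rotOrbit (tetra b) ((g ^ 2) X) ∪ rotOrbit (tetra b) ((g ^ 3) X) ∪
          rotOrbit (tetra b) ((g ^ 4) X) := by
  have hgt := golden_gt
  have hs := golden_sq
  have hi := inv_sqrt_three_pos
  obtain ⟨gA, gB, gC, gD, gE⟩ := h.rotP
  obtain ⟨c0, c1, c2⟩ := h.faceCentre_coords
  have hrot := quatP_rep.mem_rotations (b := b)
  have hPm := rotP_mem_dodec (b := b)
  have hIT := rotI_mem_tetra (b := b)
  have hJT := rotJ_mem_tetra (b := b)
  have hWT := rotW_mem_tetra (b := b)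
  have hRV := dodec_regularVertex (b := b)
  have hTV := tetra_regularVertex (b := b)
  have q0 : b.repr (midpoint ℝ (A : E3) (B : E3)) 0 = 1 / 2 * (1 / √3) := by
    rw [midpoint_coord, h.hA.1, h.hB.1]; ring
  have q1 : b.repr (midpoint ℝ (A : E3) (B : E3)) 1 = φ / 2 * (1 / √3) := by
    rw [midpoint_coord, h.hA.2.1, h.hB.2.1]; ring
  have q2 : b.repr (midpoint ℝ (A : E3) (B : E3)) 2 = (φ + 1) / 2 * (1 / √3) := by
    rw [midpoint_coord, h.hA.2.2, h.hB.2.2]; ring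
  have r0 : b.repr (midpoint ℝ (D : E3) (E : E3)) 0 = (φ + 1) / 2 * (1 / √3) := by
    rw [midpoint_coord, h.hD.1, h.hE.1]; ring
  have r1 : b.repr (midpoint ℝ (D : E3) (E : E3)) 1 = -1 / 2 * (1 / √3) := by
    rw [midpoint_coord, h.hD.2.1, h.hE.2.1]; ring
  have r2 : b.repr (midpoint ℝ (D : E3) (E : E3)) 2 = φ / 2 * (1 / √3) := by
    rw [midpoint_coord, h.hD.2.2, h.hE.2.2]; ring
  obtain ⟨N, hN⟩ := exists_radialProj (p := faceCentre {A, B, C, D, E})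
    (ne_zero_of_repr (b := b) (i := 0) (by rw [c0]; positivity))
  obtain ⟨Q, hQ⟩ := exists_radialProj (p := midpoint ℝ (A : E3) (B : E3))
    (ne_zero_of_repr (b := b) (i := 0) (by rw [q0]; positivity))
  obtain ⟨R, hR⟩ := exists_radialProj (p := midpoint ℝ (D : E3) (E : E3))
    (ne_zero_of_repr (b := b) (i := 0) (by rw [r0]; positivity))
  have hVT : tetra b = rotOrbit (tetra b) A := hTV.eq_rotOrbit (h.hA.mem_tetra.2 (by simp))
  have hFT : faceCentres (tetra b) = rotOrbit (tetra b) D := hTV.faceCentres_eq_rotOrbit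
    (mem_faceCentres_tetra.2 (h.hD.neg.mem_tetra.2 (by simp)))
  have hCB : rotOrbit (tetra b) C = rotOrbit (tetra b) B := by
    rw [← rotOrbit_apply (mul_mem hIT hJT) B]
    congr 1
    exact h.hC.ext h.hB.rotJ.rotI (by simp) rfl (by simp)
  have hEB : rotOrbit (tetra b) E = rotOrbit (tetra b) B := by
    rw [← rotOrbit_apply hWT B]
    congr 1
    exact h.hE.ext h.hB.rotW rfl rfl rfl
  have hV : dodec b = tetra b ∪ faceCentres (tetra b) ∪ rotOrbit (tetra b) B := by
    conv_lhs => rw [hRV.eq_rotOrbit (h.hA.mem_dodec.2 (by simp)), rotOrbit_dodec]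
    simp only [pow_succ, pow_zero, one_mul, Equiv.Perm.mul_apply, gA, gB, gC, gD, hCB, hEB]
    rw [← hVT, ← hFT]
    ext x
    simp only [Set.mem_union]
    tauto
  have hNface : N ∈ faceCentres (dodec b) := ⟨_, h.isFace, hN⟩
  have gN : quatRot b quatP N = N := faceCentre_radialProj (by simp) hrot h.image_face hN
  have hF : faceCentres (dodec b) = rotOrbit (tetra b) N := by
    rw [hRV.faceCentres_eq_rotOrbit hNface, rotOrbit_dodec]
    simp only [pow_succ, pow_zero, one_mul, Equiv.Perm.mul_apply, gN, Set.union_self]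
  have hlab := h.isPentagonLabelling
  have m1 := midpoint_radialProj hrot gA gB hQ
  have m2 := midpoint_radialProj hrot gB gC m1
  have m3 := midpoint_radialProj hrot gC gD m2
  have m4 := midpoint_radialProj hrot gD gE m3
  have hE1 : rotOrbit (tetra b) (quatRot b quatP Q) = edgeMidpoints (tetra b) := by
    obtain ⟨x, hx, hxp⟩ := hlab.mid_BC
    rw [m1.unique hxp]
    exact (hTV.edgeMidpoints_eq_rotOrbit hx).symm
  have hE3 : quatRot b quatP (quatRot b quatP (quatRot b quatP Q)) = R := m3.unique hR
  -- The product of the half-turn and the cyclic rotation fixes D and takes C to E, so the midpoints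
  -- of CD and DE are in one G-orbit.
  have hE2 : rotOrbit (tetra b) (quatRot b quatP (quatRot b quatP Q)) = rotOrbit (tetra b) R := by
    rw [← rotOrbit_apply (mul_mem hIT hWT)]
    congr 1
    refine (midpoint_radialProj (mul_mem hIT hWT).1 (P' := E) (Q' := D) ?_ ?_ m2).unique
      (by rwa [midpoint_comm])
    · exact h.hC.rotW.rotI.ext h.hE rfl (by simp) (by simp)
    · exact h.hD.rotW.rotI.ext h.hD rfl rfl (by simp)
  -- The cyclic rotation fixes A and takes B to E, so the midpoints of AB and EA are in one G-orbit.
  have hE4 : rotOrbit (tetra b) (quatRot b quatP (quatRot b quatP (quatRot b quatP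
      (quatRot b quatP Q)))) = rotOrbit (tetra b) Q := by
    rw [← rotOrbit_apply hWT Q]
    congr 1
    refine m4.unique ?_
    rw [midpoint_comm]
    exact midpoint_radialProj hWT.1 (h.hA.rotW.ext h.hA rfl rfl rfl) (h.hB.rotW.ext h.hE rfl rfl rfl)
      hQ
  have hE : edgeMidpoints (dodec b)
      = edgeMidpoints (tetra b) ∪ rotOrbit (tetra b) Q ∪ rotOrbit (tetra b) R := by
    rw [hRV.edgeMidpoints_eq_rotOrbit ⟨A, B, h.edge_AB, hQ⟩, rotOrbit_dodec]
    simp only [pow_succ, pow_zero, one_mul, Equiv.Perm.mul_apply, hE4, hE2, hE1]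
    rw [hE3]
    ext x
    simp only [Set.mem_union]
    tauto
  refine ⟨N, Q, R, _, hrot, hN, hQ, hR, h.image_face, gA, ?_, ?_, ?_, ?_, hV, hF, hE,
    fun X hX => ⟨fun i hi => ?_, rotOrbit_dodec X⟩⟩
  · refine not_mem_specialPoints (isRadialProj_self B) h.hB.1 h.hB.2.1 h.hB.2.2 ?_
    rintro (⟨h1, h2⟩ | ⟨h1, h2, h3⟩) <;> nlinarith
  · refine not_mem_specialPoints hN c0 (by rw [c1, zero_mul]) c2 ?_
    rintro (⟨h1, h2⟩ | ⟨h1, h2, h3⟩) <;> nlinarith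
  · refine not_mem_specialPoints hQ q0 q1 q2 ?_
    rintro (⟨h1, h2⟩ | ⟨h1, h2, h3⟩) <;> nlinarith
  · refine not_mem_specialPoints hR r0 r1 r2 ?_
    rintro (⟨h1, h2⟩ | ⟨h1, h2, h3⟩) <;> nlinarith
  -- By the formulas just proved, special points of the tetrahedron are special for the
  -- dodecahedron, whose special points are invariant under g.
  · refine hX (hRV.mem_specialPoints_of_apply (pow_mem hPm i) (specialPoints_subset ?_ ?_ ?_ hi))
    · exact fun x hx => Or.inl (Or.inl (hV ▸ Or.inl (Or.inl hx)))
    · exact fun x hx => Or.inl (Or.inl (hV ▸ Or.inl (Or.inr hx)))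
    · exact fun x hx => Or.inr (hE ▸ Or.inl (Or.inl hx))

end

section

variable {b : OrthonormalBasis (Fin 3) ℝ E3} {A B C D : S2}

/-! ### The octahedral case -/

theorem exists_squareCoords_points (b : OrthonormalBasis (Fin 3) ℝ E3) :
    ∃ A B C D, SquareCoords b A B C D :=
  ⟨_, _, _, _, vertexPt_coords _ _ _ (by norm_num), vertexPt_coords _ _ _ (by norm_num),
    vertexPt_coords _ _ _ (by norm_num), vertexPt_coords _ _ _ (by norm_num)⟩

namespace SquareCoords

theorem rotO (h : SquareCoords b A B C D) :
    quatRot b quatO A = B ∧ quatRot b quatO B = C ∧ quatRot b quatO C = D ∧ quatRot b quatO D = A :=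
  ⟨h.hA.rotO.ext h.hB rfl rfl rfl, h.hB.rotO.ext h.hC rfl rfl rfl,
    h.hC.rotO.ext h.hD (neg_neg _) rfl rfl, h.hD.rotO.ext h.hA (neg_neg _) rfl rfl⟩

theorem ne (h : SquareCoords b A B C D) : A ≠ B ∧ A ≠ C ∧ A ≠ D ∧ B ≠ C ∧ B ≠ D ∧ C ≠ D := by
  refine ⟨?_, ?_, ?_, ?_, ?_, ?_⟩ <;> rintro rfl
  · have := (h.hA.inj h.hB).1; norm_num at this
  · have := (h.hA.inj h.hC).1; norm_num at this
  · have := (h.hA.inj h.hD).2.1; norm_num at this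
  · have := (h.hB.inj h.hC).2.1; norm_num at this
  · have := (h.hB.inj h.hD).1; norm_num at this
  · have := (h.hC.inj h.hD).1; norm_num at this

theorem face_eq (h : SquareCoords b A B C D) : ({A, B, C, D} : Set S2) =
    {v ∈ cube b | inner ℝ (coordVec b ((!![1, 0, 0; 0, 1, 0; 0, 0, 1] :
      Matrix (Fin 3) (Fin 3) ℝ) 2)) (v : E3) = 1 * (1 / √3)} := by
  ext x
  obtain ⟨u, v, w, hx⟩ := exists_hasCoords (b := b) x
  rw [mem_cube_face hx, hx.mem_cube]
  simp only [Set.mem_insert_iff, Set.mem_singleton_iff, Matrix.cons_val]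
  constructor
  · rintro (rfl | rfl | rfl | rfl)
    · obtain ⟨rfl, rfl, rfl⟩ := hx.inj h.hA
      simp
    · obtain ⟨rfl, rfl, rfl⟩ := hx.inj h.hB
      simp
    · obtain ⟨rfl, rfl, rfl⟩ := hx.inj h.hC
      simp
    · obtain ⟨rfl, rfl, rfl⟩ := hx.inj h.hD
      simp
  · rintro ⟨⟨rfl | rfl, rfl | rfl, -⟩, rfl⟩
    · exact Or.inl (hx.ext h.hA rfl rfl rfl)
    · exact Or.inr (Or.inr (Or.inr (hx.ext h.hD rfl rfl rfl)))
    · exact Or.inr (Or.inl (hx.ext h.hB rfl rfl rfl))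
    · exact Or.inr (Or.inr (Or.inl (hx.ext h.hC rfl rfl rfl)))

theorem isFace (h : SquareCoords b A B C D) : IsFace (cube b) {A, B, C, D} := by
  rw [h.face_eq]
  exact cube_simpleVertex.isFace 2

theorem edge_AB (h : SquareCoords b A B C D) : IsEdge (cube b) A B := by
  have h1 := cube_simpleVertex.isEdge (V := cube b) 0
  rwa [baseVertex_coords.ext h.hA rfl rfl rfl, (cubeNbr_coords 0).ext h.hB rfl rfl rfl] at h1

theorem isSquareLabelling (h : SquareCoords b A B C D) :
    IsSquareLabelling (tetra b) (cube b) A B C D := by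
  obtain ⟨hA, hB, hC, hD⟩ := h.rotO
  have hO := rotO_mem_cube (b := b)
  have e1 := h.edge_AB
  have e2 := isEdge_image hO e1
  rw [hA, hB] at e2
  have e3 := isEdge_image hO e2
  rw [hB, hC] at e3
  have e4 := isEdge_image hO e3
  rw [hC, hD] at e4
  exact ⟨h.isFace, e1, e2, e3, e4, h.hA.mem_tetra.2 (by simp)⟩

theorem image_face (h : SquareCoords b A B C D) :
    quatRot b quatO '' {A, B, C, D} = {A, B, C, D} := by
  obtain ⟨hA, hB, hC, hD⟩ := h.rotO
  simp only [Set.image_insert_eq, Set.image_singleton, hA, hB, hC, hD]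
  ext x
  simp only [Set.mem_insert_iff, Set.mem_singleton_iff]
  tauto

theorem polePt_radialProj (h : SquareCoords b A B C D) :
    IsRadialProj (faceCentre {A, B, C, D}) (polePt b) := by
  have hr : ({A, B, C, D} : Set S2) = Set.range ![A, B, C, D] := by
    simp only [Matrix.range_cons, Matrix.range_empty, Set.union_empty, Set.singleton_union]
  have hinj : Function.Injective ![A, B, C, D] := by
    obtain ⟨h1, h2, h3, h4, h5, h6⟩ := h.ne
    intro i j hij
    fin_cases i <;> fin_cases j <;> first | rfl | (exfalso; simp at hij; simp_all)
  have h3 : (√3)⁻¹ * √3 = 1 := inv_mul_cancel₀ (by positivity)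
  rw [hr, faceCentre_range hinj]
  refine isRadialProj_of_coords polePt_coords (r := (√3)⁻¹) (by positivity) ?_ ?_ ?_
  · simp [Fin.sum_univ_four, h.hA.1, h.hB.1, h.hC.1, h.hD.1]
  · simp [Fin.sum_univ_four, h.hA.2.1, h.hB.2.1, h.hC.2.1, h.hD.2.1]
  · rw [← mul_assoc, h3]
    simp [Fin.sum_univ_four, h.hA.2.2, h.hB.2.2, h.hC.2.2, h.hD.2.2]
    ring

end SquareCoords

/-- The index is two and g is the quarter turn of the square. It takes A to B, the antipode of a
vertex of the tetrahedron, and fixes the face centre, which lies on a coordinate axis. -/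
theorem octahedral_orbits (h : SquareCoords b A B C D) :
    ∃ P : S2, ∃ g ∈ rotations,
      IsRadialProj (midpoint ℝ (A : E3) (B : E3)) P ∧
      g '' {A, B, C, D} = {A, B, C, D} ∧ g A = B ∧
      P ∉ specialPoints (tetra b) ∧
      cube b = tetra b ∪ faceCentres (tetra b) ∧
      faceCentres (cube b) = edgeMidpoints (tetra b) ∧
      edgeMidpoints (cube b) = rotOrbit (tetra b) P ∧
      ∀ X : S2, X ∉ specialPoints (cube b) →
        (∀ i : ℕ, (g ^ i) X ∉ specialPoints (tetra b)) ∧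
        rotOrbit (cube b) X = rotOrbit (tetra b) X ∪ rotOrbit (tetra b) (g X) := by
  obtain ⟨gA, gB, gC, gD⟩ := h.rotO
  have hi := inv_sqrt_three_pos
  have hrot := quatO_rep.mem_rotations (b := b)
  have hOm := rotO_mem_cube (b := b)
  have hIT := rotI_mem_tetra (b := b)
  have hJT := rotJ_mem_tetra (b := b)
  have hWT := rotW_mem_tetra (b := b)
  have hRV := cube_regularVertex (b := b)
  have hTV := tetra_regularVertex (b := b)
  have q0 : b.repr (midpoint ℝ (A : E3) (B : E3)) 0 = 0 * (1 / √3) := by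
    rw [midpoint_coord, h.hA.1, h.hB.1]; ring
  have q1 : b.repr (midpoint ℝ (A : E3) (B : E3)) 1 = 1 * (1 / √3) := by
    rw [midpoint_coord, h.hA.2.1, h.hB.2.1]; ring
  have q2 : b.repr (midpoint ℝ (A : E3) (B : E3)) 2 = 1 * (1 / √3) := by
    rw [midpoint_coord, h.hA.2.2, h.hB.2.2]; ring
  obtain ⟨P, hP⟩ := exists_radialProj (p := midpoint ℝ (A : E3) (B : E3))
    (ne_zero_of_repr (b := b) (i := 1) (by rw [q1]; positivity))
  have hVT : tetra b = rotOrbit (tetra b) A := hTV.eq_rotOrbit (h.hA.mem_tetra.2 (by simp))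
  have hFT : faceCentres (tetra b) = rotOrbit (tetra b) B := hTV.faceCentres_eq_rotOrbit
    (mem_faceCentres_tetra.2 (h.hB.neg.mem_tetra.2 (by simp)))
  have hV : cube b = tetra b ∪ faceCentres (tetra b) := by
    conv_lhs => rw [hRV.eq_rotOrbit (h.hA.mem_cube.2 (by simp)), rotOrbit_cube, gA]
    rw [← hVT, ← hFT]
  have hF : faceCentres (cube b) = edgeMidpoints (tetra b) := by
    rw [hRV.faceCentres_eq_rotOrbit ⟨_, h.isFace, h.polePt_radialProj⟩, rotOrbit_cube,
      faceCentre_radialProj (by simp) hrot h.image_face h.polePt_radialProj, Set.union_self,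
      ← hTV.edgeMidpoints_eq_rotOrbit polePt_mem_edgeMidpoints_tetra]
  have m1 := midpoint_radialProj hrot gA gB hP
  -- An element of G fixes B and takes A to C, so the midpoints of AB and BC are in one G-orbit.
  have hE1 : rotOrbit (tetra b) (quatRot b quatO P) = rotOrbit (tetra b) P := by
    have hg := mul_mem (mul_mem hIT hJT) hWT
    rw [← rotOrbit_apply hg P]
    congr 1
    refine m1.unique ?_
    rw [midpoint_comm]
    exact midpoint_radialProj hg.1 (h.hA.rotW.rotJ.rotI.ext h.hC rfl rfl (by simp))
      (h.hB.rotW.rotJ.rotI.ext h.hB rfl (by simp) (by simp)) hP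
  have hE : edgeMidpoints (cube b) = rotOrbit (tetra b) P := by
    rw [hRV.edgeMidpoints_eq_rotOrbit ⟨A, B, h.edge_AB, hP⟩, rotOrbit_cube, hE1, Set.union_self]
  refine ⟨P, _, hrot, hP, h.image_face, gA, ?_, hV, hF, hE,
    fun X hX => ⟨fun i hi => ?_, rotOrbit_cube X⟩⟩
  · refine not_mem_specialPoints hP q0 q1 q2 ?_
    rintro (⟨h1, h2⟩ | ⟨h1, h2, h3⟩) <;> linarith
  · refine hX (hRV.mem_specialPoints_of_apply (pow_mem hOm i) (specialPoints_subset ?_ ?_ ?_ hi))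
    · exact fun x hx => Or.inl (Or.inl (hV ▸ Or.inl hx))
    · exact fun x hx => Or.inl (Or.inl (hV ▸ Or.inr hx))
    · exact fun x hx => Or.inl (Or.inr (hF ▸ hx))

end

theorem mainTheorem7 (VT : Set S2) (hVT : IsRegularTetrahedron VT) :
    -- the tetrahedral group is isomorphic to `A₄`
    Nonempty (rotationGroup VT ≃* alternatingGroup (Fin 4)) ∧
    -- the characterization of the finite sets with `𝒜_α = G`
    (∀ α : Set S2, α.Finite →
      (fixingGroup α = rotationGroup VT ↔
        IsUnionOfElements (orbitFamily VT) α ∧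
        (∀ VI : Set S2, IsRegularDodecahedron VI → rotationGroup VT ≤ rotationGroup VI →
          ¬ IsUnionOfElements (orbitFamily VI) α) ∧
        (∀ VO : Set S2, IsCube VO → rotationGroup VT ≤ rotationGroup VO →
          ¬ IsUnionOfElements (orbitFamily VO) α))) ∧
    -- containing icosahedral and octahedral groups exist
    (∃ VI : Set S2, IsRegularDodecahedron VI ∧ rotationGroup VT ≤ rotationGroup VI) ∧
    (∃ VO : Set S2, IsCube VO ∧ rotationGroup VT ≤ rotationGroup VO) ∧
    -- the orbits of a containing icosahedral group
    (∀ VI : Set S2, IsRegularDodecahedron VI → rotationGroup VT ≤ rotationGroup VI →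
      (∃ A B C D E : S2, IsPentagonLabelling VT VI A B C D E) ∧
      ∀ A B C D E : S2, IsPentagonLabelling VT VI A B C D E →
        ∃ N Q R : S2, ∃ g ∈ rotations,
          IsRadialProj (faceCentre {A, B, C, D, E}) N ∧
          IsRadialProj (midpoint ℝ (A : E3) (B : E3)) Q ∧
          IsRadialProj (midpoint ℝ (D : E3) (E : E3)) R ∧
          g '' {A, B, C, D, E} = {A, B, C, D, E} ∧ g A = B ∧
          B ∉ specialPoints VT ∧ N ∉ specialPoints VT ∧
          Q ∉ specialPoints VT ∧ R ∉ specialPoints VT ∧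
          VI = VT ∪ faceCentres VT ∪ rotOrbit VT B ∧
          faceCentres VI = rotOrbit VT N ∧
          edgeMidpoints VI = edgeMidpoints VT ∪ rotOrbit VT Q ∪ rotOrbit VT R ∧
          ∀ X : S2, X ∉ specialPoints VI →
            (∀ i : ℕ, (g ^ i) X ∉ specialPoints VT) ∧
            rotOrbit VI X = rotOrbit VT X ∪ rotOrbit VT (g X) ∪ rotOrbit VT ((g ^ 2) X) ∪
              rotOrbit VT ((g ^ 3) X) ∪ rotOrbit VT ((g ^ 4) X)) ∧
    -- the orbits of a containing octahedral group
    (∀ VO : Set S2, IsCube VO → rotationGroup VT ≤ rotationGroup VO →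
      (∃ A B C D : S2, IsSquareLabelling VT VO A B C D) ∧
      ∀ A B C D : S2, IsSquareLabelling VT VO A B C D →
        ∃ P : S2, ∃ g ∈ rotations,
          IsRadialProj (midpoint ℝ (A : E3) (B : E3)) P ∧
          g '' {A, B, C, D} = {A, B, C, D} ∧ g A = B ∧
          P ∉ specialPoints VT ∧
          VO = VT ∪ faceCentres VT ∧
          faceCentres VO = edgeMidpoints VT ∧
          edgeMidpoints VO = rotOrbit VT P ∧
          ∀ X : S2, X ∉ specialPoints VO →
            (∀ i : ℕ, (g ^ i) X ∉ specialPoints VT) ∧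
            rotOrbit VO X = rotOrbit VT X ∪ rotOrbit VT (g X)) := by
  obtain ⟨b, rfl⟩ := exists_tetra hVT
  refine ⟨rotationGroup_tetra_equiv, fun α hα => fixingGroup_eq_tetra_iff hα,
    ⟨dodec b, isRegularDodecahedron_iff.2 ⟨b, rfl⟩, tetra_le_dodec⟩,
    ⟨cube b, isCube_iff.2 ⟨b, rfl⟩, tetra_le_cube⟩, fun VI hVI hle => ?_, fun VO hVO hle => ?_⟩
  -- Two dodecahedra are possible over one tetrahedron, hence a new frame here; the cube is unique
  -- and keeps the frame b.
  · obtain ⟨b₁, h₁, rfl⟩ := dodec_of_tetra_le hVI hle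
    rw [← h₁]
    constructor
    · obtain ⟨A, B, C, D, E, h⟩ := exists_pentagonCoords_points b₁
      exact ⟨A, B, C, D, E, h.isPentagonLabelling⟩
    · intro A B C D E h
      obtain ⟨b₂, h₂, h₃, h⟩ := exists_pentagonCoords h
      rw [← h₂, ← h₃]
      exact icosahedral_orbits h
  · obtain rfl := cube_of_tetra_le hVO hle
    constructor
    · obtain ⟨A, B, C, D, h⟩ := exists_squareCoords_points b
      exact ⟨A, B, C, D, h.isSquareLabelling⟩
    · intro A B C D h
      obtain ⟨b₂, h₂, h₃, h⟩ := exists_squareCoords h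
      rw [← h₂, ← h₃]
      exact octahedral_orbits h
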